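/- Let $\Omega\subset\mathbb R^2$ be a bounded polygonal domain with Lipschitz boundary, let $q^1,\dots,q^n\in\mathbb R$, $f\in H^1(\Omega)$, and let $\epsilon\in C(\bar\Omega)$ satisfy $0<\epsilon_0\le\epsilon\le\epsilon_1$. Let $\mathcal T^h$ be a conforming triangulation of $\Omega$ such that each (closed) element $\tau$ contains a disc of radius $h_\tau/\kappa$, where $h_\tau$ is the diameter of $\tau$. Let $S_0^h\subset H^1_0(\Omega)$ be the space of functions in $H_0^1(\Omega)$ that are affine on each element, and let $\varphi_z$ be the nodal (piecewise affine) basis function of the vertex $z$. Let $p^1,\dots,p^n,\phi\in H_0^1(\Omega)$ be a weak solution of the nonlinear Poisson--Nernst--Planck system $$-\nabla\cdot\big(\alpha(x,p^i)\nabla p^i+\beta(x,p^i)+\gamma(x,p^i)\nabla\phi\big)+g(x,p^i)=0\quad(1\le i\le n),\qquad -\nabla\cdot(\epsilon\nabla\phi)-\sum_{i=1}^n q^ip^i=f,$$ that is, for all $v,w\in H^1_0(\Omega)$ and all $i$, $$\int_\Omega\big(\alpha(x,p^i)\nabla p^i+\beta(x,p^i)+\gamma(x,p^i)\nabla\phi\big)\cdot\nabla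 v+g(x,p^i)v=0,\qquad \int_\Omega\epsilon\nabla\phi\cdot\nabla w=\int_\Omega\Big(\sum_{i=1}^nq^ip^i+f\Big)w ,$$ and let $p_h^1,\dots,p_h^n,\phi_h\in S_0^h$ satisfy the same identities for all $v,w\in S_0^h$ (all integrals being well defined). The coefficients $\alpha,\beta,\gamma,g$ may depend on $i$. For each vertex $z$ let weights $\alpha_z^{\tau}\ge0$, indexed by the elements $\tau$ with vertex $z$, be given with $\sum_{\tau\ni z}\alpha_z^\tau=1$, and put $$G_h\phi_h=\sum_z\Big(\sum_{\tau\ni z}\alpha_z^\tau\,\epsilon(z)\,(\nabla\phi_h)|_\tau\Big)\varphi_z,\qquad D_h(\phi_h)=G_h\phi_h-\epsilon\nabla\phi_h,\qquad R_{1h}=\sum_{i=1}^nq^ip_h^i+\operatorname{div}(G_h\phi_h)+f .$$ For an element $\tau$ let $\omega_\tau$ be the union of all elements that intersect $\tau$, $h_{\omega_\tau}$ its diameter, and suppose $\epsilon\in W^{2,\infty}(\omega_\tau)$. Write $\|\cdot\|_{0,D}$ for the $L^2(D)$ norm, $\|\cdot\|_{1,D}$ and $|\cdot|_{1,D}$ for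 the $H^1(D)$ norm and seminorm. For an edge $l$ of length $h_l$ put $$\xi_{h,l}=1+h_l\,|\epsilon|_{1,\infty,l}\,\|\epsilon^{-1}\|_{0,\infty,l},\qquad \xi_{h,\omega_\tau}=\max_{l}\xi_{h,l},$$ where $|\epsilon|_{1,\infty,l}$ is the $W^{1,\infty}(l)$ seminorm of $\epsilon|_l$ and the maximum is over the edges $l$ of $\mathcal T^h$ whose relative interior lies in the interior of $\omega_\tau$ (and is $1$ if there are none). Then there is a constant $C>0$, depending only on $\kappa$, $\epsilon_0$, $\epsilon_1$, $n$ and $q^1,\dots,q^n$ (in particular not on the mesh), such that for every $\tau\in\mathcal T^h$ $$h_\tau\|R_{1h}\|_{0,\tau}+\|D_h(\phi_h)\|_{0,\tau}\le C\,\xi_{h,\omega_\tau}\Big(\|\nabla(\phi-\phi_h)\|_{0,\omega_\tau}+h_{\omega_\tau}\sum_{i=1}^n\|p^i-p^i_h\|_{0,\omega_\tau}\Big)+\widetilde r_{\phi_h,\omega_\tau},$$ with a number $\widetilde r_{\phi_h,\omega_\tau}$ satisfying $$\widetilde r_{\phi_h,\omega_\tau}\le C\,\xi_{h,\omega_\tau}\,h_{\omega_\tau}^2\big(\|\epsilon\|_{2,\infty,\omega_\tau}\|\phi_h\|_{1,\omega_\tau}+|f|_{1,\omega_\tau}\big).$$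 -/

import Mathlib

open MeasureTheory Set
open scoped ENNReal ContDiff

noncomputable section

namespace PNP

/-- The Euclidean plane. -/
abbrev Plane : Type := EuclideanSpace ℝ (Fin 2)

/-! ### Sobolev spaces through weak derivatives -/

/-- Smooth functions with compact support inside `U`. -/
def IsTestFunction (U : Set Plane) (ψ : Plane → ℝ) : Prop :=
  ContDiff ℝ ∞ ψ ∧ HasCompactSupport ψ ∧ tsupport ψ ⊆ U

/-- `v` is the weak partial derivative `∂ᵢ u` on the open set `U`. -/
def HasWeakPartial (U : Set Plane) (i : Fin 2) (u v : Plane → ℝ) : Prop :=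
  LocallyIntegrableOn u U ∧ LocallyIntegrableOn v U ∧
    ∀ ψ : Plane → ℝ, IsTestFunction U ψ →
      ∫ x in U, u x * fderiv ℝ ψ x (EuclideanSpace.single i 1) = - ∫ x in U, v x * ψ x

open Classical in
/-- The weak partial derivative (determined almost everywhere on `U` when it exists). -/
def weakPartial (U : Set Plane) (i : Fin 2) (u : Plane → ℝ) : Plane → ℝ :=
  if h : ∃ v, HasWeakPartial U i u v then h.choose else 0

/-- The weak gradient on `U`. -/
def weakGrad (U : Set Plane) (u : Plane → ℝ) (x : Plane) : Plane :=
  WithLp.toLp 2 fun i => weakPartial U i u x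

/-- `‖u‖_{0,D}`, for scalar or vector valued `u`. -/
def l2Norm {F : Type} [NormedAddCommGroup F] (D : Set Plane) (u : Plane → F) : ℝ :=
  (eLpNorm u 2 (volume.restrict D)).toReal

/-- `‖u‖_{0,∞,D}`. -/
def supNorm (D : Set Plane) (u : Plane → ℝ) : ℝ :=
  (eLpNorm u ∞ (volume.restrict D)).toReal

/-- `u ∈ H¹(Ω)`. -/
def MemH1 (Ω : Set Plane) (u : Plane → ℝ) : Prop :=
  MemLp u 2 (volume.restrict Ω) ∧
    ∀ i, ∃ v, HasWeakPartial Ω i u v ∧ MemLp v 2 (volume.restrict Ω)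

/-- `‖u‖_{1,D}` for `D ⊆ closure Ω` and `u ∈ H¹(Ω)`. -/
def h1Norm (Ω D : Set Plane) (u : Plane → ℝ) : ℝ :=
  Real.sqrt (l2Norm D u ^ 2 + l2Norm D (weakGrad Ω u) ^ 2)

/-- `u ∈ H¹₀(Ω)`: the closure of the test functions in `H¹(Ω)`. -/
def MemH10 (Ω : Set Plane) (u : Plane → ℝ) : Prop :=
  MemH1 Ω u ∧ ∀ δ > 0, ∃ ψ, IsTestFunction Ω ψ ∧ h1Norm Ω Ω (u - ψ) < δ

/-- `u ∈ W^{2,∞}(U)`. -/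
def MemW2Infty (U : Set Plane) (u : Plane → ℝ) : Prop :=
  MemLp u ∞ (volume.restrict U) ∧
    ∀ i, ∃ v, HasWeakPartial U i u v ∧ MemLp v ∞ (volume.restrict U) ∧
      ∀ j, ∃ w, HasWeakPartial U j v w ∧ MemLp w ∞ (volume.restrict U)

/-- `‖u‖_{2,∞,U}`: the sum of `‖D^β u‖_{0,∞,U}` over the multi-indices `|β| ≤ 2`. -/
def w2InftyNorm (U : Set Plane) (u : Plane → ℝ) : ℝ :=
  supNorm U u + ∑ i, supNorm U (weakPartial U i u) +
    ∑ i, ∑ j ∈ Finset.Ici i, supNorm U (weakPartial U j (weakPartial U i u))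

/-! ### Domains and meshes -/

/-- A bounded domain with Lipschitz boundary: near each boundary point, in suitable Cartesian
coordinates, the domain is the part of the plane above the graph of a Lipschitz function. -/
structure IsLipschitzDomain (Ω : Set Plane) : Prop where
  isOpen : IsOpen Ω
  isConnected : IsConnected Ω
  isBounded : Bornology.IsBounded Ω
  boundary : ∀ x ∈ frontier Ω, ∃ (e : Plane ≃ₗᵢ[ℝ] Plane) (g : ℝ → ℝ) (K : NNReal) (r : ℝ),
    LipschitzWith K g ∧ 0 < r ∧ ∀ y ∈ Metric.ball x r, y ∈ Ω ↔ g (e y 0) < e y 1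

/-- The closed triangle with vertex set `s`. -/
def tri (s : Finset Plane) : Set Plane := convexHull ℝ (s : Set Plane)

/-- A conforming triangulation of `Ω`. An element is given by its set of three vertices; two
elements meet in the convex hull of their common vertices. (A domain which admits such a
triangulation is polygonal.) -/
structure Mesh (Ω : Set Plane) where
  elems : Finset (Finset Plane)
  card_eq : ∀ s ∈ elems, s.card = 3
  indep : ∀ s ∈ elems, AffineIndependent ℝ ((↑) : s → Plane)
  conforming : ∀ s ∈ elems, ∀ t ∈ elems,
    tri s ∩ tri t ⊆ convexHull ℝ ((s : Set Plane) ∩ (t : Set Plane))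
  cover : ⋃ s ∈ elems, tri s = closure Ω

variable {Ω : Set Plane}

/-- Shape regularity with constant `κ`: each element `τ` contains a disc of radius `h_τ / κ`,
where `h_τ` is the diameter of `τ`. -/
def Mesh.ShapeRegular (T : Mesh Ω) (κ : ℝ) : Prop :=
  ∀ s ∈ T.elems, ∃ c, Metric.closedBall c (Metric.diam (tri s) / κ) ⊆ tri s

open Classical in
/-- The vertices of the mesh. -/
def Mesh.vertices (T : Mesh Ω) : Finset Plane := T.elems.biUnion id

/-- The patch `ω_τ`: the union of the elements that meet `τ`. -/
def Mesh.patch (T : Mesh Ω) (s : Finset Plane) : Set Plane :=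
  ⋃ t ∈ T.elems, ⋃ _ : (tri t ∩ tri s).Nonempty, tri t

open Classical in
/-- The edges of the mesh, as ordered pairs of end points (each edge occurs in both
orientations). -/
def Mesh.edges (T : Mesh Ω) : Finset (Plane × Plane) := T.elems.biUnion Finset.offDiag

open Classical in
/-- The edges whose relative interior lies in `ω_τ \ ∂ω_τ`. -/
def Mesh.innerEdges (T : Mesh Ω) (s : Finset Plane) : Finset (Plane × Plane) :=
  T.edges.filter fun l => openSegment ℝ l.1 l.2 ⊆ interior (T.patch s)

/-! ### The linear finite element space -/

/-- `v` is a polynomial of degree at most one on each element. -/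
def Mesh.PiecewiseLinear (T : Mesh Ω) (v : Plane → ℝ) : Prop :=
  ∀ s ∈ T.elems, ∃ (a : Plane) (c : ℝ), ∀ x ∈ tri s, v x = inner ℝ a x + c

/-- `v ∈ S₀ʰ`. -/
def Mesh.MemS0 (T : Mesh Ω) (v : Plane → ℝ) : Prop :=
  MemH10 Ω v ∧ T.PiecewiseLinear v

open Classical in
/-- `(∇v)|_τ`, the constant gradient of a function that is linear on `τ`. -/
def elemGrad (v : Plane → ℝ) (s : Finset Plane) : Plane :=
  if h : ∃ (a : Plane), ∃ (c : ℝ), ∀ x ∈ tri s, v x = inner ℝ a x + c then h.choose else 0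

open Classical in
/-- For a triangle with vertex set `s`, the affine function with value `1` at `z` and `0` at the
vertices other than `z` (so it is the zero function if `z ∉ s`). -/
def baryCoord (s : Finset Plane) (z : Plane) : Plane →ᵃ[ℝ] ℝ :=
  if h : ∃ A : Plane →ᵃ[ℝ] ℝ, ∀ y ∈ s, A y = if y = z then 1 else 0 then h.choose else 0

open Classical in
/-- The nodal basis function `φ_z`. By conformity its value does not depend on the element that
is used to compute it. -/
def Mesh.nodalBasis (T : Mesh Ω) (z x : Plane) : ℝ :=
  if h : ∃ s ∈ T.elems, x ∈ tri s then baryCoord h.choose z x else 0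

open Classical in
/-- Averaging weights: for each vertex `z`, nonnegative numbers indexed by the elements that
have `z` as a vertex, with sum `1`. -/
def Mesh.IsWeight (T : Mesh Ω) (wt : Plane → Finset Plane → ℝ) : Prop :=
  ∀ z ∈ T.vertices, (∀ t ∈ T.elems, z ∈ t → 0 ≤ wt z t) ∧
    ∑ t ∈ T.elems.filter (fun t => z ∈ t), wt z t = 1

open Classical in
/-- The averaged nodal flux `(ε ∇v)_z`. -/
def Mesh.nodalFlux (T : Mesh Ω) (wt : Plane → Finset Plane → ℝ) (ε v : Plane → ℝ)
    (z : Plane) : Plane :=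
  ∑ t ∈ T.elems.filter (fun t => z ∈ t), wt z t • (ε z • elemGrad v t)

/-- The recovered flux `G_h v = ∑_z (ε ∇v)_z φ_z`. -/
def Mesh.recoveredFlux (T : Mesh Ω) (wt : Plane → Finset Plane → ℝ) (ε v : Plane → ℝ)
    (x : Plane) : Plane :=
  ∑ z ∈ T.vertices, T.nodalBasis z x • T.nodalFlux wt ε v z

/-- The divergence of a vector field. -/
def divergence (G : Plane → Plane) (x : Plane) : ℝ :=
  ∑ i, fderiv ℝ G x (EuclideanSpace.single i 1) i

/-! ### The Poisson-Nernst-Planck system in weak form -/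

/-- The integrand of `a(p, v) + b(p, φ, v)`. -/
def concIntegrand (Ω : Set Plane) (α : Plane → ℝ → ℝ) (β : Plane → ℝ → Plane)
    (γ g : Plane → ℝ → ℝ) (p φ v : Plane → ℝ) (x : Plane) : ℝ :=
  inner ℝ (α x (p x) • weakGrad Ω p x + β x (p x) + γ x (p x) • weakGrad Ω φ x)
    (weakGrad Ω v x) + g x (p x) * v x

/-- `(p¹, …, pⁿ, φ)` solves the weak form of the system with trial and test space `V`. The case
that `V` is `H¹₀(Ω)` is the weak solution, the case that `V` is `S₀ʰ` is its finite element
discretization. -/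
structure Solves {n : ℕ} (Ω : Set Plane) (α : Fin n → Plane → ℝ → ℝ)
    (β : Fin n → Plane → ℝ → Plane) (γ g : Fin n → Plane → ℝ → ℝ) (ε f : Plane → ℝ)
    (q : Fin n → ℝ) (V : (Plane → ℝ) → Prop) (p : Fin n → Plane → ℝ) (φ : Plane → ℝ) :
    Prop where
  mem_conc : ∀ i, V (p i)
  mem_pot : V φ
  conc_integrable : ∀ i, ∀ v, V v →
    IntegrableOn (concIntegrand Ω (α i) (β i) (γ i) (g i) (p i) φ v) Ω
  conc : ∀ i, ∀ v, V v → ∫ x in Ω, concIntegrand Ω (α i) (β i) (γ i) (g i) (p i) φ v x = 0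
  pot : ∀ w, V w →
    ∫ x in Ω, ε x * inner ℝ (weakGrad Ω φ x) (weakGrad Ω w x) =
      ∫ x in Ω, (∑ i, q i * p i x + f x) * w x

/-! ### The error indicator and the quantities of the lower bound -/

/-- `R_{1h}(p_h, φ_h) = ∑ qⁱ p_hⁱ + div (G_h φ_h) + f`. -/
def Mesh.residual {n : ℕ} (T : Mesh Ω) (wt : Plane → Finset Plane → ℝ) (ε f : Plane → ℝ)
    (q : Fin n → ℝ) (ph : Fin n → Plane → ℝ) (φh : Plane → ℝ) (x : Plane) : ℝ :=
  ∑ i, q i * ph i x + divergence (T.recoveredFlux wt ε φh) x + f x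

/-- `D_h(φ_h) = G_h φ_h - ε ∇φ_h` on the element `τ`. -/
def Mesh.defect (T : Mesh Ω) (wt : Plane → Finset Plane → ℝ) (ε φh : Plane → ℝ)
    (s : Finset Plane) (x : Plane) : Plane :=
  T.recoveredFlux wt ε φh x - ε x • elemGrad φh s

/-- `η_{τ,φ}(p_h, φ_h) = h_τ ‖R_{1h}‖_{0,τ} + ‖D_h(φ_h)‖_{0,τ}`. -/
def Mesh.indicator {n : ℕ} (T : Mesh Ω) (wt : Plane → Finset Plane → ℝ) (ε f : Plane → ℝ)
    (q : Fin n → ℝ) (ph : Fin n → Plane → ℝ) (φh : Plane → ℝ) (s : Finset Plane) : ℝ :=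
  Metric.diam (tri s) * l2Norm (tri s) (T.residual wt ε f q ph φh) +
    l2Norm (tri s) (T.defect wt ε φh s)

/-- `‖u‖_{0,∞,l}` on the edge `l` with end points `l.1` and `l.2`. -/
def edgeSupNorm (l : Plane × Plane) (u : Plane → ℝ) : ℝ :=
  (eLpNorm (fun t : ℝ => u (AffineMap.lineMap l.1 l.2 t)) ∞
    (volume.restrict (Ioo (0 : ℝ) 1))).toReal

/-- `|u|_{1,∞,l}`: the essential supremum over the edge `l` of the modulus of the derivative of
`u` with respect to arc length along `l`. -/
def edgeSeminorm (l : Plane × Plane) (u : Plane → ℝ) : ℝ :=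
  (eLpNorm (deriv fun t : ℝ => u (AffineMap.lineMap l.1 l.2 t)) ∞
    (volume.restrict (Ioo (0 : ℝ) 1))).toReal / dist l.1 l.2

/-- `ξ_{h,l} = 1 + h_l |ε|_{1,∞,l} ‖ε⁻¹‖_{0,∞,l}`. -/
def edgeFactor (ε : Plane → ℝ) (l : Plane × Plane) : ℝ :=
  1 + dist l.1 l.2 * edgeSeminorm l ε * edgeSupNorm l fun x => (ε x)⁻¹

/-- `ξ_{h,ω_τ}`: the maximum of `ξ_{h,l} ≥ 1` over the inner edges of `ω_τ`, and `1` if there is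
no such edge. -/
def Mesh.patchFactor (T : Mesh Ω) (ε : Plane → ℝ) (s : Finset Plane) : ℝ :=
  (T.innerEdges s).fold max 1 (edgeFactor ε)

end PNP

end

noncomputable section

namespace PNP

/-! ### Calculus of weak derivatives -/

theorem integrable_mul_of_locallyIntegrableOn {U : Set Plane} {v ψ : Plane → ℝ}
    (hv : LocallyIntegrableOn v U) (hψ : Continuous ψ) (hc : HasCompactSupport ψ)
    (hs : tsupport ψ ⊆ U) : Integrable (fun x => v x * ψ x) := by
  have h1 : IntegrableOn v (tsupport ψ) := hv.integrableOn_compact_subset hs hc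
  have h2 : IntegrableOn (fun x => v x * ψ x) (tsupport ψ) :=
    h1.mul_continuousOn hψ.continuousOn hc
  refine (integrableOn_iff_integrable_of_support_subset ?_).1 h2
  intro x hx
  refine subset_tsupport ψ ?_
  simp only [Function.mem_support] at hx ⊢
  exact fun h => hx (by simp [h])

theorem setIntegral_mul_eq_integral {U : Set Plane} {v ψ : Plane → ℝ}
    (hs : tsupport ψ ⊆ U) : ∫ x in U, v x * ψ x = ∫ x, v x * ψ x := by
  refine setIntegral_eq_integral_of_forall_compl_eq_zero fun x hx => ?_
  rw [image_eq_zero_of_notMem_tsupport fun h => hx (hs h), mul_zero]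

theorem tsupport_fderiv_apply_subset (ψ : Plane → ℝ) (w : Plane) :
    tsupport (fun x => fderiv ℝ ψ x w) ⊆ tsupport ψ := by
  refine (closure_mono ?_).trans (tsupport_fderiv_subset ℝ (f := ψ))
  intro x hx
  simp only [Function.mem_support] at hx ⊢
  exact fun h => hx (by simp [h])

theorem IsTestFunction.fderiv_apply {U : Set Plane} {ψ : Plane → ℝ} (h : IsTestFunction U ψ)
    (w : Plane) : IsTestFunction U (fun x => fderiv ℝ ψ x w) := by
  refine ⟨?_, ?_, (tsupport_fderiv_apply_subset ψ w).trans h.2.2⟩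
  · exact (h.1.fderiv_right (m := ∞) (by simp)).clm_apply contDiff_const
  · exact h.2.1.mono' ((subset_tsupport _).trans (tsupport_fderiv_apply_subset ψ w))

theorem IsTestFunction.mono {U V : Set Plane} {ψ : Plane → ℝ} (h : IsTestFunction U ψ)
    (hUV : U ⊆ V) : IsTestFunction V ψ := ⟨h.1, h.2.1, h.2.2.trans hUV⟩

theorem ae_restrict_eq_of_integral_mul_eq {U : Set Plane} (hU : IsOpen U) {v v' : Plane → ℝ}
    (hv : LocallyIntegrableOn v U) (hv' : LocallyIntegrableOn v' U)
    (h : ∀ ψ, IsTestFunction U ψ → ∫ x in U, v x * ψ x = ∫ x in U, v' x * ψ x) :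
    v =ᵐ[volume.restrict U] v' := by
  have key := hU.ae_eq_zero_of_integral_contDiff_smul_eq_zero (hv.sub hv') (μ := volume) ?_
  · refine (ae_restrict_iff' hU.measurableSet).2 ?_
    filter_upwards [key] with x hx hxU
    exact sub_eq_zero.1 (hx hxU)
  intro ψ h1 h2 h3
  have h4 := h ψ ⟨h1, h2, h3⟩
  rw [setIntegral_mul_eq_integral h3, setIntegral_mul_eq_integral h3] at h4
  have i1 := integrable_mul_of_locallyIntegrableOn hv h1.continuous h2 h3
  have i2 := integrable_mul_of_locallyIntegrableOn hv' h1.continuous h2 h3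
  have : (fun x => ψ x • (v - v') x) = fun x => v x * ψ x - v' x * ψ x := by
    funext x; simp only [Pi.sub_apply, smul_eq_mul]; ring
  rw [this, integral_sub i1 i2, h4, sub_self]

theorem HasWeakPartial.ae_eq {U : Set Plane} (hU : IsOpen U) {i : Fin 2} {u v v' : Plane → ℝ}
    (h : HasWeakPartial U i u v) (h' : HasWeakPartial U i u v') :
    v =ᵐ[volume.restrict U] v' := by
  refine ae_restrict_eq_of_integral_mul_eq hU h.2.1 h'.2.1 fun ψ hψ => ?_
  have h1 := h.2.2 ψ hψ
  rw [h'.2.2 ψ hψ] at h1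
  exact (neg_injective h1).symm

theorem HasWeakPartial.weakPartial {U : Set Plane} {i : Fin 2} {u v : Plane → ℝ}
    (h : HasWeakPartial U i u v) : HasWeakPartial U i u (weakPartial U i u) := by
  have hex : ∃ v, HasWeakPartial U i u v := ⟨v, h⟩
  rw [PNP.weakPartial, dif_pos hex]
  exact hex.choose_spec

theorem HasWeakPartial.weakPartial_ae_eq {U : Set Plane} (hU : IsOpen U) {i : Fin 2}
    {u v : Plane → ℝ} (h : HasWeakPartial U i u v) :
    PNP.weakPartial U i u =ᵐ[volume.restrict U] v :=
  h.weakPartial.ae_eq hU h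

theorem HasWeakPartial.restrict {U V : Set Plane} (hVU : V ⊆ U) {i : Fin 2}
    {u v : Plane → ℝ} (h : HasWeakPartial U i u v) : HasWeakPartial V i u v := by
  refine ⟨h.1.mono_set hVU, h.2.1.mono_set hVU, fun ψ hψ => ?_⟩
  have h1 := h.2.2 ψ (hψ.mono hVU)
  have hd : tsupport (fun x => fderiv ℝ ψ x (EuclideanSpace.single i 1)) ⊆ V :=
    (tsupport_fderiv_apply_subset ψ _).trans hψ.2.2
  rw [setIntegral_mul_eq_integral hd, setIntegral_mul_eq_integral hψ.2.2]
  rwa [setIntegral_mul_eq_integral (hd.trans hVU),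
    setIntegral_mul_eq_integral (hψ.2.2.trans hVU)] at h1

theorem locallyIntegrableOn_congr_ae {U : Set Plane} {u v : Plane → ℝ}
    (h : u =ᵐ[volume.restrict U] v) (hu : LocallyIntegrableOn u U) : LocallyIntegrableOn v U := by
  intro x hx
  obtain ⟨s, hs, hi⟩ := hu x hx
  refine ⟨s ∩ U, Filter.inter_mem hs self_mem_nhdsWithin, ?_⟩
  refine (hi.mono_set inter_subset_left).congr_fun_ae ?_
  exact ae_restrict_of_ae_restrict_of_subset inter_subset_right h

theorem HasWeakPartial.congr_ae {U : Set Plane} {i : Fin 2}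
    {u v u' v' : Plane → ℝ} (h : HasWeakPartial U i u v) (hu : u =ᵐ[volume.restrict U] u')
    (hv : v =ᵐ[volume.restrict U] v') : HasWeakPartial U i u' v' := by
  refine ⟨locallyIntegrableOn_congr_ae hu h.1, locallyIntegrableOn_congr_ae hv h.2.1,
    fun ψ hψ => ?_⟩
  have h1 : ∫ x in U, u x * fderiv ℝ ψ x (EuclideanSpace.single i 1) =
      ∫ x in U, u' x * fderiv ℝ ψ x (EuclideanSpace.single i 1) :=
    integral_congr_ae (by filter_upwards [hu] with x hx; rw [hx])
  have h2 : ∫ x in U, v x * ψ x = ∫ x in U, v' x * ψ x :=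
    integral_congr_ae (by filter_upwards [hv] with x hx; rw [hx])
  rw [← h1, ← h2]
  exact h.2.2 ψ hψ

theorem HasWeakPartial.sub {U : Set Plane} {i : Fin 2} {u v u' v' : Plane → ℝ}
    (h : HasWeakPartial U i u v) (h' : HasWeakPartial U i u' v') :
    HasWeakPartial U i (u - u') (v - v') := by
  refine ⟨h.1.sub h'.1, h.2.1.sub h'.2.1, fun ψ hψ => ?_⟩
  have hd := hψ.fderiv_apply (EuclideanSpace.single i 1)
  have e1 := h.2.2 ψ hψ
  have e2 := h'.2.2 ψ hψ
  simp only [Pi.sub_apply, sub_mul]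
  rw [integral_sub, integral_sub, e1, e2]
  · ring
  · exact (integrable_mul_of_locallyIntegrableOn h.2.1 hψ.1.continuous hψ.2.1 hψ.2.2).integrableOn
  · exact (integrable_mul_of_locallyIntegrableOn h'.2.1 hψ.1.continuous hψ.2.1
      hψ.2.2).integrableOn
  · exact (integrable_mul_of_locallyIntegrableOn h.1 hd.1.continuous hd.2.1 hd.2.2).integrableOn
  · exact (integrable_mul_of_locallyIntegrableOn h'.1 hd.1.continuous hd.2.1 hd.2.2).integrableOn

/-- Integration by parts against a compactly supported function. -/
theorem integral_mul_fderiv_eq_neg {u ψ : Plane → ℝ} (hu : ContDiff ℝ 1 u) (hψ : ContDiff ℝ 1 ψ)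
    (hc : HasCompactSupport ψ) (w : Plane) :
    ∫ x, u x * fderiv ℝ ψ x w = -∫ x, fderiv ℝ u x w * ψ x := by
  have cu : Continuous fun x => fderiv ℝ u x w :=
    (hu.continuous_fderiv one_ne_zero).clm_apply continuous_const
  have cψ : Continuous fun x => fderiv ℝ ψ x w :=
    (hψ.continuous_fderiv one_ne_zero).clm_apply continuous_const
  have cc : HasCompactSupport fun x => fderiv ℝ ψ x w :=
    hc.mono' ((subset_tsupport _).trans (tsupport_fderiv_apply_subset ψ w))
  refine integral_mul_fderiv_eq_neg_fderiv_mul_of_integrable ?_ ?_ ?_ ?_ ?_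
  · exact (cu.mul hψ.continuous).integrable_of_hasCompactSupport hc.mul_left
  · exact (hu.continuous.mul cψ).integrable_of_hasCompactSupport cc.mul_left
  · exact (hu.continuous.mul hψ.continuous).integrable_of_hasCompactSupport hc.mul_left
  · exact fun x _ => hu.differentiable one_ne_zero x
  · exact fun x _ => hψ.differentiable one_ne_zero x

theorem hasWeakPartial_of_contDiff (U : Set Plane) (i : Fin 2) {u : Plane → ℝ}
    (hu : ContDiff ℝ 1 u) :
    HasWeakPartial U i u fun x => fderiv ℝ u x (EuclideanSpace.single i 1) := by
  have cu : Continuous fun x => fderiv ℝ u x (EuclideanSpace.single i 1) :=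
    (hu.continuous_fderiv one_ne_zero).clm_apply continuous_const
  refine ⟨hu.continuous.locallyIntegrable.locallyIntegrableOn _,
    cu.locallyIntegrable.locallyIntegrableOn _, fun ψ hψ => ?_⟩
  rw [setIntegral_mul_eq_integral ((tsupport_fderiv_apply_subset ψ _).trans hψ.2.2),
    setIntegral_mul_eq_integral hψ.2.2]
  exact integral_mul_fderiv_eq_neg hu (hψ.1.of_le (by simp)) hψ.2.1 _

/-- The classical gradient. -/
def grad (u : Plane → ℝ) (x : Plane) : Plane :=
  WithLp.toLp 2 fun i => fderiv ℝ u x (EuclideanSpace.single i 1)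

theorem inner_grad (u : Plane → ℝ) (x w : Plane) : inner ℝ w (grad u x) = fderiv ℝ u x w := by
  have hw : w = ∑ i, w i • EuclideanSpace.single i (1 : ℝ) := by
    ext j
    fin_cases j <;> simp [Fin.sum_univ_two]
  conv_rhs => rw [hw]
  simp [grad, PiLp.inner_apply, Fin.sum_univ_two, mul_comm]

theorem norm_grad_le (u : Plane → ℝ) (x : Plane) : ‖grad u x‖ ≤ ‖fderiv ℝ u x‖ := by
  by_cases h : ‖grad u x‖ = 0
  · rw [h]; positivity
  have h1 : ‖grad u x‖ * ‖grad u x‖ ≤ ‖fderiv ℝ u x‖ * ‖grad u x‖ := by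
    rw [← real_inner_self_eq_norm_mul_norm, inner_grad]
    exact (le_abs_self _).trans ((fderiv ℝ u x).le_opNorm _)
  exact le_of_mul_le_mul_right h1 (lt_of_le_of_ne (norm_nonneg _) (Ne.symm h))

theorem weakGrad_ae_eq_of_hasWeakPartial {U : Set Plane} (hU : IsOpen U) {u : Plane → ℝ}
    {G : Plane → Plane} (h : ∀ i, HasWeakPartial U i u fun x => G x i) :
    weakGrad U u =ᵐ[volume.restrict U] G := by
  have h' : ∀ᵐ x ∂volume.restrict U, ∀ i, weakPartial U i u x = G x i :=
    ae_all_iff.2 fun i => (h i).weakPartial_ae_eq hU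
  filter_upwards [h'] with x hx
  ext i
  simp [weakGrad, hx i]

theorem weakGrad_ae_eq_grad {U : Set Plane} (hU : IsOpen U) {u : Plane → ℝ}
    (hu : ContDiff ℝ 1 u) : weakGrad U u =ᵐ[volume.restrict U] grad u :=
  weakGrad_ae_eq_of_hasWeakPartial hU fun i => hasWeakPartial_of_contDiff U i hu

theorem MemH1.hasWeakPartial {U : Set Plane} {u : Plane → ℝ} (h : MemH1 U u) (i : Fin 2) :
    HasWeakPartial U i u (weakPartial U i u) := by
  obtain ⟨v, hv, -⟩ := h.2 i
  exact hv.weakPartial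

theorem MemH1.memLp_weakPartial {U : Set Plane} (hU : IsOpen U) {u : Plane → ℝ} (h : MemH1 U u)
    (i : Fin 2) : MemLp (weakPartial U i u) 2 (volume.restrict U) := by
  obtain ⟨v, hv, hm⟩ := h.2 i
  exact (memLp_congr_ae (hv.weakPartial_ae_eq hU)).2 hm

theorem memLp_toLp {μ : Measure Plane} {p : ℝ≥0∞} {G : Plane → Fin 2 → ℝ}
    (h : ∀ i, MemLp (fun x => G x i) p μ) :
    MemLp (fun x => (WithLp.toLp 2 (G x) : Plane)) p μ := by
  have h1 : (fun x => (WithLp.toLp 2 (G x) : Plane)) =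
      fun x => ∑ i, G x i • EuclideanSpace.single i (1 : ℝ) := by
    funext x
    ext j
    fin_cases j <;> simp [Fin.sum_univ_two]
  rw [h1]
  refine memLp_finsetSum _ fun i _ => ?_
  exact (ContinuousLinearMap.smulRight (1 : ℝ →L[ℝ] ℝ)
    (EuclideanSpace.single i (1 : ℝ) : Plane)).comp_memLp' (h i)

theorem MemH1.memLp_weakGrad {U : Set Plane} (hU : IsOpen U) {u : Plane → ℝ} (h : MemH1 U u) :
    MemLp (weakGrad U u) 2 (volume.restrict U) :=
  memLp_toLp fun i => h.memLp_weakPartial hU i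

theorem MemH1.weakGrad_sub {U : Set Plane} (hU : IsOpen U) {u v : Plane → ℝ} (hu : MemH1 U u)
    (hv : MemH1 U v) :
    weakGrad U (u - v) =ᵐ[volume.restrict U] weakGrad U u - weakGrad U v :=
  weakGrad_ae_eq_of_hasWeakPartial hU fun i => (hu.hasWeakPartial i).sub (hv.hasWeakPartial i)

theorem contDiff_inner_add_const (a : Plane) (c : ℝ) {n : WithTop ℕ∞} :
    ContDiff ℝ n fun x : Plane => inner ℝ a x + c :=
  (innerSL ℝ a).contDiff.add contDiff_const

theorem fderiv_inner_add_const (a : Plane) (c : ℝ) (x : Plane) :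
    fderiv ℝ (fun x : Plane => inner ℝ a x + c) x = innerSL ℝ a :=
  ((innerSL ℝ a).hasFDerivAt.add_const c).fderiv

theorem weakGrad_ae_eq_of_eqOn {U V : Set Plane} (hV : IsOpen V) (hVU : V ⊆ U)
    {u : Plane → ℝ} (hu : MemH1 U u) {a : Plane} {c : ℝ} (h : ∀ x ∈ V, u x = inner ℝ a x + c) :
    ∀ᵐ x ∂volume.restrict V, weakGrad U u x = a := by
  have hA : ContDiff ℝ 1 fun x : Plane => inner ℝ a x + c :=
    contDiff_inner_add_const a c
  have h' : ∀ᵐ x ∂volume.restrict V, ∀ i, weakPartial U i u x = a i := by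
    refine ae_all_iff.2 fun i => ?_
    have h1 := ((hu.hasWeakPartial i).restrict hVU).congr_ae (u' := fun x => inner ℝ a x + c)
      (v' := weakPartial U i u)
      ((ae_restrict_iff' hV.measurableSet).2 (ae_of_all _ h)) Filter.EventuallyEq.rfl
    filter_upwards [h1.ae_eq hV (hasWeakPartial_of_contDiff V i hA)] with x hx
    rw [hx, fderiv_inner_add_const]
    simp [PiLp.inner_apply]
  filter_upwards [h'] with x hx
  ext i
  simp [weakGrad, hx i]

theorem IsTestFunction.memH10 {U : Set Plane} (hU : IsOpen U) {ψ : Plane → ℝ}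
    (h : IsTestFunction U ψ) : MemH10 U ψ := by
  have hψ1 : ContDiff ℝ 1 ψ := h.1.of_le (by simp)
  refine ⟨⟨?_, fun i => ⟨_, hasWeakPartial_of_contDiff U i hψ1, ?_⟩⟩, fun δ hδ => ⟨ψ, h, ?_⟩⟩
  · exact (h.1.continuous.memLp_of_hasCompactSupport h.2.1).restrict _
  · have hd := h.fderiv_apply (EuclideanSpace.single i 1)
    exact (hd.1.continuous.memLp_of_hasCompactSupport hd.2.1).restrict _
  · have h0 : weakGrad U (ψ - ψ) =ᵐ[volume.restrict U] (fun _ => (0 : Plane)) := by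
      refine weakGrad_ae_eq_of_hasWeakPartial hU fun i => ?_
      have h1 := hasWeakPartial_of_contDiff U i (u := fun _ => (0 : ℝ)) contDiff_const
      rw [sub_self]
      exact h1.congr_ae Filter.EventuallyEq.rfl (ae_of_all _ fun x => by
        change fderiv ℝ (fun _ : Plane => (0 : ℝ)) x (EuclideanSpace.single i 1) = 0
        rw [(hasFDerivAt_const (0 : ℝ) x).fderiv]
        rfl)
    have h2 : l2Norm U (weakGrad U (ψ - ψ)) = 0 := by
      rw [l2Norm, eLpNorm_congr_ae h0]
      simp
    have h3 : l2Norm U (ψ - ψ) = 0 := by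
      rw [sub_self, l2Norm]
      simp
    rw [h1Norm, h2, h3]
    simpa using hδ

/-! ### Mollification -/

open scoped Convolution in
/-- The mollification of `u` by a bump function. -/
def mollify (φ : ContDiffBump (0 : Plane)) (u : Plane → ℝ) : Plane → ℝ :=
  φ.normed volume ⋆[ContinuousLinearMap.lsmul ℝ ℝ, volume] u

theorem mollify_apply (φ : ContDiffBump (0 : Plane)) (u : Plane → ℝ) (x : Plane) :
    mollify φ u x = ∫ y, u y * φ.normed volume (x - y) := by
  rw [mollify, convolution_eq_swap]
  simp only [ContinuousLinearMap.lsmul_apply, smul_eq_mul, mul_comm]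

theorem isTestFunction_normed_sub {U : Set Plane} (φ : ContDiffBump (0 : Plane)) {x : Plane}
    (hx : Metric.closedBall x φ.rOut ⊆ U) :
    IsTestFunction U fun y => φ.normed volume (x - y) := by
  have hs : Function.support (fun y => φ.normed volume (x - y)) ⊆ Metric.closedBall x φ.rOut := by
    intro y hy
    have h1 : x - y ∈ Function.support (φ.normed (volume : Measure Plane)) := hy
    rw [φ.support_normed_eq, mem_ball_zero_iff] at h1
    rw [Metric.mem_closedBall, dist_comm, dist_eq_norm]
    exact h1.le
  have ht : tsupport (fun y => φ.normed volume (x - y)) ⊆ Metric.closedBall x φ.rOut :=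
    closure_minimal hs Metric.isClosed_closedBall
  refine ⟨φ.contDiff_normed.comp (contDiff_const.sub contDiff_id), ?_, ht.trans hx⟩
  exact HasCompactSupport.of_support_subset_isCompact (isCompact_closedBall x φ.rOut) hs

theorem fderiv_normed_sub (φ : ContDiffBump (0 : Plane)) (x y w : Plane) :
    fderiv ℝ (fun y => φ.normed volume (x - y)) y w =
      - fderiv ℝ (φ.normed volume) (x - y) w := by
  have h1 : HasFDerivAt (φ.normed (volume : Measure Plane))
      (fderiv ℝ (φ.normed volume) (x - y)) (x - y) :=
    ((φ.contDiff_normed (n := 1)).differentiable one_ne_zero _).hasFDerivAt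
  have h2 : HasFDerivAt (fun y : Plane => x - y) (-ContinuousLinearMap.id ℝ Plane) y :=
    (hasFDerivAt_id y).const_sub x
  have h3 : HasFDerivAt (fun y => φ.normed volume (x - y)) _ y := h1.comp y h2
  rw [h3.fderiv]
  simp

open scoped Convolution in
theorem hasFDerivAt_mollify {U : Set Plane} {u : Plane → ℝ} {v : Fin 2 → Plane → ℝ}
    (hu : LocallyIntegrable u) (hv : ∀ i, HasWeakPartial U i u (v i))
    (φ : ContDiffBump (0 : Plane)) {x : Plane} (hx : Metric.closedBall x φ.rOut ⊆ U) :
    HasFDerivAt (mollify φ u)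
      (innerSL ℝ (WithLp.toLp 2 fun i => mollify φ (v i) x : Plane)) x := by
  have hφ1 : ContDiff ℝ 1 (φ.normed (volume : Measure Plane)) := φ.contDiff_normed (n := 1)
  have h1 := φ.hasCompactSupport_normed.hasFDerivAt_convolution_left
    (ContinuousLinearMap.lsmul ℝ ℝ) hφ1 hu x
  refine h1.congr_fderiv ?_
  have hint : Integrable fun t => (ContinuousLinearMap.lsmul ℝ ℝ).precompL Plane
      (fderiv ℝ (φ.normed (volume : Measure Plane)) (x - t)) (u t) := by
    have := ((φ.hasCompactSupport_normed (μ := volume)).fderiv ℝ).convolutionExists_left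
      ((ContinuousLinearMap.lsmul ℝ ℝ).precompL Plane) (hφ1.continuous_fderiv one_ne_zero) hu x
    exact this.integrable_swap
  have hcoord : ∀ i, (fderiv ℝ (φ.normed (volume : Measure Plane))
      ⋆[(ContinuousLinearMap.lsmul ℝ ℝ).precompL Plane, volume] u) x
        (EuclideanSpace.single i 1) = mollify φ (v i) x := by
    intro i
    have h3 := (hv i).2.2 _ (isTestFunction_normed_sub φ hx)
    rw [setIntegral_mul_eq_integral (isTestFunction_normed_sub φ hx).2.2,
      setIntegral_mul_eq_integral (((isTestFunction_normed_sub φ hx).fderiv_apply _).2.2)] at h3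
    rw [mollify_apply, ← neg_eq_iff_eq_neg.2 h3, convolution_eq_swap,
      ContinuousLinearMap.integral_apply hint, ← integral_neg]
    refine integral_congr_ae (ae_of_all _ fun y => ?_)
    simp only [fderiv_normed_sub, ContinuousLinearMap.precompL_apply,
      ContinuousLinearMap.lsmul_apply, smul_eq_mul]
    ring
  ext w
  have hw : w = ∑ i, w i • EuclideanSpace.single i (1 : ℝ) := by
    ext j
    fin_cases j <;> simp [Fin.sum_univ_two]
  conv_lhs => rw [hw]
  rw [map_sum]
  simp only [map_smul, hcoord]
  simp [PiLp.inner_apply, Fin.sum_univ_two]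

theorem hasDerivAt_mollify_line {U : Set Plane} {u : Plane → ℝ} {v : Fin 2 → Plane → ℝ}
    (hu : LocallyIntegrable u) (hv : ∀ i, HasWeakPartial U i u (v i))
    (φ : ContDiffBump (0 : Plane)) {x w : Plane} {s : ℝ}
    (hx : Metric.closedBall (x + s • w) φ.rOut ⊆ U) :
    HasDerivAt (fun s : ℝ => mollify φ u (x + s • w))
      (∑ i, w i * mollify φ (v i) (x + s • w)) s := by
  have h1 := hasFDerivAt_mollify hu hv φ hx
  have h2 : HasDerivAt (fun s : ℝ => x + s • w) w s := by
    simpa using ((hasDerivAt_id s).smul_const w).const_add x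
  have h3 := h1.comp_hasDerivAt s h2
  refine h3.congr_deriv ?_
  simp [PiLp.inner_apply, Fin.sum_univ_two]

theorem abs_mollify_le {U : Set Plane} {w : Plane → ℝ} {B : ℝ}
    (hB : ∀ᵐ y ∂volume.restrict U, |w y| ≤ B) (hU : MeasurableSet U)
    (φ : ContDiffBump (0 : Plane)) {x : Plane} (hx : Metric.closedBall x φ.rOut ⊆ U) :
    |mollify φ w x| ≤ B := by
  have ht := isTestFunction_normed_sub φ hx
  rw [mollify_apply, ← Real.norm_eq_abs]
  have hi : Integrable fun y => B * φ.normed volume (x - y) :=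
    (ht.1.continuous.integrable_of_hasCompactSupport ht.2.1).const_mul B
  refine (norm_integral_le_of_norm_le hi ?_).trans ?_
  · filter_upwards [(ae_restrict_iff' hU).1 hB] with y hy
    by_cases hyU : y ∈ U
    · rw [norm_mul, Real.norm_eq_abs, Real.norm_eq_abs, abs_of_nonneg (φ.nonneg_normed _)]
      exact mul_le_mul_of_nonneg_right (hy hyU) (φ.nonneg_normed _)
    · have h0 : φ.normed volume (x - y) = 0 :=
        image_eq_zero_of_notMem_tsupport (f := fun y => φ.normed volume (x - y))
          fun h => hyU (ht.2.2 h)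
      simp [h0]
  · rw [integral_const_mul, integral_sub_left_eq_self (φ.normed volume), φ.integral_normed, mul_one]

/-- A sequence of bump functions with shrinking supports. -/
def bumpSeq (k : ℕ) : ContDiffBump (0 : Plane) where
  rIn := 1 / (2 * (k + 1))
  rOut := 1 / (k + 1)
  rIn_pos := by positivity
  rIn_lt_rOut := by
    have : (0 : ℝ) < k + 1 := by positivity
    rw [div_lt_div_iff_of_pos_left one_pos (by positivity) this]
    linarith

theorem tendsto_bumpSeq_rOut :
    Filter.Tendsto (fun k => (bumpSeq k).rOut) Filter.atTop (nhds 0) :=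
  tendsto_one_div_add_atTop_nhds_zero_nat

theorem ae_tendsto_mollify {u : Plane → ℝ} (hu : LocallyIntegrable u) :
    ∀ᵐ x, Filter.Tendsto (fun k => mollify (bumpSeq k) u x) Filter.atTop (nhds (u x)) := by
  refine ContDiffBump.ae_convolution_tendsto_right_of_locallyIntegrable (K := 2)
    tendsto_bumpSeq_rOut (Filter.Eventually.of_forall fun k => ?_) hu
  simp only [bumpSeq]
  apply le_of_eq
  field_simp

theorem tendsto_mollify {u : Plane → ℝ} (hu : LocallyIntegrable u) {x : Plane}
    (hx : ContinuousAt u x) :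
    Filter.Tendsto (fun k => mollify (bumpSeq k) u x) Filter.atTop (nhds (u x)) := by
  refine ContDiffBump.convolution_tendsto_right tendsto_bumpSeq_rOut
    (g := fun _ => u) (Filter.Eventually.of_forall fun _ => hu.aestronglyMeasurable) ?_
    tendsto_const_nhds
  exact hx.tendsto.comp Filter.tendsto_snd

/-- A function with second derivative bounded by `K` is close to its chord. -/
theorem abs_sub_chord_le {g g' g'' : ℝ → ℝ} {K : ℝ}
    (h1 : ∀ s ∈ Icc (0 : ℝ) 1, HasDerivAt g (g' s) s)
    (h2 : ∀ s ∈ Icc (0 : ℝ) 1, HasDerivAt g' (g'' s) s)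
    (hK : ∀ s ∈ Icc (0 : ℝ) 1, |g'' s| ≤ K) {s : ℝ} (hs : s ∈ Icc (0 : ℝ) 1) :
    |g s - ((1 - s) * g 0 + s * g 1)| ≤ K / 2 * (s * (1 - s)) := by
  have key : ∀ σ : ℝ, |σ| = 1 →
      σ * g s + K / 2 * s ^ 2 ≤ (1 - s) * (σ * g 0) + s * (σ * g 1 + K / 2) := by
    intro σ hσ
    have hconv : ConvexOn ℝ (Icc (0 : ℝ) 1) fun s => σ * g s + K / 2 * s ^ 2 := by
      refine convexOn_of_hasDerivWithinAt2_nonneg (convex_Icc 0 1)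
        (f' := fun s => σ * g' s + K * s) (f'' := fun s => σ * g'' s + K) ?_ ?_ ?_ ?_
      · intro s hs
        exact (((h1 s hs).continuousAt.const_mul σ).add (by fun_prop)).continuousWithinAt
      · intro s hs
        have hs' := interior_subset hs
        refine HasDerivAt.hasDerivWithinAt ?_
        refine (((h1 s hs').const_mul σ).add ((hasDerivAt_pow 2 s).const_mul (K / 2))).congr_deriv ?_
        simp; ring
      · intro s hs
        have hs' := interior_subset hs
        refine HasDerivAt.hasDerivWithinAt ?_
        refine (((h2 s hs').const_mul σ).add ((hasDerivAt_id s).const_mul K)).congr_deriv ?_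
        simp
      · intro s hs
        have h3 : |σ * g'' s| ≤ K := by
          rw [abs_mul, hσ, one_mul]; exact hK s (interior_subset hs)
        linarith [neg_abs_le (σ * g'' s)]
    have h4 := hconv.2 (left_mem_Icc.2 zero_le_one) (right_mem_Icc.2 zero_le_one)
      (sub_nonneg.2 hs.2) hs.1 (by ring)
    simp only [smul_eq_mul, mul_zero, mul_one, zero_add] at h4
    linarith
  have k1 := key 1 (by simp)
  have k2 := key (-1) (by simp)
  rw [abs_le]
  constructor <;> nlinarith

theorem restrict_indicator_ae_eq {U : Set Plane} (hU : MeasurableSet U) (u : Plane → ℝ) :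
    u =ᵐ[volume.restrict U] U.indicator u := by
  refine (ae_restrict_iff' hU).2 (ae_of_all _ fun x hx => ?_)
  rw [indicator_of_mem hx]

/-- A continuous function whose weak second derivatives are bounded is close to its chords. -/
theorem abs_sub_chord_le_of_hasWeakPartial {U : Set Plane} (hU : IsOpen U) (hUc : Convex ℝ U)
    {u : Plane → ℝ} {v : Fin 2 → Plane → ℝ} {w : Fin 2 → Fin 2 → Plane → ℝ}
    (hc : ContinuousOn u U) (hui : IntegrableOn u U) (hvi : ∀ i, IntegrableOn (v i) U)
    (hv : ∀ i, HasWeakPartial U i u (v i)) (hw : ∀ i j, HasWeakPartial U j (v i) (w i j))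
    {B : Fin 2 → Fin 2 → ℝ} (hB : ∀ i j, ∀ᵐ y ∂volume.restrict U, |w i j y| ≤ B i j)
    {M : ℝ} (hM : ∀ h : Plane, ∑ i, |h i| * ∑ j, |h j| * B i j ≤ M * ‖h‖ ^ 2)
    {a b : Plane} (ha : a ∈ U) (hb : b ∈ U) {s : ℝ} (hs : s ∈ Icc (0 : ℝ) 1) :
    |u (a + s • (b - a)) - ((1 - s) * u a + s * u b)| ≤
      M / 2 * ‖b - a‖ ^ 2 * (s * (1 - s)) := by
  set u₀ := U.indicator u
  set v₀ : Fin 2 → Plane → ℝ := fun i => U.indicator (v i)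
  have hu₀ : LocallyIntegrable u₀ := (hui.integrable_indicator hU.measurableSet).locallyIntegrable
  have hv₀ : ∀ i, LocallyIntegrable (v₀ i) := fun i =>
    ((hvi i).integrable_indicator hU.measurableSet).locallyIntegrable
  have hd1 : ∀ i, HasWeakPartial U i u₀ (v₀ i) := fun i =>
    (hv i).congr_ae (restrict_indicator_ae_eq hU.measurableSet _)
      (restrict_indicator_ae_eq hU.measurableSet _)
  have hd2 : ∀ i j, HasWeakPartial U j (v₀ i) (w i j) := fun i j =>
    (hw i j).congr_ae (restrict_indicator_ae_eq hU.measurableSet _) Filter.EventuallyEq.rfl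
  have hseg : ∀ r ∈ Icc (0 : ℝ) 1, a + r • (b - a) ∈ segment ℝ a b := fun r hr => by
    rw [segment_eq_image']
    exact ⟨r, hr, rfl⟩
  have hcomp : IsCompact (segment ℝ a b) := by
    rw [segment_eq_image']
    exact isCompact_Icc.image (by fun_prop)
  obtain ⟨δ, hδ, hδU⟩ := hcomp.exists_cthickening_subset_open hU (hUc.segment_subset ha hb)
  have hev : ∀ᶠ k in Filter.atTop, (bumpSeq k).rOut < δ :=
    tendsto_bumpSeq_rOut.eventually (gt_mem_nhds hδ)
  have hball : ∀ {φ : ContDiffBump (0 : Plane)}, φ.rOut < δ → ∀ r ∈ Icc (0 : ℝ) 1,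
      Metric.closedBall (a + r • (b - a)) φ.rOut ⊆ U := fun hφ r hr =>
    (Metric.closedBall_subset_closedBall hφ.le).trans
      ((Metric.closedBall_subset_cthickening (hseg r hr) δ).trans hδU)
  have hlim : ∀ x ∈ U, Filter.Tendsto (fun k => mollify (bumpSeq k) u₀ x) Filter.atTop
      (nhds (u x)) := by
    intro x hx
    have h1 : u₀ =ᶠ[nhds x] u := by
      filter_upwards [hU.mem_nhds hx] with y hy
      exact indicator_of_mem hy u
    have h2 : ContinuousAt u₀ x := (hc.continuousAt (hU.mem_nhds hx)).congr h1.symm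
    have h3 := tendsto_mollify hu₀ h2
    rwa [show u₀ x = u x from indicator_of_mem hx u] at h3
  have hxs : a + s • (b - a) ∈ U := hUc.segment_subset ha hb (hseg s hs)
  refine le_of_tendsto ((hlim _ hxs).sub (((hlim a ha).const_mul (1 - s)).add
    ((hlim b hb).const_mul s))).abs ?_
  filter_upwards [hev] with k hk
  set φ := bumpSeq k
  have key := abs_sub_chord_le (K := M * ‖b - a‖ ^ 2) (s := s)
    (g := fun r : ℝ => mollify φ u₀ (a + r • (b - a)))
    (g' := fun r => ∑ i, (b - a) i * mollify φ (v₀ i) (a + r • (b - a)))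
    (g'' := fun r => ∑ i, (b - a) i * ∑ j, (b - a) j * mollify φ (w i j) (a + r • (b - a)))
    (fun r hr => hasDerivAt_mollify_line hu₀ hd1 φ (hball hk r hr))
    (fun r hr => HasDerivAt.fun_sum fun i _ =>
      (hasDerivAt_mollify_line (hv₀ i) (hd2 i) φ (hball hk r hr)).const_mul _)
    (fun r hr => ?_) hs
  · simp only [zero_smul, add_zero, one_smul, add_sub_cancel] at key
    refine key.trans (le_of_eq (by ring))
  · refine (Finset.abs_sum_le_sum_abs _ _).trans (le_trans ?_ (hM (b - a)))
    refine Finset.sum_le_sum fun i _ => ?_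
    rw [abs_mul]
    refine mul_le_mul_of_nonneg_left ?_ (abs_nonneg _)
    refine (Finset.abs_sum_le_sum_abs _ _).trans (Finset.sum_le_sum fun j _ => ?_)
    rw [abs_mul]
    exact mul_le_mul_of_nonneg_left
      (abs_mollify_le (hB i j) hU.measurableSet φ (hball hk r hr)) (abs_nonneg _)

/-! ### The Poincaré inequality on convex sets -/

theorem lintegral_mul_sq_le {α : Type*} [MeasurableSpace α] {μ : Measure α} {F ρ : α → ℝ≥0∞}
    (hF : AEMeasurable F μ) (hρ : AEMeasurable ρ μ) :
    (∫⁻ x, F x * ρ x ∂μ) ^ 2 ≤ (∫⁻ x, F x ^ 2 * ρ x ∂μ) * ∫⁻ x, ρ x ∂μ := by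
  have h := ENNReal.lintegral_mul_le_Lp_mul_Lq μ Real.HolderConjugate.two_two
    (hF.mul (hρ.pow_const (1 / 2 : ℝ))) (hρ.pow_const (1 / 2 : ℝ))
  have e : ∀ r : ℝ≥0∞, r ^ (1 / 2 : ℝ) * r ^ (1 / 2 : ℝ) = r := fun r => by
    rw [← ENNReal.rpow_add_of_nonneg _ _ (by norm_num) (by norm_num)]
    norm_num
  have e2 : ∀ r : ℝ≥0∞, (r ^ (1 / 2 : ℝ)) ^ 2 = r := fun r => by rw [pow_two, e]
  simp only [Pi.mul_apply, mul_assoc, e, ENNReal.rpow_two, mul_pow, e2] at h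
  calc (∫⁻ x, F x * ρ x ∂μ) ^ 2 ≤ _ := pow_le_pow_left' h 2
    _ = _ := by rw [mul_pow, e2, e2]

theorem lintegral_mollify_sq_le {v : Plane → ℝ} (hv : Integrable v)
    (φ : ContDiffBump (0 : Plane)) :
    ∫⁻ x, ‖mollify φ v x‖ₑ ^ 2 ≤ ∫⁻ x, ‖v x‖ₑ ^ 2 := by
  have hone : ∀ x, ∫⁻ y, ‖φ.normed volume (x - y)‖ₑ = 1 := by
    intro x
    have h1 : ∫⁻ y, ‖φ.normed volume (x - y)‖ₑ = ∫⁻ y, ‖φ.normed (volume : Measure Plane) y‖ₑ :=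
      lintegral_sub_left_eq_self (fun y => ‖φ.normed (volume : Measure Plane) y‖ₑ) x
    rw [h1, ← ofReal_integral_norm_eq_lintegral_enorm φ.integrable_normed]
    simp only [Real.norm_eq_abs, abs_of_nonneg (φ.nonneg_normed _)]
    rw [φ.integral_normed, ENNReal.ofReal_one]
  have hone' : ∀ y, ∫⁻ x, ‖φ.normed volume (x - y)‖ₑ = 1 := by
    intro y
    rw [lintegral_sub_right_eq_self (fun x => ‖φ.normed (volume : Measure Plane) x‖ₑ) y]
    simpa using (lintegral_sub_left_eq_self
      (fun y => ‖φ.normed (volume : Measure Plane) y‖ₑ) 0).symm.trans (hone 0)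
  have hm : ∀ x, AEMeasurable fun y => ‖φ.normed (volume : Measure Plane) (x - y)‖ₑ := fun x =>
    ((φ.continuous_normed.comp (continuous_const.sub continuous_id)).enorm).measurable.aemeasurable
  have hpt : ∀ x, ‖mollify φ v x‖ₑ ^ 2 ≤ ∫⁻ y, ‖v y‖ₑ ^ 2 * ‖φ.normed volume (x - y)‖ₑ := by
    intro x
    have h1 : ‖mollify φ v x‖ₑ ≤ ∫⁻ y, ‖v y‖ₑ * ‖φ.normed volume (x - y)‖ₑ := by
      rw [mollify_apply]
      refine (enorm_integral_le_lintegral_enorm _).trans (le_of_eq ?_)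
      simp only [enorm_mul]
    refine (pow_le_pow_left' h1 2).trans ?_
    refine (lintegral_mul_sq_le hv.1.enorm (hm x)).trans ?_
    rw [hone x, mul_one]
  calc ∫⁻ x, ‖mollify φ v x‖ₑ ^ 2
      ≤ ∫⁻ x, ∫⁻ y, ‖v y‖ₑ ^ 2 * ‖φ.normed volume (x - y)‖ₑ := lintegral_mono hpt
    _ = ∫⁻ y, ∫⁻ x, ‖v y‖ₑ ^ 2 * ‖φ.normed volume (x - y)‖ₑ := by
        refine lintegral_lintegral_swap ?_
        refine ((hv.1.enorm.pow_const 2).comp_snd).mul ?_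
        exact ((φ.continuous_normed.comp
          (continuous_fst.sub continuous_snd)).enorm).measurable.aemeasurable
    _ = ∫⁻ y, ‖v y‖ₑ ^ 2 := by
        refine lintegral_congr fun y => ?_
        rw [lintegral_const_mul' _ _ (by simp), hone' y, mul_one]

theorem continuous_mollify {v : Plane → ℝ} (hv : LocallyIntegrable v)
    (φ : ContDiffBump (0 : Plane)) : Continuous (mollify φ v) :=
  φ.hasCompactSupport_normed.continuous_convolution_left _ φ.continuous_normed hv

theorem enorm_sum_mul_sq_le (h : Plane) (c : Fin 2 → ℝ) :
    ‖∑ i, h i * c i‖ₑ ^ 2 ≤ ‖h‖ₑ ^ 2 * ∑ i, ‖c i‖ₑ ^ 2 := by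
  have key : (∑ i, h i * c i) ^ 2 ≤ ‖h‖ ^ 2 * ∑ i, c i ^ 2 := by
    rw [EuclideanSpace.real_norm_sq_eq]
    exact Finset.sum_mul_sq_le_sq_mul_sq _ _ _
  have e : ∀ r : ℝ, ‖r‖ₑ ^ 2 = ENNReal.ofReal (r ^ 2) := fun r => by
    rw [Real.enorm_eq_ofReal_abs, ← ENNReal.ofReal_pow (abs_nonneg r), sq_abs]
  have e' : ‖h‖ₑ ^ 2 = ENNReal.ofReal (‖h‖ ^ 2) := by
    rw [← ofReal_norm, ENNReal.ofReal_pow (norm_nonneg _)]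
  simp only [e, e']
  rw [← ENNReal.ofReal_sum_of_nonneg fun i _ => sq_nonneg _,
    ← ENNReal.ofReal_mul (sq_nonneg _)]
  exact ENNReal.ofReal_le_ofReal key

/-- The `L²` bound for differences of a function with square integrable weak gradient. -/
theorem lintegral_shift_sub_sq_le {K : Set Plane} (hK : IsOpen K) (hKc : Convex ℝ K)
    {f : Plane → ℝ} {v : Fin 2 → Plane → ℝ} (hf : IntegrableOn f K)
    (hvi : ∀ i, IntegrableOn (v i) K) (hv : ∀ i, HasWeakPartial K i f (v i)) (h : Plane) :
    ∫⁻ x in K ∩ (fun x => x + h) ⁻¹' K, ‖f (x + h) - f x‖ₑ ^ 2 ≤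
      ‖h‖ₑ ^ 2 * ∑ i, ∫⁻ x in K, ‖v i x‖ₑ ^ 2 := by
  set f₀ := K.indicator f
  set v₀ : Fin 2 → Plane → ℝ := fun i => K.indicator (v i)
  have hf₀ : LocallyIntegrable f₀ := (hf.integrable_indicator hK.measurableSet).locallyIntegrable
  have hv₀ : ∀ i, Integrable (v₀ i) := fun i => (hvi i).integrable_indicator hK.measurableSet
  have hd : ∀ i, HasWeakPartial K i f₀ (v₀ i) := fun i =>
    (hv i).congr_ae (restrict_indicator_ae_eq hK.measurableSet _)
      (restrict_indicator_ae_eq hK.measurableSet _)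
  have hAm : MeasurableSet (K ∩ (fun x => x + h) ⁻¹' K) :=
    hK.measurableSet.inter ((hK.preimage (by fun_prop)).measurableSet)
  set A : ℕ → Set Plane := fun k => {x | Metric.closedBall x (bumpSeq k).rOut ⊆ K ∧
    Metric.closedBall (x + h) (bumpSeq k).rOut ⊆ K}
  set Φ : ℕ → Plane → ℝ≥0∞ := fun k x =>
    ‖mollify (bumpSeq k) f₀ (x + h) - mollify (bumpSeq k) f₀ x‖ₑ ^ 2
  have hbound : ∀ k, ∫⁻ x in K ∩ (fun x => x + h) ⁻¹' K, (A k).indicator (Φ k) x ≤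
      ‖h‖ₑ ^ 2 * ∑ i, ∫⁻ x in K, ‖v i x‖ₑ ^ 2 := by
    intro k
    set φ := bumpSeq k
    set D : Plane → ℝ → ℝ := fun x s => ∑ i, h i * mollify φ (v₀ i) (x + s • h)
    have hcont : ∀ i, Continuous (mollify φ (v₀ i)) := fun i =>
      continuous_mollify (hv₀ i).locallyIntegrable φ
    have hDc : Continuous fun p : Plane × ℝ => D p.1 p.2 := by
      simp only [D]
      fun_prop
    have hpt : ∀ x, (A k).indicator (Φ k) x ≤ ∫⁻ s in Ioc (0 : ℝ) 1, ‖D x s‖ₑ ^ 2 := by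
      intro x
      by_cases hx : x ∈ A k
      swap
      · rw [indicator_of_notMem hx]; exact zero_le
      rw [indicator_of_mem hx]
      have hin : ∀ s ∈ uIcc (0 : ℝ) 1, Metric.closedBall (x + s • h) φ.rOut ⊆ K := by
        intro s hs y hy
        rw [uIcc_of_le zero_le_one] at hs
        have hyx : ‖y - (x + s • h)‖ ≤ φ.rOut := by
          rwa [Metric.mem_closedBall, dist_eq_norm] at hy
        have m1 : y - s • h ∈ K := hx.1 (by
          rw [Metric.mem_closedBall, dist_eq_norm]
          rwa [show y - s • h - x = y - (x + s • h) by abel])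
        have m2 : y - s • h + h ∈ K := hx.2 (by
          rw [Metric.mem_closedBall, dist_eq_norm]
          rwa [show y - s • h + h - (x + h) = y - (x + s • h) by abel])
        have := hKc m1 m2 (sub_nonneg.2 hs.2) hs.1 (by ring)
        convert this using 1
        module
      have hftc : ∫ s in (0 : ℝ)..1, D x s = mollify φ f₀ (x + h) - mollify φ f₀ x := by
        have := intervalIntegral.integral_eq_sub_of_hasDerivAt
          (f := fun s : ℝ => mollify φ f₀ (x + s • h)) (f' := D x) (a := 0) (b := 1)
          (fun s hs => hasDerivAt_mollify_line hf₀ hd φ (hin s hs))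
          ((hDc.comp (Continuous.prodMk_right x)).intervalIntegrable _ _)
        simpa using this
      simp only [Φ]
      rw [← hftc, intervalIntegral.integral_of_le zero_le_one]
      refine (pow_le_pow_left' (enorm_integral_le_lintegral_enorm _) 2).trans ?_
      have := lintegral_mul_sq_le (μ := volume.restrict (Ioc (0 : ℝ) 1))
        (F := fun s => ‖D x s‖ₑ) (ρ := fun _ => 1)
        ((hDc.comp (Continuous.prodMk_right x)).enorm.measurable.aemeasurable) aemeasurable_const
      simpa using this
    calc ∫⁻ x in K ∩ (fun x => x + h) ⁻¹' K, (A k).indicator (Φ k) x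
        ≤ ∫⁻ x, (A k).indicator (Φ k) x := setLIntegral_le_lintegral _ _
      _ ≤ ∫⁻ x, ∫⁻ s in Ioc (0 : ℝ) 1, ‖D x s‖ₑ ^ 2 := lintegral_mono hpt
      _ = ∫⁻ s in Ioc (0 : ℝ) 1, ∫⁻ x, ‖D x s‖ₑ ^ 2 :=
          lintegral_lintegral_swap (hDc.enorm.measurable.pow_const 2).aemeasurable
      _ ≤ ∫⁻ s in Ioc (0 : ℝ) 1, ‖h‖ₑ ^ 2 * ∑ i, ∫⁻ x in K, ‖v i x‖ₑ ^ 2 := by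
          refine lintegral_mono fun s => ?_
          calc ∫⁻ x, ‖D x s‖ₑ ^ 2
              ≤ ∫⁻ x, ‖h‖ₑ ^ 2 * ∑ i, ‖mollify φ (v₀ i) (x + s • h)‖ₑ ^ 2 :=
                lintegral_mono fun x => enorm_sum_mul_sq_le h _
            _ = ‖h‖ₑ ^ 2 * ∑ i, ∫⁻ x, ‖mollify φ (v₀ i) (x + s • h)‖ₑ ^ 2 := by
                rw [lintegral_const_mul' _ _ (by simp), lintegral_finsetSum]
                exact fun i _ => (((hcont i).comp (by fun_prop)).enorm.measurable.pow_const 2)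
            _ ≤ _ := by
                refine mul_le_mul_right (Finset.sum_le_sum fun i _ => ?_) _
                rw [lintegral_add_right_eq_self (fun x => ‖mollify φ (v₀ i) x‖ₑ ^ 2)]
                refine (lintegral_mollify_sq_le (hv₀ i) φ).trans ?_
                rw [← lintegral_indicator hK.measurableSet]
                refine lintegral_mono fun x => ?_
                by_cases hx : x ∈ K <;> simp [v₀, hx]
      _ = _ := by simp
  have hlim := ae_tendsto_mollify hf₀
  have hlim' : ∀ᵐ x : Plane, Filter.Tendsto (fun k => mollify (bumpSeq k) f₀ (x + h))
      Filter.atTop (nhds (f₀ (x + h))) :=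
    (measurePreserving_add_right (volume : Measure Plane) h).quasiMeasurePreserving.ae hlim
  have hΦm : ∀ k, Measurable (Φ k) := fun k =>
    ((((continuous_mollify hf₀ _).comp (by fun_prop)).sub
      (continuous_mollify hf₀ _)).enorm.measurable.pow_const 2)
  have hAk : ∀ k, MeasurableSet (A k) := by
    intro k
    have hcl : ∀ g : Plane → Plane, Continuous g →
        MeasurableSet {x | Metric.closedBall (g x) (bumpSeq k).rOut ⊆ K} := by
      intro g hg
      have : {x | Metric.closedBall (g x) (bumpSeq k).rOut ⊆ K} =
          (g ⁻¹' (Metric.cthickening (bumpSeq k).rOut Kᶜ))ᶜ := by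
        ext x
        simp only [mem_ofPred_eq, mem_compl_iff, mem_preimage]
        rw [hK.isClosed_compl.cthickening_eq_biUnion_closedBall (bumpSeq k).rOut_pos.le]
        simp only [mem_iUnion, not_exists, Metric.mem_closedBall, mem_compl_iff, subset_def]
        constructor
        · intro H y hy hxy
          exact hy (H y (by rwa [dist_comm]))
        · intro H y hy
          by_contra hyK
          exact H y hyK (by rwa [dist_comm])
      rw [this]
      exact ((Metric.isClosed_cthickening.preimage hg).measurableSet).compl
    exact (hcl _ continuous_id).inter (hcl (fun x => x + h) (by fun_prop))
  refine le_trans ?_ (Filter.liminf_le_of_le (f := Filter.atTop) ⟨0, by simp⟩ (fun b hb => ?_) :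
    Filter.liminf (fun k => ∫⁻ x in K ∩ (fun x => x + h) ⁻¹' K, (A k).indicator (Φ k) x)
      Filter.atTop ≤ _)
  · refine le_trans ?_ (lintegral_liminf_le fun k => (hΦm k).indicator (hAk k))
    refine lintegral_mono_ae ((ae_restrict_iff' hAm).2 ?_)
    filter_upwards [hlim, hlim'] with x h1 h2 hx
    have e1 : f₀ x = f x := indicator_of_mem hx.1 f
    have e2 : f₀ (x + h) = f (x + h) := indicator_of_mem (s := K) hx.2 f
    have h3 : Filter.Tendsto (fun k => Φ k x) Filter.atTop (nhds (‖f (x + h) - f x‖ₑ ^ 2)) := by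
      rw [← e1, ← e2]
      exact ((ENNReal.continuous_pow 2).tendsto _).comp ((h2.sub h1).enorm)
    have h4 : ∀ᶠ k in Filter.atTop, Φ k x = (A k).indicator (Φ k) x := by
      obtain ⟨r1, hr1, hb1⟩ := Metric.nhds_basis_closedBall.mem_iff.1 (hK.mem_nhds hx.1)
      obtain ⟨r2, hr2, hb2⟩ := Metric.nhds_basis_closedBall.mem_iff.1 (hK.mem_nhds hx.2)
      filter_upwards [tendsto_bumpSeq_rOut.eventually (gt_mem_nhds (lt_min hr1 hr2))] with k hk
      rw [indicator_of_mem]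
      exact ⟨(Metric.closedBall_subset_closedBall (hk.le.trans (min_le_left _ _))).trans hb1,
        (Metric.closedBall_subset_closedBall (hk.le.trans (min_le_right _ _))).trans hb2⟩
    exact (h3.congr' h4).liminf_eq.ge
  · obtain ⟨k, hk⟩ := hb.exists
    exact hk.trans (hbound k)

/-- The Poincaré inequality on a convex open set. -/
theorem exists_lintegral_sub_const_sq_le {K : Set Plane} (hK : IsOpen K) (hKc : Convex ℝ K)
    (hKne : volume K ≠ 0) (hKfin : volume K ≠ ⊤) {d : ℝ}
    (hd : ∀ x ∈ K, ∀ y ∈ K, ‖x - y‖ ≤ d)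
    {f : Plane → ℝ} {v : Fin 2 → Plane → ℝ} (hf : IntegrableOn f K)
    (hvi : ∀ i, IntegrableOn (v i) K) (hv : ∀ i, HasWeakPartial K i f (v i)) :
    ∃ c : ℝ, ∫⁻ x in K, ‖f x - c‖ₑ ^ 2 ≤
      (volume K)⁻¹ * (volume (Metric.closedBall (0 : Plane) d) *
        (ENNReal.ofReal d ^ 2 * ∑ i, ∫⁻ x in K, ‖v i x‖ₑ ^ 2)) := by
  set S := ∑ i, ∫⁻ x in K, ‖v i x‖ₑ ^ 2
  set f₀ := K.indicator f
  have hfm : AEMeasurable f₀ := (hf.integrable_indicator hK.measurableSet).1.aemeasurable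
  set χ : Plane → ℝ≥0∞ := K.indicator 1
  have hχ : Measurable χ := measurable_one.indicator hK.measurableSet
  set H : Plane → Plane → ℝ≥0∞ := fun y x => χ y * (χ x * ‖f₀ x - f₀ y‖ₑ ^ 2)
  have hHm : AEMeasurable (Function.uncurry H) (volume.prod volume) := by
    refine (hχ.comp measurable_fst).aemeasurable.mul
      ((hχ.comp measurable_snd).aemeasurable.mul ?_)
    exact ((hfm.comp_snd.sub hfm.comp_fst).enorm).pow_const 2
  have hH : ∀ y ∈ K, ∫⁻ x, H y x = ∫⁻ x in K, ‖f x - f y‖ₑ ^ 2 := by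
    intro y hy
    rw [← lintegral_indicator hK.measurableSet]
    refine lintegral_congr fun x => ?_
    by_cases hx : x ∈ K <;> simp [H, χ, f₀, hx, hy]
  have hshift : ∀ h : Plane, ∫⁻ y, H y (y + h) ≤
      (Metric.closedBall (0 : Plane) d).indicator (fun _ => ENNReal.ofReal d ^ 2 * S) h := by
    intro h
    have e1 : ∫⁻ y, H y (y + h) = ∫⁻ y in K ∩ (fun x => x + h) ⁻¹' K, ‖f (y + h) - f y‖ₑ ^ 2 := by
      rw [← lintegral_indicator (hK.measurableSet.inter
        ((hK.preimage (by fun_prop)).measurableSet))]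
      refine lintegral_congr fun y => ?_
      by_cases hy : y ∈ K <;> by_cases hyh : y + h ∈ K <;> simp [H, χ, f₀, hy, hyh]
    rw [e1]
    by_cases hh : h ∈ Metric.closedBall (0 : Plane) d
    · rw [indicator_of_mem hh]
      refine (lintegral_shift_sub_sq_le hK hKc hf hvi hv h).trans ?_
      gcongr
      rw [← ofReal_norm]
      exact ENNReal.ofReal_le_ofReal (mem_closedBall_zero_iff.1 hh)
    · have : K ∩ (fun x => x + h) ⁻¹' K = ∅ := by
        refine eq_empty_of_forall_notMem fun y hy => hh ?_
        rw [mem_closedBall_zero_iff]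
        simpa using hd _ hy.2 _ hy.1
      rw [this]
      simp
  have htot : ∫⁻ y, ∫⁻ x, H y x ≤
      volume (Metric.closedBall (0 : Plane) d) * (ENNReal.ofReal d ^ 2 * S) := by
    calc ∫⁻ y, ∫⁻ x, H y x = ∫⁻ y, ∫⁻ h, H y (y + h) := by
          refine lintegral_congr fun y => ?_
          exact (lintegral_add_left_eq_self (fun x => H y x) y).symm
      _ = ∫⁻ h, ∫⁻ y, H y (y + h) := by
          refine lintegral_lintegral_swap ?_
          have := hHm.comp_quasiMeasurePreserving
            (measurePreserving_prod_add (volume : Measure Plane) volume).quasiMeasurePreserving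
          exact this
      _ ≤ _ := by
          refine (lintegral_mono hshift).trans ?_
          rw [lintegral_indicator Metric.isClosed_closedBall.measurableSet, lintegral_const,
            Measure.restrict_apply_univ, mul_comm]
  obtain ⟨y, hyK, hy⟩ := exists_le_setLAverage hKne hKfin
    (f := fun y => ∫⁻ x, H y x) (hHm.lintegral_prod_right').restrict
  refine ⟨f y, ?_⟩
  rw [← hH y hyK]
  refine hy.trans ?_
  rw [setLAverage_eq, div_eq_mul_inv, mul_comm]
  gcongr
  exact (setLIntegral_le_lintegral _ _).trans htot

/-! ### Triangles and barycentric coordinates -/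

/-- `s` is the vertex set of a nondegenerate triangle. -/
structure IsTri (s : Finset Plane) : Prop where
  card : s.card = 3
  indep : AffineIndependent ℝ ((↑) : s → Plane)

theorem Mesh.isTri {Ω : Set Plane} (T : Mesh Ω) {s : Finset Plane} (hs : s ∈ T.elems) : IsTri s :=
  ⟨T.card_eq s hs, T.indep s hs⟩

/-- The affine basis given by the vertices of a triangle. -/
def IsTri.basis {s : Finset Plane} (h : IsTri s) : AffineBasis s ℝ Plane where
  toFun := (↑)
  ind' := h.indep
  tot' := by
    rw [h.indep.affineSpan_eq_top_iff_card_eq_finrank_add_one]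
    simp [h.card]

theorem IsTri.basis_apply {s : Finset Plane} (h : IsTri s) (y : s) : h.basis y = y := rfl

theorem IsTri.range_basis {s : Finset Plane} (h : IsTri s) : range h.basis = s := by
  change range ((↑) : s → Plane) = s
  simp

theorem IsTri.apply_eq_sum_coord {s : Finset Plane} (h : IsTri s) (A : Plane →ᵃ[ℝ] ℝ)
    (x : Plane) : A x = ∑ y, h.basis.coord y x * A y := by
  have h1 := h.basis.affineCombination_coord_eq_self x
  conv_lhs => rw [← h1]
  rw [Finset.map_affineCombination _ _ _ (h.basis.sum_coord_apply_eq_one x),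
    Finset.affineCombination_eq_linear_combination _ _ _ (h.basis.sum_coord_apply_eq_one x)]
  rfl

open Classical in
theorem IsTri.baryCoord_vertex {s : Finset Plane} (h : IsTri s) (z : Plane) {y : Plane}
    (hy : y ∈ s) : baryCoord s z y = if y = z then 1 else 0 := by
  have hex : ∃ A : Plane →ᵃ[ℝ] ℝ, ∀ y ∈ s, A y = if y = z then 1 else 0 := by
    by_cases hz : z ∈ s
    · refine ⟨h.basis.coord ⟨z, hz⟩, fun y hy => ?_⟩
      have := h.basis.coord_apply ⟨z, hz⟩ ⟨y, hy⟩
      rw [h.basis_apply] at this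
      rw [this]
      simp only [Subtype.mk.injEq, eq_comm]
    · refine ⟨0, fun y hy => ?_⟩
      rw [if_neg (by rintro rfl; exact hz hy)]
      rfl
  rw [baryCoord, dif_pos hex]
  exact hex.choose_spec y hy

theorem IsTri.baryCoord_self {s : Finset Plane} (h : IsTri s) {z : Plane} (hz : z ∈ s) :
    baryCoord s z z = 1 := by
  rw [h.baryCoord_vertex z hz, if_pos rfl]

theorem IsTri.baryCoord_of_ne {s : Finset Plane} (h : IsTri s) {y z : Plane} (hy : y ∈ s)
    (hyz : y ≠ z) : baryCoord s z y = 0 := by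
  rw [h.baryCoord_vertex z hy, if_neg hyz]

theorem IsTri.ext {s : Finset Plane} (h : IsTri s) {A A' : Plane →ᵃ[ℝ] ℝ}
    (hA : ∀ y ∈ s, A y = A' y) (x : Plane) : A x = A' x := by
  rw [h.apply_eq_sum_coord A, h.apply_eq_sum_coord A']
  exact Finset.sum_congr rfl fun y _ => by rw [hA y y.2]

theorem IsTri.coord_eq {s : Finset Plane} (h : IsTri s) (z : s) (x : Plane) :
    h.basis.coord z x = baryCoord s z x := by
  refine h.ext (fun y hy => ?_) x
  have := h.basis.coord_apply z ⟨y, hy⟩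
  rw [h.basis_apply] at this
  rw [this, h.baryCoord_vertex _ hy]
  refine if_congr ?_ rfl rfl
  rw [eq_comm, Subtype.ext_iff]

theorem IsTri.baryCoord_of_notMem {s : Finset Plane} (h : IsTri s) {z : Plane} (hz : z ∉ s)
    (x : Plane) : baryCoord s z x = 0 :=
  h.ext (A' := 0) (fun y hy => h.baryCoord_of_ne hy (by rintro rfl; exact hz hy)) x

theorem IsTri.apply_eq_sum {s : Finset Plane} (h : IsTri s) (A : Plane →ᵃ[ℝ] ℝ) (x : Plane) :
    A x = ∑ y ∈ s, baryCoord s y x * A y := by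
  rw [h.apply_eq_sum_coord A, ← Finset.sum_coe_sort s]
  exact Finset.sum_congr rfl fun y _ => by rw [h.coord_eq]

theorem IsTri.sum_baryCoord {s : Finset Plane} (h : IsTri s) (x : Plane) :
    ∑ y ∈ s, baryCoord s y x = 1 := by
  have := h.apply_eq_sum (AffineMap.const ℝ Plane (1 : ℝ)) x
  simpa using this.symm

theorem IsTri.sum_baryCoord_smul {s : Finset Plane} (h : IsTri s) (x : Plane) :
    ∑ y ∈ s, baryCoord s y x • y = x := by
  have h1 := h.basis.linear_combination_coord_eq_self x
  conv_rhs => rw [← h1]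
  rw [← Finset.sum_coe_sort s]
  exact Finset.sum_congr rfl fun y _ => by rw [h.coord_eq]; rfl

theorem IsTri.mem_tri_iff {s : Finset Plane} (h : IsTri s) {x : Plane} :
    x ∈ tri s ↔ ∀ y ∈ s, 0 ≤ baryCoord s y x := by
  have := h.basis.convexHull_eq_nonneg_coord
  rw [h.range_basis] at this
  rw [tri, this]
  simp only [mem_ofPred_eq, h.coord_eq, Subtype.forall]

theorem IsTri.mem_interior_iff {s : Finset Plane} (h : IsTri s) {x : Plane} :
    x ∈ interior (tri s) ↔ ∀ y ∈ s, 0 < baryCoord s y x := by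
  have := h.basis.interior_convexHull
  rw [h.range_basis] at this
  rw [tri, this]
  simp only [mem_ofPred_eq, h.coord_eq, Subtype.forall]

theorem IsTri.baryCoord_le_one {s : Finset Plane} (h : IsTri s) {x : Plane} (hx : x ∈ tri s)
    {y : Plane} (hy : y ∈ s) : baryCoord s y x ≤ 1 := by
  rw [← h.sum_baryCoord x]
  exact Finset.single_le_sum (f := fun y => baryCoord s y x) (h.mem_tri_iff.1 hx) hy

/-- The affine function with prescribed values at the vertices of a triangle. -/
def vertexInterp (s : Finset Plane) (u : Plane → ℝ) : Plane →ᵃ[ℝ] ℝ :=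
  ∑ y ∈ s, u y • baryCoord s y

theorem vertexInterp_apply (s : Finset Plane) (u : Plane → ℝ) (x : Plane) :
    vertexInterp s u x = ∑ y ∈ s, baryCoord s y x * u y := by
  rw [vertexInterp]
  have : ∀ t : Finset Plane, (∑ y ∈ t, u y • baryCoord s y) x =
      ∑ y ∈ t, baryCoord s y x * u y := by
    classical
    intro t
    induction t using Finset.induction_on with
    | empty => simp
    | insert a t ha ih =>
      rw [Finset.sum_insert ha, Finset.sum_insert ha, ← ih]
      simp [mul_comm]
  exact this s

theorem IsTri.vertexInterp_vertex {s : Finset Plane} (h : IsTri s) (u : Plane → ℝ) {z : Plane}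
    (hz : z ∈ s) : vertexInterp s u z = u z := by
  rw [vertexInterp_apply, Finset.sum_eq_single z]
  · rw [h.baryCoord_self hz, one_mul]
  · intro y _ hyz
    rw [h.baryCoord_of_ne hz hyz.symm, zero_mul]
  · exact fun h' => (h' hz).elim

theorem convex_tri (s : Finset Plane) : Convex ℝ (tri s) := convex_convexHull ℝ _

theorem isCompact_tri (s : Finset Plane) : IsCompact (tri s) :=
  s.finite_toSet.isCompact_convexHull ℝ

theorem vertex_mem_tri {s : Finset Plane} {z : Plane} (hz : z ∈ s) : z ∈ tri s :=
  subset_convexHull ℝ _ hz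

theorem volume_frontier_tri (s : Finset Plane) : volume (frontier (tri s)) = 0 :=
  (convex_tri s).addHaar_frontier volume

theorem interior_tri_ae_eq (s : Finset Plane) :
    (interior (tri s) : Set Plane) =ᵐ[volume] tri s :=
  interior_ae_eq_of_null_frontier (volume_frontier_tri s)

theorem dist_le_diam_tri {s : Finset Plane} {x y : Plane} (hx : x ∈ tri s) (hy : y ∈ tri s) :
    dist x y ≤ Metric.diam (tri s) :=
  Metric.dist_le_diam_of_mem (isCompact_tri s).isBounded hx hy

theorem IsTri.diam_pos {s : Finset Plane} (h : IsTri s) : 0 < Metric.diam (tri s) := by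
  obtain ⟨a, ha, b, hb, hab⟩ := Finset.one_lt_card.1 (show 1 < s.card by rw [h.card]; norm_num)
  exact (dist_pos.2 hab).trans_le (dist_le_diam_tri (vertex_mem_tri ha) (vertex_mem_tri hb))

/-- The gradient of an affine function. -/
def affGrad (A : Plane →ᵃ[ℝ] ℝ) : Plane :=
  (InnerProductSpace.toDual ℝ Plane).symm (LinearMap.toContinuousLinearMap A.linear)

theorem inner_affGrad (A : Plane →ᵃ[ℝ] ℝ) (w : Plane) : inner ℝ (affGrad A) w = A.linear w := by
  rw [affGrad, InnerProductSpace.toDual_symm_apply]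
  rfl

theorem affine_add (A : Plane →ᵃ[ℝ] ℝ) (x w : Plane) :
    A (x + w) = A x + inner ℝ (affGrad A) w := by
  rw [inner_affGrad, add_comm x w, ← vadd_eq_add, A.map_vadd, vadd_eq_add, add_comm]

theorem affine_eq (A : Plane →ᵃ[ℝ] ℝ) (x : Plane) : A x = inner ℝ (affGrad A) x + A 0 := by
  have := affine_add A 0 x
  rw [zero_add] at this
  rw [this, add_comm]

theorem affine_sub (A : Plane →ᵃ[ℝ] ℝ) (x y : Plane) :
    A x - A y = inner ℝ (affGrad A) (x - y) := by
  have := affine_add A y (x - y)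
  rw [add_sub_cancel] at this
  rw [this]
  ring

theorem norm_affGrad_mul_le {A : Plane →ᵃ[ℝ] ℝ} {c : Plane} {ρ : ℝ} (hρ : 0 ≤ ρ)
    (h : ∀ x ∈ Metric.closedBall c ρ, A x ∈ Icc (0 : ℝ) 1) : ‖affGrad A‖ * ρ ≤ 1 := by
  rcases eq_or_ne (affGrad A) 0 with h0 | h0
  · rw [h0]; simp
  have hn : 0 < ‖affGrad A‖ := norm_pos_iff.2 h0
  have h1 := h (c + (ρ / ‖affGrad A‖) • affGrad A) (by
    rw [Metric.mem_closedBall, dist_eq_norm, add_sub_cancel_left, norm_smul, Real.norm_eq_abs,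
      abs_of_nonneg (by positivity)]
    rw [div_mul_cancel₀ _ hn.ne'])
  have h2 := h c (Metric.mem_closedBall_self hρ)
  rw [affine_add, inner_smul_right, real_inner_self_eq_norm_sq] at h1
  have h3 : ρ / ‖affGrad A‖ * ‖affGrad A‖ ^ 2 = ‖affGrad A‖ * ρ := by
    field_simp
  rw [h3] at h1
  linarith [h1.2, h2.1]

/-- `s` contains a disc of radius `diam s / κ`. -/
def ShapeReg (κ : ℝ) (s : Finset Plane) : Prop :=
  ∃ c, Metric.closedBall c (Metric.diam (tri s) / κ) ⊆ tri s

theorem IsTri.norm_affGrad_baryCoord_le {s : Finset Plane} (h : IsTri s) {κ : ℝ} (hκ : 0 < κ)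
    (hr : ShapeReg κ s) {y : Plane} (hy : y ∈ s) :
    ‖affGrad (baryCoord s y)‖ ≤ κ / Metric.diam (tri s) := by
  obtain ⟨c, hc⟩ := hr
  have h1 := norm_affGrad_mul_le (A := baryCoord s y) (c := c)
    (div_nonneg h.diam_pos.le hκ.le)
    fun x hx => ⟨h.mem_tri_iff.1 (hc hx) y hy, h.baryCoord_le_one (hc hx) hy⟩
  have hd := h.diam_pos
  rw [le_div_iff₀ hd]
  rw [mul_div_assoc', div_le_one hκ] at h1
  exact h1

theorem IsTri.diam_le_mul_dist {s : Finset Plane} (h : IsTri s) {κ : ℝ} (hκ : 0 < κ)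
    (hr : ShapeReg κ s) {y z : Plane} (hy : y ∈ s) (hz : z ∈ s) (hyz : y ≠ z) :
    Metric.diam (tri s) ≤ κ * dist y z := by
  have h1 : baryCoord s y y - baryCoord s y z = 1 := by
    rw [h.baryCoord_self hy, h.baryCoord_of_ne hz hyz.symm, sub_zero]
  rw [affine_sub] at h1
  have h2 := real_inner_le_norm (affGrad (baryCoord s y)) (y - z)
  rw [h1, ← dist_eq_norm] at h2
  have h3 := h2.trans (mul_le_mul_of_nonneg_right (h.norm_affGrad_baryCoord_le hκ hr hy)
    dist_nonneg)
  rw [div_mul_eq_mul_div, le_div_iff₀ h.diam_pos] at h3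
  linarith

theorem volume_closedBall_plane (x : Plane) {r : ℝ} (hr : 0 ≤ r) :
    (volume (Metric.closedBall x r)).toReal = Real.pi * r ^ 2 := by
  rw [EuclideanSpace.volume_closedBall_fin_two]
  rw [ENNReal.toReal_mul, ENNReal.toReal_pow, ENNReal.toReal_ofReal hr, mul_comm,
    ENNReal.toReal_ofReal Real.pi_pos.le]

theorem IsTri.volume_le {s : Finset Plane} (h : IsTri s) :
    (volume (tri s)).toReal ≤ (2 * Metric.diam (tri s)) ^ 2 := by
  obtain ⟨z, hz⟩ : s.Nonempty := Finset.card_pos.1 (by rw [h.card]; norm_num)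
  have h1 : tri s ⊆ Metric.closedBall z (Metric.diam (tri s)) := fun x hx =>
    dist_le_diam_tri hx (vertex_mem_tri hz)
  have h2 := ENNReal.toReal_mono (measure_closedBall_lt_top).ne (measure_mono (μ := volume) h1)
  rw [volume_closedBall_plane z h.diam_pos.le] at h2
  refine h2.trans ?_
  nlinarith [Real.pi_le_four, sq_nonneg (Metric.diam (tri s))]

theorem IsTri.le_volume {s : Finset Plane} (h : IsTri s) {κ : ℝ} (hκ : 0 < κ)
    (hr : ShapeReg κ s) :
    Real.pi * (Metric.diam (tri s) / κ) ^ 2 ≤ (volume (tri s)).toReal := by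
  obtain ⟨c, hc⟩ := hr
  rw [← volume_closedBall_plane c (div_nonneg h.diam_pos.le hκ.le)]
  exact ENNReal.toReal_mono (isCompact_tri s).measure_ne_top (measure_mono hc)

theorem IsTri.ball_subset_interior {s : Finset Plane} {c : Plane} {r : ℝ}
    (hc : Metric.closedBall c r ⊆ tri s) : Metric.ball c r ⊆ interior (tri s) :=
  interior_maximal (Metric.ball_subset_closedBall.trans hc) Metric.isOpen_ball

/-! ### Conforming meshes -/

variable {Ω : Set Plane}

theorem Mesh.mem_of_vertex_mem_tri (T : Mesh Ω) {s t : Finset Plane} (hs : s ∈ T.elems)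
    (ht : t ∈ T.elems) {z x : Plane} (hz : z ∈ s) (hx : x ∈ tri s) (hxt : x ∈ tri t)
    (hpos : 0 < baryCoord s z x) : z ∈ t := by
  by_contra hzt
  have h1 := T.conforming s hs t ht ⟨hx, hxt⟩
  have h2 : convexHull ℝ ((s : Set Plane) ∩ (t : Set Plane)) ⊆ {x | baryCoord s z x ≤ 0} := by
    refine convexHull_min (fun y hy => ?_) ?_
    · refine le_of_eq ((T.isTri hs).baryCoord_of_ne hy.1 ?_)
      rintro rfl
      exact hzt hy.2
    · intro a ha b hb p q hp hq hpq
      have := Convex.combo_affine_apply (f := baryCoord s z) (x := a) (y := b) hpq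
      simp only [mem_ofPred_eq] at ha hb ⊢
      rw [this]
      simp only [smul_eq_mul]
      nlinarith
  exact absurd (h2 h1) (not_le.2 hpos)

theorem Mesh.eq_of_mem_interior (T : Mesh Ω) {s t : Finset Plane} (hs : s ∈ T.elems)
    (ht : t ∈ T.elems) {x : Plane} (hx : x ∈ interior (tri s)) (hxt : x ∈ tri t) : s = t := by
  have hsub : s ⊆ t := fun z hz =>
    T.mem_of_vertex_mem_tri hs ht hz (interior_subset hx) hxt
      ((T.isTri hs).mem_interior_iff.1 hx z hz)
  exact Finset.eq_of_subset_of_card_le hsub (by rw [T.card_eq s hs, T.card_eq t ht])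

theorem Mesh.vertex_mem (T : Mesh Ω) {s t : Finset Plane} (hs : s ∈ T.elems)
    (ht : t ∈ T.elems) {z : Plane} (hz : z ∈ s) (hzt : z ∈ tri t) : z ∈ t :=
  T.mem_of_vertex_mem_tri hs ht hz (vertex_mem_tri hz) hzt
    (by rw [(T.isTri hs).baryCoord_self hz]; norm_num)

theorem Mesh.tri_subset_closure (T : Mesh Ω) {s : Finset Plane} (hs : s ∈ T.elems) :
    tri s ⊆ closure Ω := by
  rw [← T.cover]
  exact subset_biUnion_of_mem (u := fun s => tri s) hs

theorem Mesh.nodalBasis_eq (T : Mesh Ω) {s : Finset Plane} (hs : s ∈ T.elems) {x : Plane}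
    (hx : x ∈ interior (tri s)) (z : Plane) : T.nodalBasis z x = baryCoord s z x := by
  have hex : ∃ s ∈ T.elems, x ∈ tri s := ⟨s, hs, interior_subset hx⟩
  rw [Mesh.nodalBasis, dif_pos hex]
  rw [← T.eq_of_mem_interior hs hex.choose_spec.1 hx hex.choose_spec.2]

theorem Mesh.subset_vertices (T : Mesh Ω) {s : Finset Plane} (hs : s ∈ T.elems) :
    s ⊆ T.vertices := by
  intro z hz
  rw [Mesh.vertices, Finset.mem_biUnion]
  exact ⟨s, hs, hz⟩

theorem Mesh.recoveredFlux_eq (T : Mesh Ω) (wt : Plane → Finset Plane → ℝ) (ε v : Plane → ℝ)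
    {s : Finset Plane} (hs : s ∈ T.elems) {x : Plane} (hx : x ∈ interior (tri s)) :
    T.recoveredFlux wt ε v x = ∑ z ∈ s, baryCoord s z x • T.nodalFlux wt ε v z := by
  rw [Mesh.recoveredFlux]
  rw [← Finset.sum_subset (T.subset_vertices hs)]
  · exact Finset.sum_congr rfl fun z _ => by rw [T.nodalBasis_eq hs hx]
  · intro z _ hz
    rw [T.nodalBasis_eq hs hx, (T.isTri hs).baryCoord_of_notMem hz, zero_smul]

theorem Mesh.divergence_recoveredFlux (T : Mesh Ω) (wt : Plane → Finset Plane → ℝ)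
    (ε v : Plane → ℝ) {s : Finset Plane} (hs : s ∈ T.elems) {x : Plane}
    (hx : x ∈ interior (tri s)) :
    divergence (T.recoveredFlux wt ε v) x =
      ∑ z ∈ s, inner ℝ (affGrad (baryCoord s z)) (T.nodalFlux wt ε v z) := by
  set F := T.nodalFlux wt ε v
  have h1 : T.recoveredFlux wt ε v =ᶠ[nhds x] fun x => ∑ z ∈ s, baryCoord s z x • F z := by
    filter_upwards [isOpen_interior.mem_nhds hx] with y hy
    exact T.recoveredFlux_eq wt ε v hs hy
  have h2 : HasFDerivAt (fun x => ∑ z ∈ s, baryCoord s z x • F z)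
      (∑ z ∈ s, (innerSL ℝ (affGrad (baryCoord s z))).smulRight (F z)) x := by
    refine HasFDerivAt.fun_sum fun z _ => ?_
    have h3 : HasFDerivAt (fun x => baryCoord s z x) (innerSL ℝ (affGrad (baryCoord s z))) x := by
      have := ((innerSL ℝ (affGrad (baryCoord s z))).hasFDerivAt (x := x)).add_const
        (baryCoord s z 0)
      refine this.congr_of_eventuallyEq (Filter.Eventually.of_forall fun y => ?_)
      exact affine_eq _ y
    exact h3.smul_const (F z)
  rw [divergence, (h2.congr_of_eventuallyEq h1).fderiv]
  simp only [_root_.sum_apply, ContinuousLinearMap.smulRight_apply,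
    innerSL_apply_apply, WithLp.ofLp_sum, WithLp.ofLp_smul, Finset.sum_apply, Pi.smul_apply,
    smul_eq_mul]
  rw [Finset.sum_comm]
  refine Finset.sum_congr rfl fun z _ => ?_
  simp [PiLp.inner_apply, Fin.sum_univ_two]
  ring

theorem IsTri.interior_nonempty {s : Finset Plane} (h : IsTri s) :
    (interior (tri s)).Nonempty := by
  have h1 := h.indep.affineSpan_eq_top_iff_card_eq_finrank_add_one.2 (by simp [h.card])
  rw [Subtype.range_coe_subtype] at h1
  exact interior_convexHull_nonempty_iff_affineSpan_eq_top.2 h1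

/-! ### Lipschitz domains -/

theorem IsLipschitzDomain.interior_closure_subset (hΩ : IsLipschitzDomain Ω) :
    interior (closure Ω) ⊆ Ω := by
  intro x hx
  by_contra hxΩ
  have hfr : x ∈ frontier Ω := ⟨interior_subset hx, by rwa [hΩ.isOpen.interior_eq]⟩
  obtain ⟨e, g, K, r, hg, hr, hball⟩ := hΩ.boundary x hfr
  have hle : e x 1 ≤ g (e x 0) := by
    by_contra h
    exact hxΩ ((hball x (Metric.mem_ball_self hr)).2 (not_le.1 h))
  have hcurve : Continuous fun s : ℝ => x - s • e.symm (EuclideanSpace.single 1 1) := by fun_prop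
  have hN : interior (closure Ω) ∩ Metric.ball x r ∈ nhds
      (x - (0 : ℝ) • e.symm (EuclideanSpace.single 1 1)) := by
    rw [zero_smul, sub_zero]
    exact (isOpen_interior.inter Metric.isOpen_ball).mem_nhds ⟨hx, Metric.mem_ball_self hr⟩
  obtain ⟨δ, hδ, hδs⟩ := Metric.mem_nhds_iff.1 (hcurve.continuousAt.preimage_mem_nhds hN)
  have hs : δ / 2 ∈ Metric.ball (0 : ℝ) δ := by
    rw [mem_ball_zero_iff, Real.norm_eq_abs, abs_of_pos (by positivity)]
    linarith
  set y := x - (δ / 2) • e.symm (EuclideanSpace.single 1 1) with hy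
  obtain ⟨hy1, hy2⟩ : y ∈ interior (closure Ω) ∩ Metric.ball x r := hδs hs
  have hey : e y = e x - (δ / 2) • EuclideanSpace.single 1 1 := by
    rw [hy, map_sub, map_smul, e.apply_symm_apply]
  have hlt : e y 1 < g (e y 0) := by
    have h0 : e y 0 = e x 0 := by rw [hey]; simp
    have h1 : e y 1 = e x 1 - δ / 2 := by rw [hey]; simp
    rw [h0, h1]
    linarith
  have hopen : IsOpen {w : Plane | e w 1 < g (e w 0)} := by
    have hgc := hg.continuous
    exact isOpen_lt (by fun_prop) (by fun_prop)
  obtain ⟨w, ⟨hw1, hw2⟩, hwΩ⟩ := mem_closure_iff.1 (interior_subset hy1) _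
    (hopen.inter Metric.isOpen_ball) ⟨hlt, hy2⟩
  exact lt_asymm ((hball w hw2).1 hwΩ) hw1

/-- Near each point of its closure, a Lipschitz domain stays connected if the point is removed. -/
theorem IsLipschitzDomain.exists_preconnected (hΩ : IsLipschitzDomain Ω) {z : Plane}
    (hz : z ∈ closure Ω) {r₀ : ℝ} (hr₀ : 0 < r₀) :
    ∃ Q V : Set Plane, IsPreconnected Q ∧ Q ⊆ Metric.ball z r₀ ∧ Q ⊆ Ω ∧ z ∉ Q ∧
      V ∈ nhds z ∧ (V ∩ Ω) \ {z} ⊆ Q := by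
  by_cases hzΩ : z ∈ Ω
  · obtain ⟨r₁, hr₁, hb⟩ := Metric.isOpen_iff.1 hΩ.isOpen z hzΩ
    set r := min r₀ r₁
    have hr : 0 < r := lt_min hr₀ hr₁
    refine ⟨Metric.ball z r \ {z}, Metric.ball z r, ?_, ?_, ?_, by simp, Metric.ball_mem_nhds z hr,
      sdiff_subset_sdiff_left inter_subset_left⟩
    · have h1 : IsPreconnected (Ioo (0 : ℝ) r ×ˢ Metric.sphere (0 : Plane) 1) := by
        refine isPreconnected_Ioo.prod (isPreconnected_sphere ?_ 0 1)
        rw [← Module.finrank_eq_rank]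
        simp
      have h2 : Metric.ball z r \ {z} =
          (fun p : ℝ × Plane => z + p.1 • p.2) '' (Ioo (0 : ℝ) r ×ˢ Metric.sphere (0 : Plane) 1) := by
        ext y
        constructor
        · rintro ⟨hy, hyz⟩
          have hn : 0 < ‖y - z‖ := norm_pos_iff.2 (sub_ne_zero.2 hyz)
          rw [Metric.mem_ball, dist_eq_norm] at hy
          refine ⟨(‖y - z‖, ‖y - z‖⁻¹ • (y - z)), ⟨⟨hn, hy⟩, ?_⟩, ?_⟩
          · rw [mem_sphere_zero_iff_norm, norm_smul, norm_inv, norm_norm, inv_mul_cancel₀ hn.ne']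
          · simp only
            rw [smul_smul, mul_inv_cancel₀ hn.ne', one_smul, add_sub_cancel]
        · rintro ⟨⟨s, w⟩, ⟨hs, hw⟩, rfl⟩
          simp only at hs hw ⊢
          rw [mem_sphere_zero_iff_norm] at hw
          have hsw : ‖s • w‖ = s := by
            rw [norm_smul, hw, mul_one, Real.norm_eq_abs, abs_of_pos hs.1]
          refine ⟨?_, ?_⟩
          · rw [Metric.mem_ball, dist_eq_norm, add_sub_cancel_left, hsw]
            exact hs.2
          · intro h
            have : s • w = 0 := by simpa using h
            rw [this, norm_zero] at hsw
            exact hs.1.ne hsw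
      rw [h2]
      exact h1.image _ (by fun_prop)
    · exact sdiff_subset.trans (Metric.ball_subset_ball (min_le_left _ _))
    · exact sdiff_subset.trans ((Metric.ball_subset_ball (min_le_right _ _)).trans hb)
  · have hfr : z ∈ frontier Ω := ⟨hz, by rwa [hΩ.isOpen.interior_eq]⟩
    obtain ⟨e, g, K, r₁, hg, hr₁, hball⟩ := hΩ.boundary z hfr
    have hgc := hg.continuous
    set r := min r₀ r₁
    have hr : 0 < r := lt_min hr₀ hr₁
    have hz1 : e z 1 ≤ g (e z 0) := by
      by_contra h
      exact hzΩ ((hball z (Metric.mem_ball_self hr₁)).2 (not_le.1 h))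
    have hz2 : g (e z 0) ≤ e z 1 := by
      by_contra h
      have hopen : IsOpen {w : Plane | e w 1 < g (e w 0)} :=
        isOpen_lt (by fun_prop) (by fun_prop)
      obtain ⟨w, ⟨hw1, hw2⟩, hwΩ⟩ := mem_closure_iff.1 hz _
        (hopen.inter Metric.isOpen_ball) ⟨not_le.1 h, Metric.mem_ball_self hr₁⟩
      exact lt_asymm ((hball w hw2).1 hwΩ) hw1
    have hgz : g (e z 0) = e z 1 := le_antisymm hz2 hz1
    set a := r / (4 * ((K : ℝ) + 1)) with ha_def
    have hK : (0 : ℝ) ≤ K := K.2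
    have ha : 0 < a := by positivity
    have haK : (K + 1) * a = r / 4 := by
      rw [ha_def]
      field_simp
    have hgl : ∀ u : ℝ, |u - e z 0| < a → |g u - e z 1| ≤ K * a := by
      intro u hu
      have := hg.dist_le_mul u (e z 0)
      rw [Real.dist_eq, Real.dist_eq, hgz] at this
      exact this.trans (mul_le_mul_of_nonneg_left hu.le hK)
    set Q : Set Plane := {y | |e y 0 - e z 0| < a ∧ g (e y 0) < e y 1 ∧ e y 1 < e z 1 + r / 2}
    have hQball : Q ⊆ Metric.ball z r := by
      rintro y ⟨h1, h2, h3⟩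
      have h4 := hgl _ h1
      rw [abs_le] at h4
      have h5 : |e y 1 - e z 1| ≤ r / 2 := by
        rw [abs_le]
        constructor <;> nlinarith
      rw [Metric.mem_ball, dist_eq_norm, ← e.norm_map, map_sub, EuclideanSpace.norm_eq]
      refine Real.sqrt_lt' hr |>.2 ?_
      rw [Fin.sum_univ_two]
      simp only [PiLp.sub_apply, Real.norm_eq_abs]
      have ha4 : a ≤ r / 4 := by nlinarith
      nlinarith [abs_nonneg (e y 0 - e z 0), abs_nonneg (e y 1 - e z 1)]
    refine ⟨Q, {y | |e y 0 - e z 0| < a} ∩ {y | e y 1 < e z 1 + r / 2} ∩ Metric.ball z r, ?_,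
      hQball.trans (Metric.ball_subset_ball (min_le_left _ _)), ?_, ?_, ?_, ?_⟩
    · have h1 : IsPreconnected (Ioo (e z 0 - a) (e z 0 + a) ×ˢ Ioo (0 : ℝ) 1) :=
        isPreconnected_Ioo.prod isPreconnected_Ioo
      have hden : ∀ u, |u - e z 0| < a → 0 < e z 1 + r / 2 - g u := by
        intro u hu
        have := hgl u hu
        rw [abs_le] at this
        nlinarith
      have h2 : Q = (fun p : ℝ × ℝ =>
          e.symm (p.1 • EuclideanSpace.single 0 1 +
            (g p.1 + p.2 * (e z 1 + r / 2 - g p.1)) • EuclideanSpace.single 1 1)) ''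
          (Ioo (e z 0 - a) (e z 0 + a) ×ˢ Ioo (0 : ℝ) 1) := by
        ext y
        constructor
        · rintro ⟨h1, h2, h3⟩
          have hd := hden _ h1
          rw [abs_lt] at h1
          refine ⟨(e y 0, (e y 1 - g (e y 0)) / (e z 1 + r / 2 - g (e y 0))), ⟨⟨?_, ?_⟩, ?_, ?_⟩, ?_⟩
          · simp only; linarith
          · simp only; linarith
          · exact div_pos (by linarith) hd
          · exact (div_lt_one hd).2 (by linarith)
          · simp only
            rw [div_mul_cancel₀ _ hd.ne', LinearIsometryEquiv.symm_apply_eq]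
            ext j
            fin_cases j <;> simp
        · rintro ⟨⟨u, t⟩, ⟨hu, ht⟩, rfl⟩
          simp only [mem_Ioo] at hu ht
          have hu' : |u - e z 0| < a := abs_lt.2 ⟨by linarith, by linarith⟩
          have hd := hden u hu'
          refine ⟨?_, ?_, ?_⟩
          · simpa using hu'
          · simp; nlinarith
          · simp; nlinarith
      rw [h2]
      exact h1.image _ (by fun_prop)
    · rintro y hy
      exact (hball y (Metric.ball_subset_ball (min_le_right _ _) (hQball hy))).2 hy.2.1
    · rintro ⟨-, h, -⟩
      exact absurd h (not_lt.2 hz1)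
    · refine Filter.inter_mem ?_ (Metric.ball_mem_nhds z hr)
      have o1 : IsOpen {y : Plane | |e y 0 - e z 0| < a} := isOpen_lt (by fun_prop) (by fun_prop)
      have o2 : IsOpen {y : Plane | e y 1 < e z 1 + r / 2} :=
        isOpen_lt (by fun_prop) (by fun_prop)
      exact (o1.inter o2).mem_nhds ⟨by simpa using ha, by simpa using hr⟩
    · rintro y ⟨⟨⟨⟨h1, h2⟩, h3⟩, h4⟩, -⟩
      exact ⟨h1, (hball y (Metric.ball_subset_ball (min_le_right _ _) h3)).1 h4, h2⟩

theorem Mesh.interior_subset (T : Mesh Ω) (hΩ : IsLipschitzDomain Ω) {s : Finset Plane}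
    (hs : s ∈ T.elems) : interior (tri s) ⊆ Ω :=
  (interior_mono (T.tri_subset_closure hs)).trans hΩ.interior_closure_subset

theorem Mesh.closure_ae_eq (T : Mesh Ω) (hΩ : IsLipschitzDomain Ω) :
    (closure Ω : Set Plane) =ᵐ[volume] Ω := by
  refine Filter.EventuallyEq.symm (ae_eq_of_subset_of_measure_ge subset_closure ?_
    hΩ.isOpen.measurableSet.nullMeasurableSet (hΩ.isBounded.closure.measure_lt_top).ne)
  have h1 : closure Ω ⊆ Ω ∪ ⋃ s ∈ T.elems, frontier (tri s) := by
    intro x hx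
    rw [← T.cover] at hx
    simp only [mem_iUnion, exists_prop] at hx
    obtain ⟨s, hs, hxs⟩ := hx
    by_cases hi : x ∈ interior (tri s)
    · exact Or.inl (T.interior_subset hΩ hs hi)
    · refine Or.inr ?_
      simp only [mem_iUnion, exists_prop]
      exact ⟨s, hs, subset_closure hxs, hi⟩
  refine (measure_mono h1).trans ((measure_union_le _ _).trans ?_)
  have h2 : volume (⋃ s ∈ T.elems, frontier (tri s)) = 0 :=
    (measure_biUnion_null_iff T.elems.countable_toSet).2 fun s _ => volume_frontier_tri s
  rw [h2, add_zero]

/-! ### The star of a vertex -/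

open Classical in
/-- The elements with vertex `z`. -/
def Mesh.star (T : Mesh Ω) (z : Plane) : Finset (Finset Plane) :=
  T.elems.filter fun s => z ∈ s

theorem Mesh.mem_star (T : Mesh Ω) {z : Plane} {s : Finset Plane} :
    s ∈ T.star z ↔ s ∈ T.elems ∧ z ∈ s := by
  simp [Mesh.star]

/-- Two elements with vertex `z` are adjacent if they share an edge that ends in `z`. -/
def Mesh.starGraph (T : Mesh Ω) (z : Plane) : SimpleGraph (T.star z) where
  Adj s t := s ≠ t ∧ ∃ y, y ≠ z ∧ y ∈ s.1 ∧ y ∈ t.1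
  symm := ⟨fun _ _ h => ⟨h.1.symm, h.2.imp fun _ hy => ⟨hy.1, hy.2.2, hy.2.1⟩⟩⟩
  loopless := ⟨fun _ h => h.1 rfl⟩

theorem Mesh.starGraph_preconnected (T : Mesh Ω) (hΩ : IsLipschitzDomain Ω) (z : Plane) :
    (T.starGraph z).Preconnected := by
  intro s t
  by_contra hst
  have hs := T.mem_star.1 s.2
  have hzc : z ∈ closure Ω := T.tri_subset_closure hs.1 (vertex_mem_tri hs.2)
  obtain ⟨r₀, hr₀, hfar⟩ : ∃ r₀ > 0, ∀ u ∈ T.elems, z ∉ u → ∀ x ∈ Metric.ball z r₀, x ∉ tri u := by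
    have hcl : IsClosed (⋃ u ∈ {u ∈ (T.elems : Set (Finset Plane)) | z ∉ u}, tri u) :=
      (T.elems.finite_toSet.subset (sep_subset _ _)).isClosed_biUnion fun u _ =>
        (isCompact_tri u).isClosed
    have hzn : z ∉ ⋃ u ∈ {u ∈ (T.elems : Set (Finset Plane)) | z ∉ u}, tri u := by
      simp only [mem_iUnion, exists_prop, not_exists, not_and]
      intro u hu hzu
      exact hu.2 (T.vertex_mem hs.1 hu.1 hs.2 hzu)
    obtain ⟨r₀, hr₀, hsub⟩ := Metric.isOpen_iff.1 hcl.isOpen_compl z hzn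
    refine ⟨r₀, hr₀, fun u hu hzu x hx hxu => hsub hx ?_⟩
    simp only [mem_iUnion, exists_prop]
    exact ⟨u, ⟨hu, hzu⟩, hxu⟩
  obtain ⟨Q, V, hQ, hQb, hQΩ, hzQ, hV, hVQ⟩ := hΩ.exists_preconnected hzc hr₀
  have hmeet : ∀ u : T.star z, (Q ∩ tri u.1).Nonempty := by
    intro u
    have hu := T.mem_star.1 u.2
    have htri := T.isTri hu.1
    have hne : (interior (tri u.1)).Nonempty := htri.interior_nonempty
    have hzcl : z ∈ closure (interior (tri u.1)) := by
      rw [(convex_tri u.1).closure_interior_eq_closure_of_nonempty_interior hne]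
      exact subset_closure (vertex_mem_tri hu.2)
    obtain ⟨x, hxV, hxi⟩ := mem_closure_iff_nhds.1 hzcl V hV
    have hxz : x ≠ z := by
      rintro rfl
      obtain ⟨y, hy, hyx⟩ := Finset.exists_mem_ne (by rw [htri.card]; norm_num) x
      have := htri.mem_interior_iff.1 hxi y hy
      rw [htri.baryCoord_of_ne hu.2 hyx.symm] at this
      exact lt_irrefl _ this
    exact ⟨x, hVQ ⟨⟨hxV, T.interior_subset hΩ hu.1 hxi⟩, hxz⟩, _root_.interior_subset hxi⟩
  set A : Set Plane := ⋃ u ∈ {u : T.star z | (T.starGraph z).Reachable s u}, tri u.1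
  set A' : Set Plane := ⋃ u ∈ {u : T.star z | ¬ (T.starGraph z).Reachable s u}, tri u.1
  have hA : IsClosed A := (toFinite _).isClosed_biUnion fun u _ => (isCompact_tri u.1).isClosed
  have hA' : IsClosed A' := (toFinite _).isClosed_biUnion fun u _ => (isCompact_tri u.1).isClosed
  have hcov : Q ⊆ A ∪ A' := by
    intro x hx
    have h1 : x ∈ closure Ω := subset_closure (hQΩ hx)
    rw [← T.cover] at h1
    simp only [mem_iUnion, exists_prop] at h1
    obtain ⟨u, hu, hxu⟩ := h1
    have hzu : z ∈ u := by
      by_contra hzu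
      exact hfar u hu hzu x (hQb hx) hxu
    set u' : T.star z := ⟨u, T.mem_star.2 ⟨hu, hzu⟩⟩
    by_cases h : (T.starGraph z).Reachable s u'
    · exact Or.inl (mem_biUnion (x := u') h hxu)
    · exact Or.inr (mem_biUnion (x := u') h hxu)
  have hQA : (Q ∩ A).Nonempty := by
    obtain ⟨x, hx, hxs⟩ := hmeet s
    exact ⟨x, hx, mem_biUnion (x := s) (SimpleGraph.Reachable.refl s) hxs⟩
  have hQA' : (Q ∩ A').Nonempty := by
    obtain ⟨x, hx, hxt⟩ := hmeet t
    exact ⟨x, hx, mem_biUnion (x := t) hst hxt⟩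
  obtain ⟨x, hxQ, hxA, hxA'⟩ := isPreconnected_closed_iff.1 hQ A A' hA hA' hcov hQA hQA'
  simp only [A, A', mem_iUnion, exists_prop] at hxA hxA'
  obtain ⟨u, hu, hxu⟩ := hxA
  obtain ⟨u', hu', hxu'⟩ := hxA'
  have hne : u ≠ u' := by
    rintro rfl
    exact hu' hu
  have hx := T.conforming u.1 (T.mem_star.1 u.2).1 u'.1 (T.mem_star.1 u'.2).1 ⟨hxu, hxu'⟩
  have hsub : ((u.1 : Set Plane) ∩ (u'.1 : Set Plane)) ⊆ {z} := by
    rintro y ⟨hy, hy'⟩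
    by_contra hyz
    exact hu' (SimpleGraph.Reachable.trans hu
      (SimpleGraph.Adj.reachable (G := T.starGraph z) ⟨hne, y, hyz, hy, hy'⟩))
  have := convexHull_mono hsub hx
  rw [convexHull_singleton, mem_singleton_iff] at this
  exact hzQ (this ▸ hxQ)

theorem Mesh.card_star_le (T : Mesh Ω) {κ : ℝ} (hκ : 0 < κ) (hr : T.ShapeRegular κ) (z : Plane) :
    ((T.star z).card : ℝ) ≤ κ ^ 2 := by
  rcases (T.star z).eq_empty_or_nonempty with h0 | hne
  · rw [h0]; simp; positivity
  obtain ⟨s₀, hs₀, hmin⟩ := (T.star z).exists_min_image (fun s => Metric.diam (tri s)) hne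
  set r := Metric.diam (tri s₀)
  have hr0 : 0 < r := (T.isTri (T.mem_star.1 hs₀).1).diam_pos
  have hc : ∀ s ∈ T.star z, ∃ c, Metric.closedBall c (r / κ) ⊆ tri s ∩ Metric.closedBall z r := by
    intro s hs
    have hs' := T.mem_star.1 hs
    obtain ⟨c, hc⟩ := hr s hs'.1
    have hd := (T.isTri hs'.1).diam_pos
    set h := Metric.diam (tri s)
    have hrh : r ≤ h := hmin s hs
    have hz := vertex_mem_tri hs'.2
    refine ⟨z + (r / h) • (c - z), fun x hx => ?_⟩
    set y := z + (h / r) • (x - z) with hy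
    have hxy : x = z + (r / h) • (y - z) := by
      rw [hy, add_sub_cancel_left, smul_smul, div_mul_div_cancel₀ hd.ne', div_self hr0.ne',
        one_smul, add_sub_cancel]
    have hyt : y ∈ tri s := by
      apply hc
      rw [Metric.mem_closedBall, dist_eq_norm] at hx ⊢
      have e1 : y - c = (h / r) • (x - (z + (r / h) • (c - z))) := by
        rw [hy, ← sub_sub, smul_sub (h / r) (x - z), smul_smul, div_mul_div_cancel₀ hr0.ne',
          div_self hd.ne', one_smul]
        abel
      rw [e1, norm_smul, Real.norm_eq_abs, abs_of_pos (by positivity)]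
      calc h / r * _ ≤ h / r * (r / κ) := by gcongr
        _ = h / κ := by field_simp
    constructor
    · have := (convex_tri s) hz hyt (sub_nonneg.2 ((div_le_one hd).2 hrh))
        (div_nonneg hr0.le hd.le) (by ring)
      convert this using 1
      rw [hxy]
      module
    · rw [Metric.mem_closedBall, dist_eq_norm, hxy, add_sub_cancel_left, norm_smul,
        Real.norm_eq_abs, abs_of_pos (by positivity), ← dist_eq_norm]
      calc r / h * dist y z ≤ r / h * h := by gcongr; exact dist_le_diam_tri hyt hz
        _ = r := by field_simp
  choose! c hc using hc
  have hdisj : ((T.star z : Finset (Finset Plane)) : Set (Finset Plane)).PairwiseDisjoint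
      fun s => Metric.ball (c s) (r / κ) := by
    intro s hs t ht hst
    refine Set.disjoint_left.2 fun x hxs hxt => hst ?_
    exact T.eq_of_mem_interior (T.mem_star.1 hs).1 (T.mem_star.1 ht).1
      (IsTri.ball_subset_interior ((hc s hs).trans inter_subset_left) hxs)
      ((hc t ht) (Metric.ball_subset_closedBall hxt)).1
  have hvol : volume (⋃ s ∈ T.star z, Metric.ball (c s) (r / κ)) ≤
      volume (Metric.closedBall z r) :=
    measure_mono (iUnion₂_subset fun s hs =>
      Metric.ball_subset_closedBall.trans ((hc s hs).trans inter_subset_right))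
  rw [measure_biUnion_finset hdisj fun s _ => Metric.isOpen_ball.measurableSet] at hvol
  have h1 := ENNReal.toReal_mono measure_closedBall_lt_top.ne hvol
  rw [volume_closedBall_plane z hr0.le, ENNReal.toReal_sum fun s _ => measure_ball_lt_top.ne] at h1
  have h2 : ∀ s, (volume (Metric.ball (c s) (r / κ))).toReal = Real.pi * (r / κ) ^ 2 := fun s => by
    rw [← volume_closedBall_plane (c s) (by positivity), Measure.addHaar_closedBall_eq_addHaar_ball]
  simp only [h2, Finset.sum_const, nsmul_eq_mul] at h1
  have h3 : ((T.star z).card : ℝ) * (Real.pi * r ^ 2) ≤ κ ^ 2 * (Real.pi * r ^ 2) := by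
    calc _ = κ ^ 2 * ((T.star z).card * (Real.pi * (r / κ) ^ 2)) := by field_simp
      _ ≤ _ := by gcongr
  exact le_of_mul_le_mul_right h3 (by positivity)

/-! ### Bump functions and the divergence theorem on a half plane -/

/-- Scaled smooth bump functions. -/
theorem exists_bump : ∃ C : ℝ, 0 < C ∧ ∀ (c : Plane) (r : ℝ), 0 < r → ∃ v : Plane → ℝ,
    ContDiff ℝ ∞ v ∧ tsupport v ⊆ Metric.closedBall c r ∧ (∀ x, v x ∈ Icc (0 : ℝ) 1) ∧
    (∀ x ∈ Metric.closedBall c (r / 2), v x = 1) ∧ ∀ x, ‖fderiv ℝ v x‖ ≤ C / r := by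
  obtain ⟨Φ, hin, hout⟩ : ∃ Φ : ContDiffBump (0 : Plane), Φ.rIn = 1 / 2 ∧ Φ.rOut = 1 :=
    ⟨⟨1 / 2, 1, by norm_num, by norm_num⟩, rfl, rfl⟩
  have hΦ1 : ContDiff ℝ 1 Φ := Φ.contDiff (n := 1)
  obtain ⟨C, hC⟩ := (Φ.hasCompactSupport.fderiv ℝ).exists_bound_of_continuous
    (hΦ1.continuous_fderiv one_ne_zero)
  refine ⟨max C 1, by positivity, fun c r hr => ⟨fun x => Φ (r⁻¹ • (x - c)), ?_, ?_, ?_, ?_, ?_⟩⟩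
  · exact (Φ.contDiff (n := ⊤)).comp ((contDiff_id.sub contDiff_const).const_smul r⁻¹)
  · refine closure_minimal (fun x hx => ?_) Metric.isClosed_closedBall
    have h1 : r⁻¹ • (x - c) ∈ Function.support Φ := hx
    rw [Φ.support_eq, mem_ball_zero_iff, norm_smul, norm_inv, Real.norm_eq_abs, abs_of_pos hr,
      inv_mul_lt_iff₀ hr, hout, mul_one] at h1
    rw [Metric.mem_closedBall, dist_eq_norm]
    exact h1.le
  · exact fun x => ⟨Φ.nonneg, Φ.le_one⟩
  · intro x hx
    refine Φ.one_of_mem_closedBall ?_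
    rw [Metric.mem_closedBall, dist_eq_norm] at hx
    rw [mem_closedBall_zero_iff, norm_smul, norm_inv, Real.norm_eq_abs, abs_of_pos hr,
      inv_mul_le_iff₀ hr, hin]
    linarith
  · intro x
    have h1 : HasFDerivAt Φ (fderiv ℝ Φ (r⁻¹ • (x - c))) (r⁻¹ • (x - c)) :=
      (hΦ1.differentiable one_ne_zero _).hasFDerivAt
    have h2 : HasFDerivAt (fun x : Plane => r⁻¹ • (x - c)) (r⁻¹ • ContinuousLinearMap.id ℝ Plane) x :=
      ((hasFDerivAt_id x).sub_const c).const_smul r⁻¹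
    have h3 : HasFDerivAt (fun x => Φ (r⁻¹ • (x - c))) _ x :=
      HasFDerivAt.comp (g := Φ) x h1 h2
    rw [h3.fderiv, ContinuousLinearMap.comp_smul, ContinuousLinearMap.comp_id, norm_smul, norm_inv,
      Real.norm_eq_abs, abs_of_pos hr, div_eq_inv_mul]
    exact mul_le_mul_of_nonneg_left ((hC _).trans (le_max_left _ _)) (by positivity)

theorem exists_eq_zero_of_lt_norm {u : Plane → ℝ} (hc : HasCompactSupport u) (m : Plane) :
    ∃ R : ℝ, ∀ x, R < ‖x - m‖ → u x = 0 := by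
  obtain ⟨R, hR⟩ := hc.isCompact.isBounded.subset_closedBall m
  refine ⟨R, fun x hx => image_eq_zero_of_notMem_tsupport fun h => ?_⟩
  have := hR h
  rw [Metric.mem_closedBall, dist_eq_norm] at this
  linarith

/-- Cartesian coordinates with origin `m` and axes `d`, `n`. -/
theorem exists_coordinates {d n : Plane} (hd : ‖d‖ = 1) (hn : ‖n‖ = 1) (hdn : inner ℝ d n = 0)
    (m : Plane) : ∃ Ψ : ℝ × ℝ ≃ᵐ Plane, MeasurePreserving Ψ ∧
      ∀ p, Ψ p = m + (p.1 • d + p.2 • n) := by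
  have hon : Orthonormal ℝ ![d, n] := by
    refine ⟨fun i => ?_, fun i j hij => ?_⟩
    · fin_cases i <;> simp [hd, hn]
    · fin_cases i <;> fin_cases j <;> simp_all [real_inner_comm]
  have hsp : ⊤ ≤ Submodule.span ℝ (range ![d, n]) := by
    rw [hon.linearIndependent.span_eq_top_of_card_eq_finrank (by simp)]
  set b := OrthonormalBasis.mk hon hsp
  refine ⟨MeasurableEquiv.finTwoArrow.symm.trans ((MeasurableEquiv.toLp 2 (Fin 2 → ℝ)).trans
    (b.repr.symm.toMeasurableEquiv.trans (MeasurableEquiv.addLeft m))), ?_, ?_⟩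
  · refine (measurePreserving_add_left volume m).comp (b.measurePreserving_repr_symm.comp
      ((PiLp.volume_preserving_toLp (Fin 2)).comp ?_))
    exact (volume_preserving_finTwoArrow ℝ).symm
  · intro p
    change m + b.repr.symm (WithLp.toLp 2 ![p.1, p.2]) = _
    rw [← b.sum_repr_symm]
    simp [b, Fin.sum_univ_two]

theorem integral_halfPlane {d n : Plane} (hd : ‖d‖ = 1) (hn : ‖n‖ = 1) (hdn : inner ℝ d n = 0)
    (m : Plane) {u : Plane → ℝ} (hu : ContDiff ℝ 1 u) (hc : HasCompactSupport u) (w : Plane) :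
    ∫ x in {x | 0 < inner ℝ n (x - m)}, fderiv ℝ u x w =
      - (inner ℝ n w * ∫ s : ℝ, u (m + s • d)) := by
  obtain ⟨Ψ, hΨ, hΨe⟩ := exists_coordinates hd hn hdn m
  obtain ⟨R, hR⟩ := exists_eq_zero_of_lt_norm hc m
  have hdd : inner ℝ d d = (1 : ℝ) := by rw [real_inner_self_eq_norm_sq, hd]; norm_num
  have hnn : inner ℝ n n = (1 : ℝ) := by rw [real_inner_self_eq_norm_sq, hn]; norm_num
  have hnd : inner ℝ n d = (0 : ℝ) := by rw [real_inner_comm]; exact hdn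
  have hpre : Ψ ⁻¹' {x | 0 < inner ℝ n (x - m)} = univ ×ˢ Ioi (0 : ℝ) := by
    ext p
    simp [hΨe, inner_add_right, inner_smul_right, hn, hnd]
  have hcd : ∀ w, Continuous fun x => fderiv ℝ u x w := fun w =>
    (hu.continuous_fderiv one_ne_zero).clm_apply continuous_const
  have hcc : ∀ w, HasCompactSupport fun x => fderiv ℝ u x w := fun w =>
    hc.mono' ((subset_tsupport _).trans (tsupport_fderiv_apply_subset u w))
  have hint : ∀ w, Integrable (fun p : ℝ × ℝ => fderiv ℝ u (Ψ p) w) := fun w =>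
    (hΨ.integrable_comp_emb Ψ.measurableEmbedding).2
      ((hcd w).integrable_of_hasCompactSupport (hcc w))
  have hchange : ∀ w, ∫ x in {x | 0 < inner ℝ n (x - m)}, fderiv ℝ u x w =
      ∫ p in univ ×ˢ Ioi (0 : ℝ), fderiv ℝ u (Ψ p) w := fun w => by
    rw [← hpre]
    exact (hΨ.setIntegral_preimage_emb Ψ.measurableEmbedding _ _).symm
  have hbig1 : ∀ s t : ℝ, R < |s| → u (m + (s • d + t • n)) = 0 := fun s t hs => by
    refine hR _ (hs.trans_le ?_)
    rw [add_sub_cancel_left]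
    have := abs_real_inner_le_norm d (s • d + t • n)
    rw [inner_add_right, inner_smul_right, inner_smul_right, hdd, hdn, hd] at this
    simpa using this
  have hbig2 : ∀ s t : ℝ, R < |t| → u (m + (s • d + t • n)) = 0 := fun s t hs => by
    refine hR _ (hs.trans_le ?_)
    rw [add_sub_cancel_left]
    have := abs_real_inner_le_norm n (s • d + t • n)
    rw [inner_add_right, inner_smul_right, inner_smul_right, hnn, hnd, hn] at this
    simpa using this
  have hder1 : ∀ s t : ℝ, HasDerivAt (fun s : ℝ => u (m + (s • d + t • n)))
      (fderiv ℝ u (m + (s • d + t • n)) d) s := fun s t => by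
    have h2 : HasDerivAt (fun s : ℝ => m + (s • d + t • n)) d s := by
      simpa using (((hasDerivAt_id s).smul_const d).add_const (t • n)).const_add m
    exact (hu.differentiable one_ne_zero _).hasFDerivAt.comp_hasDerivAt s h2
  have hder2 : ∀ s t : ℝ, HasDerivAt (fun t : ℝ => u (m + (s • d + t • n)))
      (fderiv ℝ u (m + (s • d + t • n)) n) t := fun s t => by
    have h2 : HasDerivAt (fun t : ℝ => m + (s • d + t • n)) n t := by
      simpa using (((hasDerivAt_id t).smul_const n).const_add (s • d)).const_add m
    exact (hu.differentiable one_ne_zero _).hasFDerivAt.comp_hasDerivAt t h2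
  have hcs1 : ∀ w, ∀ t : ℝ, HasCompactSupport fun s : ℝ => fderiv ℝ u (m + (s • d + t • n)) w := by
    intro w t
    refine HasCompactSupport.intro (isCompact_Icc (a := -R) (b := R)) fun s hs => ?_
    have hs' : R < |s| := by
      by_contra h
      exact hs (abs_le.1 (not_lt.1 h))
    have : fderiv ℝ u (m + (s • d + t • n)) = 0 := by
      refine (Filter.EventuallyEq.fderiv_eq (f := fun _ => (0 : ℝ)) ?_).trans (by simp)
      have hop : IsOpen {x : Plane | R < |inner ℝ d (x - m)|} :=
        isOpen_lt continuous_const (by fun_prop)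
      filter_upwards [hop.mem_nhds (show m + (s • d + t • n) ∈ {x : Plane | R < |inner ℝ d (x - m)|}
        by simp [inner_add_right, inner_smul_right, hd, hdn, hs'])] with x hx
      refine hR _ (lt_of_lt_of_le hx ?_)
      simpa [hd] using abs_real_inner_le_norm d (x - m)
    rw [this]; rfl
  have hcs2 : ∀ w, ∀ s : ℝ, HasCompactSupport fun t : ℝ => fderiv ℝ u (m + (s • d + t • n)) w := by
    intro w s
    refine HasCompactSupport.intro (isCompact_Icc (a := -R) (b := R)) fun t hs => ?_
    have hs' : R < |t| := by
      by_contra h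
      exact hs (abs_le.1 (not_lt.1 h))
    have : fderiv ℝ u (m + (s • d + t • n)) = 0 := by
      refine (Filter.EventuallyEq.fderiv_eq (f := fun _ => (0 : ℝ)) ?_).trans (by simp)
      have hop : IsOpen {x : Plane | R < |inner ℝ n (x - m)|} :=
        isOpen_lt continuous_const (by fun_prop)
      filter_upwards [hop.mem_nhds (show m + (s • d + t • n) ∈ {x : Plane | R < |inner ℝ n (x - m)|}
        by simp [inner_add_right, inner_smul_right, hn, hnd, hs'])] with x hx
      refine hR _ (lt_of_lt_of_le hx ?_)
      simpa [hn] using abs_real_inner_le_norm n (x - m)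
    rw [this]; rfl
  have htop : ∀ {F : ℝ → ℝ}, (∀ s, R < |s| → F s = 0) →
      Filter.Tendsto F Filter.atTop (nhds 0) := fun {F} hF => by
    refine tendsto_const_nhds.congr' ?_
    filter_upwards [Filter.eventually_gt_atTop R] with s hs
    exact (hF s (hs.trans_le (le_abs_self s))).symm
  have hbot : ∀ {F : ℝ → ℝ}, (∀ s, R < |s| → F s = 0) →
      Filter.Tendsto F Filter.atBot (nhds 0) := fun {F} hF => by
    refine tendsto_const_nhds.congr' ?_
    filter_upwards [Filter.eventually_lt_atBot (-R)] with s hs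
    exact (hF s ((lt_neg_of_lt_neg hs).trans_le (neg_le_abs s))).symm
  have hDd : ∫ x in {x | 0 < inner ℝ n (x - m)}, fderiv ℝ u x d = 0 := by
    rw [hchange, Measure.volume_eq_prod, ← Measure.prod_restrict, integral_prod_symm]
    · refine integral_eq_zero_of_ae (ae_of_all _ fun t => ?_)
      simp only [hΨe, Measure.restrict_univ]
      rw [integral_of_hasDerivAt_of_tendsto (fun s => hder1 s t)
        (((hcd d).comp (by fun_prop)).integrable_of_hasCompactSupport (hcs1 d t))
        (hbot fun s hs => hbig1 s t hs) (htop fun s hs => hbig1 s t hs)]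
      simp
    · rw [Measure.prod_restrict]
      exact (hint d).integrableOn
  have hDn : ∫ x in {x | 0 < inner ℝ n (x - m)}, fderiv ℝ u x n = -∫ s : ℝ, u (m + s • d) := by
    rw [hchange, Measure.volume_eq_prod, setIntegral_prod _ (hint n).integrableOn,
      Measure.restrict_univ, ← integral_neg]
    refine integral_congr_ae (ae_of_all _ fun s => ?_)
    simp only [hΨe]
    rw [integral_Ioi_of_hasDerivAt_of_tendsto' (fun t _ => hder2 s t)
        (((hcd n).comp (by fun_prop)).integrable_of_hasCompactSupport (hcs2 n s)).integrableOn
        (htop fun t ht => hbig2 s t ht)]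
    simp
  obtain ⟨⟨a, c⟩, hac⟩ := Ψ.surjective (m + w)
  rw [hΨe] at hac
  have hw : w = a • d + c • n := (add_left_cancel hac).symm
  have hlin : ∀ x, fderiv ℝ u x w = a * fderiv ℝ u x d + c * fderiv ℝ u x n := fun x => by
    conv_lhs => rw [hw]
    simp
  have hI : ∀ w, IntegrableOn (fun x => fderiv ℝ u x w) {x | 0 < inner ℝ n (x - m)} := fun w =>
    ((hcd w).integrable_of_hasCompactSupport (hcc w)).integrableOn
  simp only [hlin]
  rw [integral_add ((hI d).const_mul a) ((hI n).const_mul c), integral_const_mul,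
    integral_const_mul, hDd, hDn]
  have : inner ℝ n w = c := by
    rw [hw]; simp [inner_add_right, inner_smul_right, hn, hnd]
  rw [this]
  ring

/-! ### `L²` norms -/

section L2

variable {F : Type} [NormedAddCommGroup F] {D : Set Plane} {u v : Plane → F}

theorem l2Norm_nonneg (D : Set Plane) (u : Plane → F) : 0 ≤ l2Norm D u := ENNReal.toReal_nonneg

theorem l2Norm_mono {K : Set Plane} (hKD : K ⊆ D) (hu : MemLp u 2 (volume.restrict D)) :
    l2Norm K u ≤ l2Norm D u :=
  ENNReal.toReal_mono hu.2.ne (eLpNorm_mono_measure _ (Measure.restrict_mono hKD le_rfl))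

theorem l2Norm_congr (h : u =ᵐ[volume.restrict D] v) : l2Norm D u = l2Norm D v := by
  rw [l2Norm, l2Norm, eLpNorm_congr_ae h]

theorem l2Norm_add_le (hu : MemLp u 2 (volume.restrict D)) (hv : MemLp v 2 (volume.restrict D)) :
    l2Norm D (u + v) ≤ l2Norm D u + l2Norm D v := by
  rw [l2Norm, l2Norm, l2Norm, ← ENNReal.toReal_add hu.2.ne hv.2.ne]
  exact ENNReal.toReal_mono (ENNReal.add_ne_top.2 ⟨hu.2.ne, hv.2.ne⟩)
    (eLpNorm_add_le hu.1 hv.1 (by norm_num))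

theorem l2Norm_sq (D : Set Plane) (u : Plane → F) :
    l2Norm D u ^ 2 = (∫⁻ x in D, ‖u x‖ₑ ^ 2).toReal := by
  rw [l2Norm, eLpNorm_eq_lintegral_rpow_enorm_toReal (by norm_num) (by norm_num),
    ← ENNReal.toReal_pow]
  congr 1
  rw [← ENNReal.rpow_natCast, ← ENNReal.rpow_mul]
  simp

theorem toReal_rpow_half_le {D : Set Plane} {ℓ : ℝ} (hℓ : 0 ≤ ℓ)
    (hD : (volume D).toReal ≤ ℓ ^ 2) : ((volume D) ^ (1 / 2 : ℝ)).toReal ≤ ℓ := by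
  rw [← ENNReal.toReal_rpow, ← Real.sqrt_eq_rpow]
  exact Real.sqrt_le_iff.2 ⟨hℓ, hD⟩

theorem setIntegral_norm_le {ℓ : ℝ} (hℓ : 0 ≤ ℓ) (hDf : volume D ≠ ⊤)
    (hD : (volume D).toReal ≤ ℓ ^ 2) (hu : MemLp u 2 (volume.restrict D)) :
    ∫ x in D, ‖u x‖ ≤ ℓ * l2Norm D u := by
  have h1 : ∫ x in D, ‖u x‖ = (eLpNorm u 1 (volume.restrict D)).toReal := by
    rw [eLpNorm_one_eq_lintegral_enorm, integral_norm_eq_lintegral_enorm hu.1]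
  rw [h1]
  have h2 := eLpNorm_le_eLpNorm_mul_rpow_measure_univ (p := 1) (q := 2)
    (μ := volume.restrict D) (by norm_num) hu.1
  rw [Measure.restrict_apply_univ] at h2
  have h3 : (1 / (1 : ℝ≥0∞).toReal - 1 / (2 : ℝ≥0∞).toReal) = (1 / 2 : ℝ) := by norm_num
  rw [h3] at h2
  have h4 := ENNReal.toReal_mono (ENNReal.mul_ne_top hu.2.ne
    (ENNReal.rpow_ne_top_of_nonneg (by norm_num) hDf)) h2
  rw [ENNReal.toReal_mul] at h4
  refine h4.trans ?_
  rw [mul_comm]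
  exact mul_le_mul_of_nonneg_right (toReal_rpow_half_le hℓ hD) (l2Norm_nonneg D u)

theorem l2Norm_le_of_bound {ℓ c : ℝ} (hℓ : 0 ≤ ℓ) (hc : 0 ≤ c) (hDf : volume D ≠ ⊤)
    (hD : (volume D).toReal ≤ ℓ ^ 2) (hu : ∀ᵐ x ∂volume.restrict D, ‖u x‖ ≤ c) :
    l2Norm D u ≤ ℓ * c := by
  have h1 := eLpNorm_le_of_ae_bound (p := 2) hu
  rw [Measure.restrict_apply_univ] at h1
  have h2 := ENNReal.toReal_mono (ENNReal.mul_ne_top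
    (ENNReal.rpow_ne_top_of_nonneg (by simp) hDf) ENNReal.ofReal_ne_top) h1
  rw [ENNReal.toReal_mul, ENNReal.toReal_ofReal hc] at h2
  refine h2.trans (mul_le_mul_of_nonneg_right ?_ hc)
  have h3 : ((2 : ℝ≥0∞).toReal)⁻¹ = (1 / 2 : ℝ) := by norm_num
  rw [h3]
  exact toReal_rpow_half_le hℓ hD

theorem l2Norm_const_ge {ℓ : ℝ} (hD : ℓ ^ 2 ≤ (volume D).toReal) {a : F}
    (hu : ∀ᵐ x ∂volume.restrict D, u x = a) : ℓ * ‖a‖ ≤ l2Norm D u := by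
  refine le_of_sq_le_sq ?_ (l2Norm_nonneg D u)
  rw [l2Norm_sq, lintegral_congr_ae (g := fun _ => ‖a‖ₑ ^ 2)
    (by filter_upwards [hu] with x hx; rw [hx]), lintegral_const, Measure.restrict_apply_univ,
    ENNReal.toReal_mul, ENNReal.toReal_pow, toReal_enorm, mul_pow, mul_comm]
  exact mul_le_mul_of_nonneg_left hD (sq_nonneg _)

end L2

theorem restrict_interior_tri (s : Finset Plane) :
    (volume : Measure Plane).restrict (interior (tri s)) = volume.restrict (tri s) :=
  Measure.restrict_congr_set (interior_tri_ae_eq s)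

/-- The Poincaré inequality on an element. -/
theorem IsTri.exists_l2Norm_sub_const_le {Ω : Set Plane} (hΩ : IsOpen Ω) {s : Finset Plane}
    (h : IsTri s) {κ : ℝ} (hκ : 0 < κ) (hr : ShapeReg κ s) (hsΩ : interior (tri s) ⊆ Ω)
    {f : Plane → ℝ} (hf : MemH1 Ω f) :
    ∃ c : ℝ, l2Norm (tri s) (fun x => f x - c) ≤
      κ * Metric.diam (tri s) * l2Norm (tri s) (weakGrad Ω f) := by
  have hd := h.diam_pos
  have hfin : volume (interior (tri s)) ≠ ⊤ :=
    ((measure_mono interior_subset).trans_lt (isCompact_tri s).measure_lt_top).ne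
  have hne : volume (interior (tri s)) ≠ 0 :=
    (isOpen_interior.measure_pos volume h.interior_nonempty).ne'
  have : IsFiniteMeasure ((volume : Measure Plane).restrict (interior (tri s))) :=
    ⟨by rw [Measure.restrict_apply_univ]; exact hfin.lt_top⟩
  have hmem : ∀ {u : Plane → ℝ}, MemLp u 2 (volume.restrict Ω) →
      IntegrableOn u (interior (tri s)) := fun hu =>
    (hu.mono_measure (Measure.restrict_mono hsΩ le_rfl)).integrable (by norm_num)
  obtain ⟨c, hc⟩ := exists_lintegral_sub_const_sq_le isOpen_interior (convex_tri s).interior hne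
    hfin (d := Metric.diam (tri s)) (fun x hx y hy => by
      rw [← dist_eq_norm]
      exact dist_le_diam_tri (interior_subset hx) (interior_subset hy))
    (hmem hf.1) (fun i => hmem (hf.memLp_weakPartial hΩ i))
    (fun i => (hf.hasWeakPartial i).restrict hsΩ)
  refine ⟨c, ?_⟩
  have hG : MemLp (weakGrad Ω f) 2 (volume.restrict (tri s)) := by
    rw [← restrict_interior_tri]
    exact (hf.memLp_weakGrad hΩ).mono_measure (Measure.restrict_mono hsΩ le_rfl)
  have hsum : ∑ i, ∫⁻ x in interior (tri s), ‖weakPartial Ω i f x‖ₑ ^ 2 =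
      ∫⁻ x in tri s, ‖weakGrad Ω f x‖ₑ ^ 2 := by
    rw [← restrict_interior_tri, ← lintegral_finsetSum']
    · refine lintegral_congr fun x => ?_
      have e : ∀ {E : Type} [NormedAddCommGroup E] (r : E),
          ‖r‖ₑ ^ 2 = ENNReal.ofReal (‖r‖ ^ 2) := fun r => by
        rw [← ofReal_norm, ENNReal.ofReal_pow (norm_nonneg _)]
      simp only [e]
      rw [← ENNReal.ofReal_sum_of_nonneg fun i _ => sq_nonneg _, EuclideanSpace.norm_sq_eq]
      rfl
    · intro i _
      exact (hmem (hf.memLp_weakPartial hΩ i)).1.enorm.pow_const 2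
  rw [hsum, restrict_interior_tri, measure_congr (interior_tri_ae_eq s)] at hc
  have hS : ∫⁻ x in tri s, ‖weakGrad Ω f x‖ₑ ^ 2 ≠ ⊤ := by
    have := hG.2.ne
    rw [eLpNorm_eq_lintegral_rpow_enorm_toReal (by norm_num) (by norm_num)] at this
    intro htop
    apply this
    simp only [ENNReal.toReal_ofNat, ENNReal.rpow_ofNat]
    rw [htop]
    simp
  have hne' : volume (tri s) ≠ 0 := by rwa [← measure_congr (interior_tri_ae_eq s)]
  refine le_of_sq_le_sq ?_ (by
    have := l2Norm_nonneg (tri s) (weakGrad Ω f)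
    positivity)
  rw [l2Norm_sq, mul_pow, l2Norm_sq (tri s) (weakGrad Ω f)]
  have h2 := ENNReal.toReal_mono (ENNReal.mul_ne_top (ENNReal.inv_ne_top.2 hne')
    (ENNReal.mul_ne_top measure_closedBall_lt_top.ne
      (ENNReal.mul_ne_top (ENNReal.pow_ne_top ENNReal.ofReal_ne_top) hS))) hc
  refine h2.trans ?_
  rw [ENNReal.toReal_mul, ENNReal.toReal_mul, ENNReal.toReal_mul, ENNReal.toReal_inv,
    ENNReal.toReal_pow, ENNReal.toReal_ofReal hd.le, volume_closedBall_plane _ hd.le, ← mul_assoc,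
    ← mul_assoc]
  refine mul_le_mul_of_nonneg_right ?_ ENNReal.toReal_nonneg
  have h3 := h.le_volume hκ hr
  have h4 : 0 < (volume (tri s)).toReal :=
    ENNReal.toReal_pos hne' (isCompact_tri s).measure_ne_top
  rw [mul_assoc, inv_mul_le_iff₀ h4, mul_pow, ← mul_assoc]
  refine mul_le_mul_of_nonneg_right ?_ (sq_nonneg _)
  calc Real.pi * Metric.diam (tri s) ^ 2 = Real.pi * (Metric.diam (tri s) / κ) ^ 2 * κ ^ 2 := by
        field_simp
    _ ≤ _ := by gcongr

/-! ### Interpolation of `W^{2,∞}` functions -/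

theorem supNorm_nonneg (U : Set Plane) (u : Plane → ℝ) : 0 ≤ supNorm U u := ENNReal.toReal_nonneg

theorem ae_abs_le_supNorm {U : Set Plane} {u : Plane → ℝ} (hu : MemLp u ⊤ (volume.restrict U)) :
    ∀ᵐ x ∂volume.restrict U, |u x| ≤ supNorm U u := by
  filter_upwards [ae_le_eLpNormEssSup (f := u) (μ := volume.restrict U)] with x hx
  rw [supNorm, eLpNorm_exponent_top, ← Real.norm_eq_abs, ← toReal_enorm]
  refine ENNReal.toReal_mono ?_ hx
  have := hu.2.ne
  rwa [eLpNorm_exponent_top] at this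

theorem fderiv_fderiv_comm {ψ : Plane → ℝ} (hψ : ContDiff ℝ ∞ ψ) (x a b : Plane) :
    fderiv ℝ (fun y => fderiv ℝ ψ y a) x b = fderiv ℝ (fun y => fderiv ℝ ψ y b) x a := by
  have hd : DifferentiableAt ℝ (fderiv ℝ ψ) x :=
    ((hψ.fderiv_right (m := 1) (by norm_cast)).differentiable one_ne_zero) x
  have e : ∀ a b, fderiv ℝ (fun y => fderiv ℝ ψ y a) x b = fderiv ℝ (fderiv ℝ ψ) x b a := by
    intro a b
    rw [fderiv_clm_apply hd (differentiableAt_const a)]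
    simp
  rw [e, e]
  exact (hψ.contDiffAt.isSymmSndFDerivAt (by simp; norm_cast)) b a

theorem weakPartial_comm {U : Set Plane} (hU : IsOpen U) {i j : Fin 2}
    {u vi vj wij wji : Plane → ℝ} (hi : HasWeakPartial U i u vi) (hj : HasWeakPartial U j u vj)
    (hij : HasWeakPartial U j vi wij) (hji : HasWeakPartial U i vj wji) :
    wij =ᵐ[volume.restrict U] wji := by
  refine ae_restrict_eq_of_integral_mul_eq hU hij.2.1 hji.2.1 fun ψ hψ => ?_
  have h1 := hij.2.2 ψ hψ
  have h2 := hji.2.2 ψ hψ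
  have h3 := hi.2.2 _ (hψ.fderiv_apply (EuclideanSpace.single j 1))
  have h4 := hj.2.2 _ (hψ.fderiv_apply (EuclideanSpace.single i 1))
  simp only [fderiv_fderiv_comm hψ.1 _ (EuclideanSpace.single j 1) (EuclideanSpace.single i 1)]
    at h3
  rw [h3, h1, h2] at h4
  linarith

theorem w2InftyNorm_eq (U : Set Plane) (u : Plane → ℝ) :
    w2InftyNorm U u = supNorm U u + (supNorm U (weakPartial U 0 u) +
      supNorm U (weakPartial U 1 u)) +
      (supNorm U (weakPartial U 0 (weakPartial U 0 u)) +
        supNorm U (weakPartial U 1 (weakPartial U 0 u)) +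
        supNorm U (weakPartial U 1 (weakPartial U 1 u))) := by
  have e0 : (Finset.Ici (0 : Fin 2)) = {0, 1} := by decide
  have e1 : (Finset.Ici (1 : Fin 2)) = {1} := by decide
  rw [w2InftyNorm, Fin.sum_univ_two, Fin.sum_univ_two, e0, e1]
  simp

theorem w2InftyNorm_nonneg (U : Set Plane) (u : Plane → ℝ) : 0 ≤ w2InftyNorm U u := by
  rw [w2InftyNorm_eq]
  have := fun u => supNorm_nonneg U u
  exact add_nonneg (add_nonneg (this _) (add_nonneg (this _) (this _)))
    (add_nonneg (add_nonneg (this _) (this _)) (this _))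

/-- The interpolation error on a triangle. -/
theorem IsTri.abs_sub_vertexInterp_le {U : Set Plane} (hU : IsOpen U) {s : Finset Plane}
    (h : IsTri s) (hsU : interior (tri s) ⊆ U) {u : Plane → ℝ} (hu : MemW2Infty U u)
    (hc : ContinuousOn u (tri s)) {x : Plane} (hx : x ∈ tri s) :
    |u x - vertexInterp s u x| ≤ w2InftyNorm U u * Metric.diam (tri s) ^ 2 := by
  set M := w2InftyNorm U u with hMdef
  have hM0 : 0 ≤ M := w2InftyNorm_nonneg U u
  set K := interior (tri s)
  set v : Fin 2 → Plane → ℝ := fun i => weakPartial U i u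
  set w : Fin 2 → Fin 2 → Plane → ℝ := fun i j => weakPartial U j (v i)
  have hv : ∀ i, HasWeakPartial U i u (v i) := fun i => by
    obtain ⟨v', hv', -⟩ := hu.2 i
    exact hv'.weakPartial
  have hvm : ∀ i, MemLp (v i) ⊤ (volume.restrict U) := fun i => by
    obtain ⟨v', hv', hm, -⟩ := hu.2 i
    exact (memLp_congr_ae (hv'.weakPartial_ae_eq hU)).2 hm
  have hwex : ∀ i j, ∃ w', HasWeakPartial U j (v i) w' ∧ MemLp w' ⊤ (volume.restrict U) :=
    fun i j => by
      obtain ⟨v', hv', -, hw⟩ := hu.2 i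
      obtain ⟨w', hw', hm⟩ := hw j
      exact ⟨w', hw'.congr_ae (hv'.weakPartial_ae_eq hU).symm Filter.EventuallyEq.rfl, hm⟩
  have hw : ∀ i j, HasWeakPartial U j (v i) (w i j) := fun i j => by
    obtain ⟨w', hw', -⟩ := hwex i j
    exact hw'.weakPartial
  have hwm : ∀ i j, MemLp (w i j) ⊤ (volume.restrict U) := fun i j => by
    obtain ⟨w', hw', hm⟩ := hwex i j
    exact (memLp_congr_ae (hw'.weakPartial_ae_eq hU)).2 hm
  set B : Fin 2 → Fin 2 → ℝ := ![![supNorm U (w 0 0), supNorm U (w 0 1)],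
    ![supNorm U (w 0 1), supNorm U (w 1 1)]]
  have hB : ∀ i j, ∀ᵐ y ∂volume.restrict U, |w i j y| ≤ B i j := by
    intro i j
    fin_cases i <;> fin_cases j
    · exact ae_abs_le_supNorm (hwm 0 0)
    · exact ae_abs_le_supNorm (hwm 0 1)
    · filter_upwards [ae_abs_le_supNorm (hwm 0 1),
        weakPartial_comm hU (hv 0) (hv 1) (hw 0 1) (hw 1 0)] with y h1 h2
      change |w 1 0 y| ≤ supNorm U (w 0 1)
      rwa [← h2]
    · exact ae_abs_le_supNorm (hwm 1 1)
  have hMB : ∀ h : Plane, ∑ i, |h i| * ∑ j, |h j| * B i j ≤ M * ‖h‖ ^ 2 := by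
    intro h
    rw [EuclideanSpace.real_norm_sq_eq]
    simp only [Fin.sum_univ_two]
    change |h 0| * (|h 0| * supNorm U (w 0 0) + |h 1| * supNorm U (w 0 1)) +
      |h 1| * (|h 0| * supNorm U (w 0 1) + |h 1| * supNorm U (w 1 1)) ≤ _
    have hM' : supNorm U (w 0 0) + supNorm U (w 0 1) + supNorm U (w 1 1) ≤ M := by
      rw [hMdef, w2InftyNorm_eq]
      have n1 := supNorm_nonneg U u
      have n2 := supNorm_nonneg U (weakPartial U 0 u)
      have n3 := supNorm_nonneg U (weakPartial U 1 u)
      simp only [w, v]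
      linarith
    have n1 := supNorm_nonneg U (w 0 0)
    have n2 := supNorm_nonneg U (w 0 1)
    have n3 := supNorm_nonneg U (w 1 1)
    rw [← sq_abs (h 0), ← sq_abs (h 1)]
    refine le_trans ?_ (mul_le_mul_of_nonneg_right hM' (by positivity))
    nlinarith [mul_nonneg n2 (sq_nonneg (|h 0| - |h 1|)), mul_nonneg n1 (sq_nonneg |h 1|),
      mul_nonneg n3 (sq_nonneg |h 0|)]
  have hKfin : volume K ≠ ⊤ :=
    ((measure_mono interior_subset).trans_lt (isCompact_tri s).measure_lt_top).ne
  have : IsFiniteMeasure ((volume : Measure Plane).restrict K) :=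
    ⟨by rw [Measure.restrict_apply_univ]; exact hKfin.lt_top⟩
  have hint : ∀ {g : Plane → ℝ}, MemLp g ⊤ (volume.restrict U) → IntegrableOn g K := fun hg =>
    (hg.mono_measure (Measure.restrict_mono hsU le_rfl)).integrable le_top
  have chord := fun {a b : Plane} (ha : a ∈ K) (hb : b ∈ K) {r : ℝ} (hr : r ∈ Icc (0 : ℝ) 1) =>
    abs_sub_chord_le_of_hasWeakPartial (U := K) isOpen_interior (convex_tri s).interior
    (hc.mono interior_subset) (hint hu.1) (fun i => hint (hvm i))
    (fun i => (hv i).restrict hsU) (fun i j => (hw i j).restrict hsU)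
    (fun i j => ae_restrict_of_ae_restrict_of_subset hsU (hB i j)) hMB ha hb hr
  obtain ⟨c, hcK⟩ := h.interior_nonempty
  have chord' : ∀ a ∈ tri s, ∀ b ∈ tri s, ∀ r ∈ Icc (0 : ℝ) 1,
      |u (a + r • (b - a)) - ((1 - r) * u a + r * u b)| ≤
        M / 2 * ‖b - a‖ ^ 2 * (r * (1 - r)) := by
    intro a ha b hb r hr
    have hmove : ∀ y ∈ tri s, ∀ δ ∈ Ioc (0 : ℝ) 1, y + δ • (c - y) ∈ K := fun y hy δ hδ =>
      (convex_tri s).add_smul_sub_mem_interior hy hcK hδ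
    have hlim : ∀ y ∈ tri s, Filter.Tendsto (fun δ : ℝ => u (y + δ • (c - y)))
        (nhdsWithin 0 (Ioc 0 1)) (nhds (u y)) := by
      intro y hy
      refine (hc y hy).tendsto.comp (tendsto_nhdsWithin_iff.2 ⟨?_, ?_⟩)
      · have : Continuous fun δ : ℝ => y + δ • (c - y) := by fun_prop
        have h0 := this.tendsto 0
        rw [zero_smul, add_zero] at h0
        exact h0.mono_left nhdsWithin_le_nhds
      · filter_upwards [self_mem_nhdsWithin] with δ hδ
        exact interior_subset (hmove y hy δ hδ)
    have hy : a + r • (b - a) ∈ tri s := by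
      have := convex_tri s ha hb (sub_nonneg.2 hr.2) hr.1 (by ring)
      convert this using 1
      module
    have hrhs : Filter.Tendsto (fun δ : ℝ =>
        M / 2 * ‖(b + δ • (c - b)) - (a + δ • (c - a))‖ ^ 2 * (r * (1 - r)))
        (nhdsWithin 0 (Ioc 0 1)) (nhds (M / 2 * ‖b - a‖ ^ 2 * (r * (1 - r)))) := by
      have : Continuous fun δ : ℝ =>
        M / 2 * ‖(b + δ • (c - b)) - (a + δ • (c - a))‖ ^ 2 * (r * (1 - r)) := by fun_prop
      have h0 := this.tendsto 0
      simp only [zero_smul, add_zero] at h0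
      exact h0.mono_left nhdsWithin_le_nhds
    have : (nhdsWithin (0 : ℝ) (Ioc 0 1)).NeBot := by
      rw [← mem_closure_iff_nhdsWithin_neBot, closure_Ioc (by norm_num)]
      simp
    refine le_of_tendsto_of_tendsto ((hlim _ hy).sub (((hlim a ha).const_mul (1 - r)).add
      ((hlim b hb).const_mul r))).abs hrhs ?_
    filter_upwards [self_mem_nhdsWithin] with δ hδ
    have := chord (hmove a ha δ hδ) (hmove b hb δ hδ) hr
    have e : a + δ • (c - a) + r • (b + δ • (c - b) - (a + δ • (c - a))) =
        a + r • (b - a) + δ • (c - (a + r • (b - a))) := by module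
    rwa [e] at this
  have key : ∀ σ : ℝ, |σ| = 1 →
      σ * u x ≤ σ * vertexInterp s u x + M / 2 * Metric.diam (tri s) ^ 2 := by
    intro σ hσ
    have hconv : ConvexOn ℝ (tri s) fun y => σ * u y + M / 2 * ‖y - x‖ ^ 2 := by
      refine ⟨convex_tri s, fun a ha b hb p q hp hq hpq => ?_⟩
      have hch := chord' a ha b hb q ⟨hq, by linarith⟩
      have ep : p = 1 - q := by linarith
      have ey : p • a + q • b = a + q • (b - a) := by rw [ep]; module
      have en : ‖a + q • (b - a) - x‖ ^ 2 =
          p * ‖a - x‖ ^ 2 + q * ‖b - x‖ ^ 2 - p * q * ‖b - a‖ ^ 2 := by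
        have e1 : a + q • (b - a) - x = (a - x) + q • ((b - x) - (a - x)) := by module
        have e2 : b - a = (b - x) - (a - x) := by abel
        rw [e1, e2]
        generalize a - x = A
        generalize b - x = B
        rw [norm_add_sq_real, norm_smul, mul_pow, Real.norm_eq_abs, sq_abs, inner_smul_right,
          norm_sub_sq_real, inner_sub_right, real_inner_self_eq_norm_sq, real_inner_comm A B, ep]
        ring
      simp only [smul_eq_mul]
      rw [ey, en]
      have h1 : σ * (u (a + q • (b - a)) - ((1 - q) * u a + q * u b)) ≤
          M / 2 * ‖b - a‖ ^ 2 * (q * (1 - q)) := by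
        refine (le_abs_self _).trans ?_
        rw [abs_mul, hσ, one_mul]
        exact hch
      rw [ep]
      linarith
    have hJ := hconv.map_sum_le (t := s) (w := fun y => baryCoord s y x) (p := fun y => y)
      (h.mem_tri_iff.1 hx) (h.sum_baryCoord x) (fun y hy => vertex_mem_tri hy)
    rw [h.sum_baryCoord_smul x] at hJ
    simp only [sub_self, norm_zero, smul_eq_mul] at hJ
    have h2 : ∑ y ∈ s, baryCoord s y x * (σ * u y + M / 2 * ‖y - x‖ ^ 2) ≤
        ∑ y ∈ s, (σ * (baryCoord s y x * u y) +
          baryCoord s y x * (M / 2 * Metric.diam (tri s) ^ 2)) := by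
      refine Finset.sum_le_sum fun y hy => ?_
      have h3 := h.mem_tri_iff.1 hx y hy
      have h4 : ‖y - x‖ ≤ Metric.diam (tri s) := by
        rw [← dist_eq_norm]
        exact dist_le_diam_tri (vertex_mem_tri hy) hx
      have h5 : M / 2 * ‖y - x‖ ^ 2 ≤ M / 2 * Metric.diam (tri s) ^ 2 := by gcongr
      nlinarith [mul_le_mul_of_nonneg_left h5 h3]
    rw [Finset.sum_add_distrib, ← Finset.mul_sum, ← Finset.sum_mul, h.sum_baryCoord x, one_mul,
      ← vertexInterp_apply s u] at h2
    have := hJ.trans h2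
    simpa using this
  have k1 := key 1 (by simp)
  have k2 := key (-1) (by simp)
  have : M / 2 * Metric.diam (tri s) ^ 2 ≤ M * Metric.diam (tri s) ^ 2 := by
    have := mul_nonneg hM0 (sq_nonneg (Metric.diam (tri s)))
    linarith
  rw [abs_le]
  constructor <;> linarith

/-! ### The local error estimates -/

/-- The data of the a posteriori estimate on the patch of an element `τ`. Only the weak form of
the Poisson equation, tested with smooth functions, is needed. -/
structure LocalProblem (n : ℕ) (q : Fin n → ℝ) (ε₀ ε₁ κ : ℝ) where
  Ω : Set Plane
  T : Mesh Ω
  τ : Finset Plane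
  ε : Plane → ℝ
  f : Plane → ℝ
  φ : Plane → ℝ
  φh : Plane → ℝ
  p : Fin n → Plane → ℝ
  ph : Fin n → Plane → ℝ
  hε₀ : 0 < ε₀
  hκ : 0 < κ
  lip : IsLipschitzDomain Ω
  cont : ContinuousOn ε (closure Ω)
  bound : ∀ x ∈ closure Ω, ε₀ ≤ ε x ∧ ε x ≤ ε₁
  memf : MemH1 Ω f
  memφ : MemH1 Ω φ
  memφh : MemH1 Ω φh
  memp : ∀ i, MemH1 Ω (p i)
  memph : ∀ i, MemH1 Ω (ph i)
  linφh : T.PiecewiseLinear φh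
  linph : ∀ i, T.PiecewiseLinear (ph i)
  pot : ∀ w, MemH10 Ω w → ∫ x in Ω, ε x * inner ℝ (weakGrad Ω φ x) (weakGrad Ω w x) =
    ∫ x in Ω, (∑ i, q i * p i x + f x) * w x
  reg : T.ShapeRegular κ
  mem : τ ∈ T.elems
  w2 : MemW2Infty (interior (T.patch τ)) ε

namespace LocalProblem

variable {n : ℕ} {q : Fin n → ℝ} {ε₀ ε₁ κ : ℝ}

/-- The patch of the element. -/
def patch (S : LocalProblem n q ε₀ ε₁ κ) : Set Plane := S.T.patch S.τ

/-- The `W^{2,∞}` norm of the coefficient on the patch. -/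
def coeffNorm (S : LocalProblem n q ε₀ ε₁ κ) : ℝ := w2InftyNorm (interior S.patch) S.ε

/-- The error of the finite element solution on the patch. -/
def solError (S : LocalProblem n q ε₀ ε₁ κ) : ℝ :=
  l2Norm S.patch (weakGrad S.Ω (S.φ - S.φh)) +
    Metric.diam S.patch * ∑ i, l2Norm S.patch (S.p i - S.ph i)

/-- The higher order terms on the patch. -/
def higherOrder (S : LocalProblem n q ε₀ ε₁ κ) : ℝ :=
  Metric.diam S.patch ^ 2 * (S.coeffNorm * h1Norm S.Ω S.patch S.φh +
    l2Norm S.patch (weakGrad S.Ω S.f))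

/-- The error and the higher order terms on the patch. -/
def error (S : LocalProblem n q ε₀ ε₁ κ) : ℝ := S.solError + S.higherOrder

/-- The elements of the patch. -/
def InPatch (S : LocalProblem n q ε₀ ε₁ κ) (t : Finset Plane) : Prop :=
  t ∈ S.T.elems ∧ (tri t ∩ tri S.τ).Nonempty

variable (S : LocalProblem n q ε₀ ε₁ κ)

theorem tri_subset_patch {t : Finset Plane} (ht : S.InPatch t) : tri t ⊆ S.patch := by
  intro x hx
  simp only [patch, Mesh.patch, mem_iUnion, exists_prop]
  exact ⟨t, ht.1, ht.2, hx⟩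

theorem patch_subset_closure : S.patch ⊆ closure S.Ω := by
  simp only [patch, Mesh.patch, iUnion_subset_iff]
  exact fun t ht _ => S.T.tri_subset_closure ht

theorem diam_le {t : Finset Plane} (ht : S.InPatch t) :
    Metric.diam (tri t) ≤ Metric.diam S.patch :=
  Metric.diam_mono (S.tri_subset_patch ht)
    (S.lip.isBounded.closure.subset S.patch_subset_closure)

theorem isTri {t : Finset Plane} (ht : S.InPatch t) : IsTri t := S.T.isTri ht.1

theorem shapeReg {t : Finset Plane} (ht : S.InPatch t) : ShapeReg κ t := S.reg t ht.1

theorem restrict_closure :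
    (volume : Measure Plane).restrict (closure S.Ω) = volume.restrict S.Ω :=
  Measure.restrict_congr_set (S.T.closure_ae_eq S.lip)

theorem memLp_mono {F : Type} [NormedAddCommGroup F] {u : Plane → F}
    (hu : MemLp u 2 (volume.restrict S.Ω)) {D : Set Plane} (hD : D ⊆ closure S.Ω) :
    MemLp u 2 (volume.restrict D) := by
  rw [← S.restrict_closure] at hu
  exact hu.mono_measure (Measure.restrict_mono hD le_rfl)

theorem ae_mono {P : Plane → Prop} (h : ∀ᵐ x ∂volume.restrict S.Ω, P x) {D : Set Plane}
    (hD : D ⊆ closure S.Ω) : ∀ᵐ x ∂volume.restrict D, P x := by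
  rw [← S.restrict_closure] at h
  exact ae_restrict_of_ae_restrict_of_subset hD h

theorem memLp_tri {F : Type} [NormedAddCommGroup F] {u : Plane → F}
    (hu : MemLp u 2 (volume.restrict S.Ω)) {t : Finset Plane} (ht : S.InPatch t) :
    MemLp u 2 (volume.restrict (tri t)) := S.memLp_mono hu (S.T.tri_subset_closure ht.1)

theorem l2Norm_tri_le {F : Type} [NormedAddCommGroup F] {u : Plane → F}
    (hu : MemLp u 2 (volume.restrict S.Ω)) {t : Finset Plane} (ht : S.InPatch t) :
    l2Norm (tri t) u ≤ l2Norm S.patch u :=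
  l2Norm_mono (S.tri_subset_patch ht) (S.memLp_mono hu S.patch_subset_closure)

theorem coeffNorm_nonneg : 0 ≤ S.coeffNorm := w2InftyNorm_nonneg _ _

theorem concError_nonneg :
    0 ≤ Metric.diam S.patch * ∑ i, l2Norm S.patch (S.p i - S.ph i) :=
  mul_nonneg Metric.diam_nonneg (Finset.sum_nonneg fun _ _ => l2Norm_nonneg _ _)

theorem solError_nonneg : 0 ≤ S.solError :=
  add_nonneg (l2Norm_nonneg _ _) S.concError_nonneg

theorem higherOrder_nonneg : 0 ≤ S.higherOrder :=
  mul_nonneg (sq_nonneg _) (add_nonneg (mul_nonneg S.coeffNorm_nonneg (Real.sqrt_nonneg _))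
    (l2Norm_nonneg _ _))

theorem error_nonneg : 0 ≤ S.error := add_nonneg S.solError_nonneg S.higherOrder_nonneg

theorem solError_le : S.solError ≤ S.error := le_add_of_nonneg_right S.higherOrder_nonneg

theorem higherOrder_le : S.higherOrder ≤ S.error := le_add_of_nonneg_left S.solError_nonneg

/-- `∇φ_h` on an element. -/
def slope (t : Finset Plane) : Plane := elemGrad S.φh t

theorem exists_slope {t : Finset Plane} (ht : S.InPatch t) :
    ∃ c : ℝ, ∀ x ∈ tri t, S.φh x = inner ℝ (S.slope t) x + c := by
  have hex := S.linφh t ht.1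
  rw [slope, elemGrad, dif_pos hex]
  exact hex.choose_spec

theorem weakGrad_φh {t : Finset Plane} (ht : S.InPatch t) :
    ∀ᵐ x ∂volume.restrict (tri t), weakGrad S.Ω S.φh x = S.slope t := by
  obtain ⟨c, hc⟩ := S.exists_slope ht
  rw [← restrict_interior_tri]
  exact weakGrad_ae_eq_of_eqOn isOpen_interior (S.T.interior_subset S.lip ht.1) S.memφh
    fun x hx => hc x (interior_subset hx)

theorem memH1_sub_weakGrad :
    weakGrad S.Ω (S.φ - S.φh) =ᵐ[volume.restrict S.Ω] weakGrad S.Ω S.φ - weakGrad S.Ω S.φh :=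
  S.memφ.weakGrad_sub S.lip.isOpen S.memφh

theorem memLp_weakGrad_error : MemLp (weakGrad S.Ω (S.φ - S.φh)) 2 (volume.restrict S.Ω) :=
  (memLp_congr_ae S.memH1_sub_weakGrad).2
    ((S.memφ.memLp_weakGrad S.lip.isOpen).sub (S.memφh.memLp_weakGrad S.lip.isOpen))

theorem l2Norm_weakGrad_error_le {t : Finset Plane} (ht : S.InPatch t) :
    l2Norm (tri t) (weakGrad S.Ω (S.φ - S.φh)) ≤ S.error :=
  (S.l2Norm_tri_le S.memLp_weakGrad_error ht).trans
    ((le_add_of_nonneg_right S.concError_nonneg).trans S.solError_le)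

theorem l2Norm_conc_error_le {t : Finset Plane} (ht : S.InPatch t) (i : Fin n) :
    Metric.diam (tri t) * l2Norm (tri t) (S.p i - S.ph i) ≤ S.error := by
  have h7 : l2Norm (tri t) (S.p i - S.ph i) ≤ ∑ i, l2Norm S.patch (S.p i - S.ph i) :=
    (S.l2Norm_tri_le ((S.memp i).1.sub (S.memph i).1) ht).trans
      (Finset.single_le_sum (f := fun i => l2Norm S.patch (S.p i - S.ph i))
        (fun i _ => l2Norm_nonneg _ _) (Finset.mem_univ i))
  exact (mul_le_mul (S.diam_le ht) h7 (l2Norm_nonneg _ _) Metric.diam_nonneg).trans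
    ((le_add_of_nonneg_left (l2Norm_nonneg _ _)).trans S.solError_le)

theorem l2Norm_data_le {t : Finset Plane} (ht : S.InPatch t) :
    Metric.diam (tri t) ^ 2 * l2Norm (tri t) (weakGrad S.Ω S.f) ≤ S.error := by
  have h7 := S.l2Norm_tri_le (S.memf.memLp_weakGrad S.lip.isOpen) ht
  refine le_trans ?_ S.higherOrder_le
  refine mul_le_mul (pow_le_pow_left₀ Metric.diam_nonneg (S.diam_le ht) 2) (h7.trans ?_)
    (l2Norm_nonneg _ _) (sq_nonneg _)
  exact le_add_of_nonneg_left (mul_nonneg S.coeffNorm_nonneg (Real.sqrt_nonneg _))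

theorem coeff_slope_le {t : Finset Plane} (ht : S.InPatch t) :
    S.coeffNorm * Metric.diam (tri t) ^ 3 * ‖S.slope t‖ ≤ κ * S.error := by
  have hκ := S.hκ
  have hd := (S.isTri ht).diam_pos
  have h1 : Metric.diam (tri t) / κ * ‖S.slope t‖ ≤ l2Norm (tri t) (weakGrad S.Ω S.φh) := by
    refine l2Norm_const_ge (le_trans ?_ ((S.isTri ht).le_volume hκ (S.shapeReg ht)))
      (S.weakGrad_φh ht)
    exact le_mul_of_one_le_left (sq_nonneg _) (by linarith [Real.pi_gt_three])
  have h2 : l2Norm (tri t) (weakGrad S.Ω S.φh) ≤ h1Norm S.Ω S.patch S.φh := by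
    refine (S.l2Norm_tri_le (S.memφh.memLp_weakGrad S.lip.isOpen) ht).trans ?_
    exact Real.le_sqrt_of_sq_le (le_add_of_nonneg_left (sq_nonneg _))
  have h3 : Metric.diam (tri t) ^ 2 * (S.coeffNorm * (Metric.diam (tri t) / κ * ‖S.slope t‖)) ≤
      S.error := by
    refine le_trans ?_ S.higherOrder_le
    refine mul_le_mul (pow_le_pow_left₀ Metric.diam_nonneg (S.diam_le ht) 2) ?_
      (mul_nonneg S.coeffNorm_nonneg (by positivity)) (sq_nonneg _)
    refine (mul_le_mul_of_nonneg_left (h1.trans h2) S.coeffNorm_nonneg).trans ?_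
    exact le_add_of_nonneg_right (l2Norm_nonneg _ _)
  calc _ = κ * (Metric.diam (tri t) ^ 2 *
        (S.coeffNorm * (Metric.diam (tri t) / κ * ‖S.slope t‖))) := by field_simp
    _ ≤ _ := by gcongr

/-- The affine interpolant of the coefficient on an element. -/
def interp (t : Finset Plane) : Plane →ᵃ[ℝ] ℝ := vertexInterp t S.ε

theorem abs_sub_interp_le {t : Finset Plane} (ht : S.InPatch t) {x : Plane} (hx : x ∈ tri t) :
    |S.ε x - S.interp t x| ≤ S.coeffNorm * Metric.diam (tri t) ^ 2 :=
  (S.isTri ht).abs_sub_vertexInterp_le isOpen_interior (interior_mono (S.tri_subset_patch ht))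
    S.w2 (S.cont.mono (S.T.tri_subset_closure ht.1)) hx

theorem ε_le {x : Plane} (hx : x ∈ closure S.Ω) : |S.ε x| ≤ |ε₁| := by
  have h1 := S.bound x hx
  have h0 := S.hε₀
  rw [abs_of_pos (h0.trans_le h1.1)]
  exact h1.2.trans (le_abs_self _)

/-- The integrand of the weak form of the Poisson equation. -/
def potIntegrand (v : Plane → ℝ) (x : Plane) : ℝ :=
  S.ε x * inner ℝ (weakGrad S.Ω S.φ x) (grad v x) - (∑ i, q i * S.p i x + S.f x) * v x

theorem memLp_source : MemLp (fun x => ∑ i, q i * S.p i x + S.f x) 2 (volume.restrict S.Ω) :=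
  (memLp_finsetSum _ fun i _ => (S.memp i).1.const_mul (q i)).add S.memf.1

theorem aestronglyMeasurable_ε : AEStronglyMeasurable S.ε (volume.restrict S.Ω) := by
  rw [← S.restrict_closure]
  exact S.cont.aestronglyMeasurable isClosed_closure.measurableSet

theorem isFiniteMeasure_restrict : IsFiniteMeasure ((volume : Measure Plane).restrict S.Ω) :=
  ⟨by rw [Measure.restrict_apply_univ]; exact S.lip.isBounded.measure_lt_top⟩

theorem continuous_grad {v : Plane → ℝ} (hv : ContDiff ℝ ∞ v) : Continuous (grad v) := by
  have h1 : Continuous (fderiv ℝ v) := hv.continuous_fderiv (by simp)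
  unfold grad
  fun_prop

theorem integrableOn_flux {v : Plane → ℝ} (hv : ContDiff ℝ ∞ v) (hc : HasCompactSupport v) :
    IntegrableOn (fun x => S.ε x * inner ℝ (weakGrad S.Ω S.φ x) (grad v x)) S.Ω := by
  have := S.isFiniteMeasure_restrict
  have hG := S.memφ.memLp_weakGrad S.lip.isOpen
  obtain ⟨B, hB⟩ := (hc.fderiv ℝ).exists_bound_of_continuous (hv.continuous_fderiv (by simp))
  have hint : Integrable (fun x => |ε₁| * B * ‖weakGrad S.Ω S.φ x‖) (volume.restrict S.Ω) :=
    (hG.integrable (by norm_num)).norm.const_mul _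
  refine hint.mono' (S.aestronglyMeasurable_ε.mul (hG.1.inner
    (continuous_grad hv).aestronglyMeasurable)) ?_
  refine (ae_restrict_iff' S.lip.isOpen.measurableSet).2 (ae_of_all _ fun x hx => ?_)
  rw [norm_mul, Real.norm_eq_abs, mul_assoc]
  refine mul_le_mul (S.ε_le (subset_closure hx)) ?_ (norm_nonneg _) (abs_nonneg _)
  refine (norm_inner_le_norm _ _).trans ?_
  rw [mul_comm]
  exact mul_le_mul_of_nonneg_right ((norm_grad_le v x).trans (hB x)) (norm_nonneg _)

theorem integrableOn_source {v : Plane → ℝ} (hv : ContDiff ℝ ∞ v) (hc : HasCompactSupport v) :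
    IntegrableOn (fun x => (∑ i, q i * S.p i x + S.f x) * v x) S.Ω := by
  have := S.isFiniteMeasure_restrict
  obtain ⟨B, hB⟩ := hc.exists_bound_of_continuous hv.continuous
  exact (S.memLp_source.integrable (by norm_num)).mul_bdd
    hv.continuous.aestronglyMeasurable (c := B) (ae_of_all _ hB)

theorem integrableOn_potIntegrand {v : Plane → ℝ} (hv : ContDiff ℝ ∞ v)
    (hc : HasCompactSupport v) : IntegrableOn (S.potIntegrand v) S.Ω :=
  (S.integrableOn_flux hv hc).sub (S.integrableOn_source hv hc)

theorem integral_potIntegrand {v : Plane → ℝ} (hv : IsTestFunction S.Ω v) :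
    ∫ x in S.Ω, S.potIntegrand v x = 0 := by
  have h1 := S.pot v (hv.memH10 S.lip.isOpen)
  simp only [potIntegrand]
  rw [integral_sub (S.integrableOn_flux hv.1 hv.2.1) (S.integrableOn_source hv.1 hv.2.1), ← h1,
    sub_eq_zero]
  refine integral_congr_ae ?_
  filter_upwards [weakGrad_ae_eq_grad S.lip.isOpen (hv.1.of_le (by simp) : ContDiff ℝ 1 v)]
    with x hx
  rw [hx]

theorem potIntegrand_eq_zero {v : Plane → ℝ} {x : Plane} (hx : x ∉ tsupport v) :
    S.potIntegrand v x = 0 := by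
  have h1 : grad v x = 0 := by
    have h0 : fderiv ℝ v x = 0 :=
      image_eq_zero_of_notMem_tsupport fun h => hx (tsupport_fderiv_subset ℝ h)
    ext i
    simp [grad, h0]
  simp [potIntegrand, h1, image_eq_zero_of_notMem_tsupport hx]

/-- The affine function `x ↦ ⟨w, x⟩ + r` approximates the source term on the element `t`, and the
weak form of the equation on `t` is close to its counterpart with affine data. -/
structure IsAffineSource (C : ℝ) (t : Finset Plane) (w : Plane) (r : ℝ) : Prop where
  memLp : MemLp (fun x => ∑ i, q i * S.ph i x + S.f x - (inner ℝ w x + r)) 2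
    (volume.restrict (tri t))
  l2Norm_le : Metric.diam (tri t) *
    l2Norm (tri t) (fun x => ∑ i, q i * S.ph i x + S.f x - (inner ℝ w x + r)) ≤ C * S.error
  consistent : ∀ (v : Plane → ℝ) (G : ℝ), ContDiff ℝ ∞ v → HasCompactSupport v →
    (∀ x, |v x| ≤ G) → (∀ x, Metric.diam (tri t) * ‖fderiv ℝ v x‖ ≤ G) →
    |(∫ x in tri t, S.potIntegrand v x) - ∫ x in tri t,
      (S.interp t x * fderiv ℝ v x (S.slope t) - (inner ℝ w x + r) * v x)| ≤ C * G * S.error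

theorem exists_isAffineSource : ∃ C : ℝ, 0 ≤ C ∧ ∀ (S : LocalProblem n q ε₀ ε₁ κ)
    (t : Finset Plane), S.InPatch t → ∃ (w : Plane) (r : ℝ), S.IsAffineSource C t w r := by
  refine ⟨2 * |ε₁| + 6 * |κ| + 2 * ∑ i, |q i|, by positivity, fun S t ht => ?_⟩
  have hκ := S.hκ
  have hE := S.error_nonneg
  rw [abs_of_pos hκ]
  set h := Metric.diam (tri t) with hh
  have htri := S.isTri ht
  have hd : 0 < h := htri.diam_pos
  set a := S.slope t
  have hvf : volume (tri t) ≠ ⊤ := (isCompact_tri t).measure_ne_top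
  have hfin : IsFiniteMeasure ((volume : Measure Plane).restrict (tri t)) :=
    ⟨by rw [Measure.restrict_apply_univ]; exact hvf.lt_top⟩
  obtain ⟨cf, hcf⟩ := htri.exists_l2Norm_sub_const_le S.lip.isOpen hκ (S.shapeReg ht)
    (S.T.interior_subset S.lip ht.1) S.memf
  choose A c hAc using fun i => S.linph i t ht.1
  have hR : ∀ x ∈ tri t, ∑ i, q i * S.ph i x + cf =
      inner ℝ (∑ i, q i • A i) x + (∑ i, q i * c i + cf) := by
    intro x hx
    rw [sum_inner, ← add_assoc, ← Finset.sum_add_distrib]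
    congr 1
    refine Finset.sum_congr rfl fun i _ => ?_
    rw [hAc i x hx, real_inner_smul_left]
    ring
  have hfc : MemLp (fun x => S.f x - cf) 2 (volume.restrict (tri t)) :=
    (S.memLp_tri S.memf.1 ht).sub (memLp_const cf)
  have hae : (fun x => ∑ i, q i * S.ph i x + S.f x -
      (inner ℝ (∑ i, q i • A i) x + (∑ i, q i * c i + cf))) =ᵐ[volume.restrict (tri t)]
      fun x => S.f x - cf := by
    refine (ae_restrict_iff' (isCompact_tri t).isClosed.measurableSet).2
      (ae_of_all _ fun x hx => ?_)
    simp only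
    rw [← hR x hx]
    ring
  have hdata : h * l2Norm (tri t) (fun x => S.f x - cf) ≤ κ * S.error := by
    have h1 := S.l2Norm_data_le ht
    calc h * l2Norm (tri t) (fun x => S.f x - cf)
        ≤ h * (κ * h * l2Norm (tri t) (weakGrad S.Ω S.f)) := by gcongr
      _ = κ * (h ^ 2 * l2Norm (tri t) (weakGrad S.Ω S.f)) := by ring
      _ ≤ _ := by gcongr
  refine ⟨∑ i, q i • A i, ∑ i, q i * c i + cf, (memLp_congr_ae hae).2 hfc, ?_, ?_⟩
  · rw [l2Norm_congr hae]
    refine hdata.trans (mul_le_mul_of_nonneg_right ?_ hE)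
    have : 0 ≤ ∑ i, |q i| := Finset.sum_nonneg fun i _ => abs_nonneg _
    have := abs_nonneg ε₁
    linarith
  intro v G hv hc hG hG'
  have hG0 : 0 ≤ G := (abs_nonneg _).trans (hG 0)
  have hv1 : Continuous fun x => fderiv ℝ v x a :=
    (hv.continuous_fderiv (by simp)).clm_apply continuous_const
  have hLc : Continuous fun x => S.interp t x := by
    have : (fun x => S.interp t x) = fun x => inner ℝ (affGrad (S.interp t)) x + S.interp t 0 :=
      funext fun x => affine_eq _ x
    rw [this]
    fun_prop
  have i1 : IntegrableOn (S.potIntegrand v) (tri t) := by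
    have := S.integrableOn_potIntegrand hv hc
    rw [IntegrableOn, ← S.restrict_closure] at this
    exact IntegrableOn.mono_set this (S.T.tri_subset_closure ht.1)
  have i2 : IntegrableOn (fun x => S.interp t x * fderiv ℝ v x a -
      (inner ℝ (∑ i, q i • A i) x + (∑ i, q i * c i + cf)) * v x) (tri t) := by
    refine ContinuousOn.integrableOn_compact (isCompact_tri t) (Continuous.continuousOn ?_)
    exact (hLc.mul hv1).sub ((by fun_prop : Continuous fun x : Plane =>
      inner ℝ (∑ i, q i • A i) x + (∑ i, q i * c i + cf)).mul hv.continuous)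
  rw [← integral_sub i1 i2]
  have mG : ∀ i, MemLp (S.p i - S.ph i) 2 (volume.restrict (tri t)) := fun i =>
    S.memLp_tri ((S.memp i).1.sub (S.memph i).1) ht
  have mE := S.memLp_tri S.memLp_weakGrad_error ht
  set b : Plane → ℝ := fun x => G / h * |ε₁| * ‖weakGrad S.Ω (S.φ - S.φh) x‖ +
    G / h * (S.coeffNorm * h ^ 2 * ‖a‖) + (∑ i, G * |q i| * ‖(S.p i - S.ph i) x‖) +
    G * ‖S.f x - cf‖
  have j1 : Integrable (fun x => G / h * |ε₁| * ‖weakGrad S.Ω (S.φ - S.φh) x‖)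
    (volume.restrict (tri t)) := (mE.integrable (by norm_num)).norm.const_mul _
  have j2 : Integrable (fun _ : Plane => G / h * (S.coeffNorm * h ^ 2 * ‖a‖))
    (volume.restrict (tri t)) := integrable_const _
  have j3' : ∀ i, Integrable (fun x => G * |q i| * ‖(S.p i - S.ph i) x‖)
    (volume.restrict (tri t)) := fun i => ((mG i).integrable (by norm_num)).norm.const_mul _
  have j3 : Integrable (fun x => ∑ i, G * |q i| * ‖(S.p i - S.ph i) x‖)
    (volume.restrict (tri t)) := integrable_finsetSum _ fun i _ => j3' i
  have j4 : Integrable (fun x => G * ‖S.f x - cf‖) (volume.restrict (tri t)) :=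
    (hfc.integrable (by norm_num)).norm.const_mul _
  have hpt : ∀ᵐ x ∂volume.restrict (tri t), ‖S.potIntegrand v x -
      (S.interp t x * fderiv ℝ v x a -
        (inner ℝ (∑ i, q i • A i) x + (∑ i, q i * c i + cf)) * v x)‖ ≤ b x := by
    filter_upwards [S.weakGrad_φh ht, S.ae_mono S.memH1_sub_weakGrad
      (S.T.tri_subset_closure ht.1), ae_restrict_mem (isCompact_tri t).isClosed.measurableSet]
      with x hx1 hx2 hx
    have hgv : ‖grad v x‖ ≤ G / h := by
      rw [le_div_iff₀ hd, mul_comm]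
      exact (mul_le_mul_of_nonneg_left (norm_grad_le v x) hd.le).trans (hG' x)
    have e1 : weakGrad S.Ω S.φ x = weakGrad S.Ω (S.φ - S.φh) x + a := by
      rw [hx2, Pi.sub_apply, hx1, sub_add_cancel]
    have e2 : S.potIntegrand v x - (S.interp t x * fderiv ℝ v x a -
        (inner ℝ (∑ i, q i • A i) x + (∑ i, q i * c i + cf)) * v x) =
        S.ε x * inner ℝ (weakGrad S.Ω (S.φ - S.φh) x) (grad v x) +
        (S.ε x - S.interp t x) * inner ℝ a (grad v x) -
        (∑ i, q i * (S.p i - S.ph i) x) * v x - (S.f x - cf) * v x := by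
      rw [← hR x hx, potIntegrand, e1, inner_add_left, ← inner_grad]
      have : ∑ i, q i * (S.p i - S.ph i) x = ∑ i, q i * S.p i x - ∑ i, q i * S.ph i x := by
        rw [← Finset.sum_sub_distrib]
        exact Finset.sum_congr rfl fun i _ => by rw [Pi.sub_apply]; ring
      rw [this]
      ring
    rw [e2]
    refine (norm_sub_le _ _).trans (add_le_add ((norm_sub_le _ _).trans (add_le_add
      ((norm_add_le _ _).trans (add_le_add ?_ ?_)) ?_)) ?_)
    · rw [norm_mul, Real.norm_eq_abs, mul_assoc, mul_left_comm]
      refine mul_le_mul (S.ε_le (S.T.tri_subset_closure ht.1 hx)) ?_ (norm_nonneg _) (abs_nonneg _)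
      refine (norm_inner_le_norm _ _).trans ?_
      rw [mul_comm]
      exact mul_le_mul_of_nonneg_right hgv (norm_nonneg _)
    · rw [norm_mul, Real.norm_eq_abs]
      calc |S.ε x - S.interp t x| * ‖inner ℝ a (grad v x)‖
          ≤ S.coeffNorm * h ^ 2 * (‖a‖ * (G / h)) := by
            refine mul_le_mul (S.abs_sub_interp_le ht hx) ?_ (norm_nonneg _)
              (mul_nonneg S.coeffNorm_nonneg (sq_nonneg _))
            exact (norm_inner_le_norm _ _).trans (mul_le_mul_of_nonneg_left hgv (norm_nonneg _))
        _ = _ := by ring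
    · rw [norm_mul]
      calc ‖∑ i, q i * (S.p i - S.ph i) x‖ * ‖v x‖
          ≤ (∑ i, |q i| * ‖(S.p i - S.ph i) x‖) * G := by
            refine mul_le_mul ?_ (hG x) (norm_nonneg _) (Finset.sum_nonneg fun i _ => by positivity)
            refine (norm_sum_le _ _).trans (le_of_eq ?_)
            exact Finset.sum_congr rfl fun i _ => by rw [norm_mul, Real.norm_eq_abs]
        _ = _ := by
            rw [Finset.sum_mul]
            exact Finset.sum_congr rfl fun i _ => by ring
    · rw [norm_mul, mul_comm]
      exact mul_le_mul_of_nonneg_right (hG x) (norm_nonneg _)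
  rw [← Real.norm_eq_abs]
  refine (norm_integral_le_of_norm_le (((j1.add j2).add j3).add j4) hpt).trans ?_
  rw [integral_add' ((j1.add j2).add j3) j4, integral_add' (j1.add j2) j3, integral_add' j1 j2,
    integral_finsetSum _ fun i _ => j3' i]
  simp only [integral_const_mul, integral_const, smul_eq_mul]
  have h2h : (0 : ℝ) ≤ 2 * h := by positivity
  have hvol : (volume (tri t)).toReal ≤ (2 * h) ^ 2 := htri.volume_le
  have b1 : G / h * |ε₁| * ∫ x in tri t, ‖weakGrad S.Ω (S.φ - S.φh) x‖ ≤
      2 * |ε₁| * G * S.error := by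
    calc _ ≤ G / h * |ε₁| * (2 * h * S.error) := by
          gcongr
          exact (setIntegral_norm_le h2h hvf hvol mE).trans
            (mul_le_mul_of_nonneg_left (S.l2Norm_weakGrad_error_le ht) h2h)
      _ = _ := by field_simp
  have b2 : G / h * (S.coeffNorm * h ^ 2 *
      (((volume : Measure Plane).restrict (tri t)).real univ * ‖a‖)) ≤ 4 * κ * G * S.error := by
    have hM := S.coeffNorm_nonneg
    calc _ = ((volume : Measure Plane).restrict (tri t)).real univ *
          (G / h * (S.coeffNorm * h ^ 2 * ‖a‖)) := by ring
      _ ≤ (2 * h) ^ 2 * (G / h * (S.coeffNorm * h ^ 2 * ‖a‖)) := by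
          refine mul_le_mul_of_nonneg_right ?_ (by positivity)
          rw [measureReal_def, Measure.restrict_apply_univ]
          exact hvol
      _ = 4 * G * (S.coeffNorm * h ^ 3 * ‖a‖) := by field_simp; ring
      _ ≤ 4 * G * (κ * S.error) := by
          refine mul_le_mul_of_nonneg_left (S.coeff_slope_le ht) (by positivity)
      _ = _ := by ring
  have b3 : ∑ i, G * |q i| * ∫ x in tri t, ‖(S.p i - S.ph i) x‖ ≤
      2 * (∑ i, |q i|) * G * S.error := by
    rw [Finset.mul_sum, Finset.sum_mul, Finset.sum_mul]
    refine Finset.sum_le_sum fun i _ => ?_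
    calc _ ≤ G * |q i| * (2 * h * l2Norm (tri t) (S.p i - S.ph i)) := by
          gcongr
          exact setIntegral_norm_le h2h hvf hvol (mG i)
      _ = 2 * |q i| * G * (h * l2Norm (tri t) (S.p i - S.ph i)) := by ring
      _ ≤ _ := by
          gcongr
          exact S.l2Norm_conc_error_le ht i
  have b4 : G * ∫ x in tri t, ‖S.f x - cf‖ ≤ 2 * κ * G * S.error := by
    calc _ ≤ G * (2 * h * l2Norm (tri t) (fun x => S.f x - cf)) := by
          gcongr
          exact setIntegral_norm_le h2h hvf hvol hfc
      _ = 2 * G * (h * l2Norm (tri t) (fun x => S.f x - cf)) := by ring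
      _ ≤ 2 * G * (κ * S.error) := by gcongr
      _ = _ := by ring
  calc _ ≤ 2 * |ε₁| * G * S.error + 4 * κ * G * S.error + 2 * (∑ i, |q i|) * G * S.error +
        2 * κ * G * S.error := by
        exact add_le_add (add_le_add (add_le_add b1 b2) b3) b4
    _ = _ := by ring

end LocalProblem

theorem contDiff_affine (A : Plane →ᵃ[ℝ] ℝ) {n : WithTop ℕ∞} : ContDiff ℝ n fun x => A x := by
  have : (fun x => A x) = fun x => inner ℝ (affGrad A) x + A 0 := funext fun x => affine_eq _ x
  rw [this]
  exact contDiff_inner_add_const _ _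

theorem fderiv_affine (A : Plane →ᵃ[ℝ] ℝ) (x w : Plane) :
    fderiv ℝ (fun x => A x) x w = inner ℝ (affGrad A) w := by
  have : (fun x => A x) = fun x => inner ℝ (affGrad A) x + A 0 := funext fun x => affine_eq _ x
  rw [this, fderiv_inner_add_const]
  rfl

namespace LocalProblem

variable {n : ℕ} {q : Fin n → ℝ} {ε₀ ε₁ κ : ℝ} (S : LocalProblem n q ε₀ ε₁ κ)

theorem setIntegral_tri_of_support {t : Finset Plane} {u : Plane → ℝ} {K : Set Plane}
    (hK : K ⊆ tri t) (hu : ∀ x ∉ K, u x = 0) : ∫ x in tri t, u x = ∫ x, u x :=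
  setIntegral_eq_integral_of_forall_compl_eq_zero fun x hx => hu x fun h => hx (hK h)

/-- The residual of the affine data, `⟨w, x⟩ + r + ∇L · ∇φ_h`. -/
def affineResidual (t : Finset Plane) (w : Plane) (r : ℝ) (x : Plane) : ℝ :=
  inner ℝ w x + r + inner ℝ (affGrad (S.interp t)) (S.slope t)

theorem one_le_κ (S : LocalProblem n q ε₀ ε₁ κ) : 1 ≤ κ := by
  have h := S.T.isTri S.mem
  obtain ⟨a, ha, b, hb, hab⟩ := Finset.one_lt_card.1
    (show 1 < S.τ.card by rw [h.card]; norm_num)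
  have h1 := h.diam_le_mul_dist S.hκ (S.reg _ S.mem) ha hb hab
  have h2 := dist_le_diam_tri (vertex_mem_tri ha) (vertex_mem_tri hb)
  have h3 := h.diam_pos
  by_contra hlt
  have h4 : κ * dist a b ≤ κ * Metric.diam (tri S.τ) := mul_le_mul_of_nonneg_left h2 S.hκ.le
  nlinarith

/-- The element residual is controlled by the error. -/
theorem exists_residual_bound : ∃ C₀ C₁ : ℝ, 0 ≤ C₀ ∧ 0 ≤ C₁ ∧
    ∀ (S : LocalProblem n q ε₀ ε₁ κ) (t : Finset Plane), S.InPatch t →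
    ∃ (w : Plane) (r : ℝ), S.IsAffineSource C₀ t w r ∧
    ∀ x ∈ tri t, Metric.diam (tri t) ^ 2 * |S.affineResidual t w r x| ≤ C₁ * S.error := by
  obtain ⟨C₀, hC₀, hsrc⟩ := exists_isAffineSource (n := n) (q := q) (ε₀ := ε₀) (ε₁ := ε₁) (κ := κ)
  obtain ⟨Cb, hCb, hbump⟩ := exists_bump
  refine ⟨C₀, (1 + |κ|) * κ ^ 2 * (256 * (C₀ * (1 + 4 * Cb * |κ|))), hC₀, by positivity,
    fun S t ht => ?_⟩
  obtain ⟨w, r, hwr⟩ := hsrc S t ht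
  refine ⟨w, r, hwr, ?_⟩
  have hκ := S.hκ
  have hE := S.error_nonneg
  rw [abs_of_pos hκ]
  have htri := S.isTri ht
  obtain ⟨c, hc⟩ := S.shapeReg ht
  set h := Metric.diam (tri t) with hh
  have hd : 0 < h := htri.diam_pos
  set ρ := h / κ with hρdef
  have hρ : 0 < ρ := div_pos hd hκ
  have hρh : h = κ * ρ := by rw [hρdef]; field_simp
  set β := inner ℝ (affGrad (S.interp t)) (S.slope t)
  set R := S.affineResidual t w r with hR
  have hRsub : ∀ x, R x = R c + inner ℝ w (x - c) := fun x => by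
    simp only [R, affineResidual, inner_sub_right]
    ring
  obtain ⟨σ, hσ, hσR⟩ : ∃ σ : ℝ, |σ| = 1 ∧ σ * R c = |R c| := by
    rcases le_total 0 (R c) with h0 | h0
    · exact ⟨1, by simp, by rw [one_mul, abs_of_nonneg h0]⟩
    · exact ⟨-1, by simp, by rw [abs_of_nonpos h0]; ring⟩
  have hσ2 : σ * σ = 1 := by rw [← abs_mul_abs_self, hσ]; norm_num
  set Q := |R c| + ‖w‖ * ρ
  have hQ : 0 ≤ Q := by positivity
  set y₀ := c + (σ * (ρ / 2) * ‖w‖⁻¹) • w with hy₀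
  have hy₀c : ‖y₀ - c‖ ≤ ρ / 2 := by
    rw [hy₀, add_sub_cancel_left, norm_smul, Real.norm_eq_abs, abs_mul, abs_mul, hσ, one_mul,
      abs_of_pos (by positivity : 0 < ρ / 2), abs_inv, abs_norm, mul_assoc]
    rcases eq_or_ne ‖w‖ 0 with h0 | h0
    · rw [h0]; simp; positivity
    · rw [inv_mul_cancel₀ h0, mul_one]
  have hlow : ∀ x ∈ Metric.closedBall y₀ (ρ / 4), Q / 4 ≤ σ * R x := by
    intro x hx
    rw [Metric.mem_closedBall, dist_eq_norm] at hx
    have e1 : σ * R x = |R c| + ‖w‖ * (ρ / 2) + σ * inner ℝ w (x - y₀) := by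
      have e2 : x - c = (x - y₀) + (σ * (ρ / 2) * ‖w‖⁻¹) • w := by rw [hy₀]; module
      have e3 : ‖w‖⁻¹ * ‖w‖ ^ 2 = ‖w‖ := by
        rcases eq_or_ne ‖w‖ 0 with h0 | h0
        · rw [h0]; simp
        · field_simp
      rw [hRsub, e2, inner_add_right, inner_smul_right, real_inner_self_eq_norm_sq, mul_add, hσR]
      linear_combination (ρ / 2) * (‖w‖⁻¹ * ‖w‖ ^ 2) * hσ2 + (ρ / 2) * e3
    have e4 : |σ * inner ℝ w (x - y₀)| ≤ ‖w‖ * (ρ / 4) := by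
      rw [abs_mul, hσ, one_mul]
      exact (abs_real_inner_le_norm _ _).trans (mul_le_mul_of_nonneg_left hx (norm_nonneg _))
    have e5 := neg_abs_le (σ * inner ℝ w (x - y₀))
    have e6 : 0 ≤ |R c| := abs_nonneg _
    rw [e1]
    simp only [Q]
    linarith
  obtain ⟨v, hv, hvs, hv01, hv1, hvd⟩ := hbump y₀ (ρ / 4) (by positivity)
  have hcomp : HasCompactSupport v := (isCompact_closedBall y₀ (ρ / 4)).of_isClosed_subset
    (isClosed_tsupport v) hvs
  have hballK : Metric.closedBall y₀ (ρ / 4) ⊆ interior (tri t) := by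
    refine Subset.trans ?_ (IsTri.ball_subset_interior hc)
    intro x hx
    rw [Metric.mem_closedBall, dist_eq_norm] at hx
    rw [Metric.mem_ball, dist_eq_norm]
    calc ‖x - c‖ = ‖(x - y₀) + (y₀ - c)‖ := by congr 1; abel
      _ ≤ ρ / 4 + ρ / 2 := (norm_add_le _ _).trans (add_le_add hx hy₀c)
      _ < ρ := by linarith
  have hsupp : tsupport v ⊆ tri t := hvs.trans (hballK.trans interior_subset)
  have htest : IsTestFunction S.Ω v :=
    ⟨hv, hcomp, hvs.trans (hballK.trans (S.T.interior_subset S.lip ht.1))⟩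
  have hcons := hwr.consistent v (1 + 4 * Cb * κ) hv hcomp
    (fun x => by
      rw [abs_of_nonneg (hv01 x).1]
      have : 0 ≤ 4 * Cb * κ := by positivity
      linarith [(hv01 x).2])
    (fun x => by
      calc h * ‖fderiv ℝ v x‖ ≤ h * (Cb / (ρ / 4)) := by gcongr; exact hvd x
        _ = 4 * Cb * κ := by rw [hρh]; field_simp
        _ ≤ _ := by linarith)
  have hF : ∫ x in tri t, S.potIntegrand v x = 0 := by
    rw [← S.integral_potIntegrand htest]
    rw [setIntegral_tri_of_support hsupp fun x hx => S.potIntegrand_eq_zero hx]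
    exact (setIntegral_eq_integral_of_forall_compl_eq_zero fun x hx =>
      S.potIntegrand_eq_zero fun h => hx (htest.2.2 h)).symm
  have hv1' : ContDiff ℝ 1 v := hv.of_le (by simp)
  have hdc : Continuous fun x => fderiv ℝ v x (S.slope t) :=
    (hv1'.continuous_fderiv one_ne_zero).clm_apply continuous_const
  have hds : HasCompactSupport fun x => fderiv ℝ v x (S.slope t) :=
    hcomp.mono' ((subset_tsupport _).trans (tsupport_fderiv_apply_subset v _))
  have hLc : Continuous fun x => S.interp t x := (contDiff_affine (S.interp t) (n := 1)).continuous
  have hRc : Continuous R := by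
    simp only [R]
    unfold affineResidual
    fun_prop
  have hI : ∫ x in tri t, (S.interp t x * fderiv ℝ v x (S.slope t) - (inner ℝ w x + r) * v x) =
      -∫ x, R x * v x := by
    rw [setIntegral_tri_of_support hsupp fun x hx => ?_]
    · have i1 : Integrable fun x => S.interp t x * fderiv ℝ v x (S.slope t) :=
        (hLc.mul hdc).integrable_of_hasCompactSupport hds.mul_left
      have i2 : Integrable fun x => (inner ℝ w x + r) * v x :=
        ((by fun_prop : Continuous fun x : Plane => inner ℝ w x + r).mul
          hv.continuous).integrable_of_hasCompactSupport hcomp.mul_left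
      have i3 : Integrable fun x => β * v x :=
        (hv.continuous.integrable_of_hasCompactSupport hcomp).const_mul β
      rw [integral_sub i1 i2,
        integral_mul_fderiv_eq_neg (contDiff_affine (S.interp t)) hv1' hcomp]
      simp only [fderiv_affine]
      have e : (fun x => R x * v x) = fun x => (inner ℝ w x + r) * v x + β * v x := by
        funext x
        simp only [R, affineResidual, β]
        ring
      rw [e, integral_add i2 i3]
      ring
    · have h0 : fderiv ℝ v x = 0 :=
        image_eq_zero_of_notMem_tsupport fun h => hx (tsupport_fderiv_subset ℝ h)
      rw [h0, image_eq_zero_of_notMem_tsupport hx]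
      simp
  rw [hF, hI, zero_sub, neg_neg] at hcons
  have hlowI : Q / 4 * (ρ / 8) ^ 2 ≤ σ * ∫ x, R x * v x := by
    rw [← integral_const_mul]
    have i4 : Integrable fun x => σ * (R x * v x) :=
      ((hRc.mul hv.continuous).integrable_of_hasCompactSupport hcomp.mul_left).const_mul σ
    have hnn : ∀ x, 0 ≤ σ * (R x * v x) := by
      intro x
      by_cases hx : x ∈ Metric.closedBall y₀ (ρ / 4)
      · rw [← mul_assoc]
        exact mul_nonneg ((by positivity : 0 ≤ Q / 4).trans (hlow x hx)) (hv01 x).1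
      · rw [image_eq_zero_of_notMem_tsupport fun h => hx (hvs h)]
        simp
    calc Q / 4 * (ρ / 8) ^ 2
        ≤ ∫ x in Metric.closedBall y₀ (ρ / 4 / 2), Q / 4 := by
          rw [setIntegral_const, smul_eq_mul, measureReal_def,
            volume_closedBall_plane _ (by positivity), mul_comm]
          refine mul_le_mul_of_nonneg_right ?_ (by positivity)
          have e : ρ / 4 / 2 = ρ / 8 := by ring
          rw [e]
          exact le_mul_of_one_le_left (sq_nonneg _) (by linarith [Real.pi_gt_three])
      _ ≤ ∫ x in Metric.closedBall y₀ (ρ / 4 / 2), σ * (R x * v x) := by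
          refine setIntegral_mono_on (integrableOn_const (measure_closedBall_lt_top.ne))
            i4.integrableOn Metric.isClosed_closedBall.measurableSet fun x hx => ?_
          rw [hv1 x hx, mul_one]
          exact hlow x (Metric.closedBall_subset_closedBall (by linarith) hx)
      _ ≤ ∫ x, σ * (R x * v x) :=
          setIntegral_le_integral i4 (ae_of_all _ hnn)
  have hQρ : Q * ρ ^ 2 ≤ 256 * (C₀ * (1 + 4 * Cb * κ)) * S.error := by
    have h1 : σ * ∫ x, R x * v x ≤ C₀ * (1 + 4 * Cb * κ) * S.error := by
      refine (le_abs_self _).trans ?_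
      rw [abs_mul, hσ, one_mul]
      exact hcons
    linarith
  intro x hx
  have h1 : |R x| ≤ (1 + κ) * Q := by
    rw [hRsub]
    have h2 : |inner ℝ w (x - c)| ≤ ‖w‖ * h := by
      refine (abs_real_inner_le_norm _ _).trans (mul_le_mul_of_nonneg_left ?_ (norm_nonneg _))
      rw [← dist_eq_norm]
      exact dist_le_diam_tri hx (hc (Metric.mem_closedBall_self hρ.le))
    refine (abs_add_le _ _).trans ?_
    have h3 : ‖w‖ * h = κ * (‖w‖ * ρ) := by rw [hρh]; ring
    rw [h3] at h2
    have h4 : 0 ≤ κ * |R c| := by positivity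
    have h5 : 0 ≤ ‖w‖ * ρ := by positivity
    simp only [Q]
    nlinarith
  calc h ^ 2 * |R x| ≤ h ^ 2 * ((1 + κ) * Q) := by gcongr
    _ = (1 + κ) * κ ^ 2 * (Q * ρ ^ 2) := by rw [hρh]; ring
    _ ≤ (1 + κ) * κ ^ 2 * (256 * (C₀ * (1 + 4 * Cb * κ)) * S.error) := by gcongr
    _ = _ := by ring

end LocalProblem

/-! ### The jump of the gradient across an edge -/

theorem eq_inner_smul_of_inner_eq_zero {d n b : Plane} (hd : ‖d‖ = 1) (hn : ‖n‖ = 1)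
    (hdn : inner ℝ d n = 0) (hb : inner ℝ d b = 0) : b = (inner ℝ n b : ℝ) • n := by
  obtain ⟨Ψ, -, hΨ⟩ := exists_coordinates hd hn hdn 0
  obtain ⟨p, rfl⟩ := Ψ.surjective b
  have hnd : inner ℝ n d = 0 := by rw [real_inner_comm]; exact hdn
  simp only [hΨ, zero_add, inner_add_right, inner_smul_right, real_inner_self_eq_norm_sq, hd, hn,
    hdn, hnd] at hb ⊢
  have h1 : p.1 = 0 := by simpa using hb
  simp [h1]

/-- `n` is the unit normal, pointing into the triangle `t`, of the edge with end points `z`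
and `y`. -/
structure IsInnerNormal (κ : ℝ) (t : Finset Plane) (z y n : Plane) : Prop where
  norm_eq : ‖n‖ = 1
  inner_eq : inner ℝ n (y - z) = 0
  pos : ∀ x ∈ interior (tri t), 0 < inner ℝ n (x - midpoint ℝ z y)
  mem_tri : ∀ x, ‖x - midpoint ℝ z y‖ ≤ Metric.diam (tri t) / (2 * κ) →
    0 ≤ inner ℝ n (x - midpoint ℝ z y) → x ∈ tri t
  exists_vertex : ∃ x₃, (∀ x ∈ t, x = z ∨ x = y ∨ x = x₃) ∧ x₃ ∈ t ∧
    ∀ x, 0 < inner ℝ n (x - midpoint ℝ z y) → 0 < baryCoord t x₃ x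

theorem affine_midpoint (A : Plane →ᵃ[ℝ] ℝ) (z y : Plane) :
    A (midpoint ℝ z y) = (A z + A y) / 2 := by
  rw [AffineMap.map_midpoint, midpoint_eq_smul_add, smul_eq_mul, invOf_eq_inv]
  ring

theorem IsTri.exists_isInnerNormal {t : Finset Plane} (h : IsTri t) {κ : ℝ} (hκ : 0 < κ)
    (hr : ShapeReg κ t) {z y : Plane} (hz : z ∈ t) (hy : y ∈ t) (hzy : z ≠ y) :
    ∃ n, IsInnerNormal κ t z y n := by
  classical
  obtain ⟨x₃, hx₃⟩ : ∃ x₃, (t.erase z).erase y = {x₃} := by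
    rw [← Finset.card_eq_one, Finset.card_erase_of_mem (by simp [hy, hzy.symm]),
      Finset.card_erase_of_mem hz, h.card]
  have hall : ∀ x ∈ t, x = z ∨ x = y ∨ x = x₃ := by
    intro x hx
    by_cases h1 : x = z
    · exact Or.inl h1
    by_cases h2 : x = y
    · exact Or.inr (Or.inl h2)
    have : x ∈ (t.erase z).erase y := by simp [h1, h2, hx]
    rw [hx₃, Finset.mem_singleton] at this
    exact Or.inr (Or.inr this)
  obtain ⟨h3y, h3z, h3t⟩ : x₃ ≠ y ∧ x₃ ≠ z ∧ x₃ ∈ t := by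
    have : x₃ ∈ (t.erase z).erase y := by rw [hx₃]; simp
    simpa using this
  set g := affGrad (baryCoord t x₃) with hg
  set m := midpoint ℝ z y with hm
  have hd := h.diam_pos
  have hm0 : baryCoord t x₃ m = 0 := by
    rw [hm, affine_midpoint, h.baryCoord_of_ne hz h3z.symm, h.baryCoord_of_ne hy h3y.symm]
    simp
  have hb : ∀ x, baryCoord t x₃ x = inner ℝ g (x - m) := fun x => by
    have := affine_sub (baryCoord t x₃) x m
    rwa [hm0, sub_zero] at this
  have hg0 : g ≠ 0 := by
    intro h0
    have := hb x₃
    rw [h.baryCoord_self h3t, h0, inner_zero_left] at this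
    norm_num at this
  have hgn : 0 < ‖g‖ := norm_pos_iff.2 hg0
  have hb' : ∀ x, baryCoord t x₃ x = ‖g‖ * inner ℝ (‖g‖⁻¹ • g) (x - m) := fun x => by
    rw [hb, inner_smul_left, ← mul_assoc]
    simp [hgn.ne']
  refine ⟨‖g‖⁻¹ • g, ?_, ?_, ?_, ?_, x₃, hall, h3t, ?_⟩
  · rw [norm_smul, norm_inv, norm_norm, inv_mul_cancel₀ hgn.ne']
  · rw [inner_smul_left, ← affine_sub, h.baryCoord_of_ne hz h3z.symm,
      h.baryCoord_of_ne hy h3y.symm]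
    simp
  · intro x hx
    have := h.mem_interior_iff.1 hx x₃ h3t
    rw [hb'] at this
    exact (mul_pos_iff_of_pos_left hgn).1 this
  · intro x hx hpos
    have key : ∀ w ∈ t, baryCoord t w m = 1 / 2 → 0 ≤ baryCoord t w x := by
      intro w hw hwm
      have h1 := affine_sub (baryCoord t w) x m
      have h2 := abs_real_inner_le_norm (affGrad (baryCoord t w)) (x - m)
      have h3 : ‖affGrad (baryCoord t w)‖ * ‖x - m‖ ≤ 1 / 2 := by
        calc _ ≤ κ / Metric.diam (tri t) * (Metric.diam (tri t) / (2 * κ)) :=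
              mul_le_mul (h.norm_affGrad_baryCoord_le hκ hr hw) hx (norm_nonneg _) (by positivity)
          _ = 1 / 2 := by field_simp
      have h4 := neg_abs_le (inner ℝ (affGrad (baryCoord t w)) (x - m))
      rw [hwm] at h1
      linarith
    refine h.mem_tri_iff.2 fun w hw => ?_
    rcases hall w hw with rfl | rfl | rfl
    · refine key _ hw ?_
      rw [hm, affine_midpoint, h.baryCoord_self hz, h.baryCoord_of_ne hy hzy.symm]
      norm_num
    · refine key _ hw ?_
      rw [hm, affine_midpoint, h.baryCoord_self hy, h.baryCoord_of_ne hz hzy]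
      norm_num
    · rw [hb']
      exact mul_nonneg hgn.le hpos
  · intro x hx
    rw [hb']
    exact mul_pos hgn hx

/-- The inner normals of two elements that share an edge are opposite. -/
theorem Mesh.isInnerNormal_eq_neg {Ω : Set Plane} (T : Mesh Ω) {κ : ℝ} (hκ : 0 < κ)
    {t t' : Finset Plane} (ht : t ∈ T.elems) (ht' : t' ∈ T.elems) (hne : t ≠ t') {z y n n' : Plane}
    (hzy : z ≠ y) (hz : z ∈ t') (hy : y ∈ t') (hn : IsInnerNormal κ t z y n)
    (hn' : IsInnerNormal κ t' z y n') : n' = -n := by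
  set d := ‖y - z‖⁻¹ • (y - z) with hd
  have hyz : 0 < ‖y - z‖ := norm_pos_iff.2 (sub_ne_zero.2 hzy.symm)
  have hd1 : ‖d‖ = 1 := by
    rw [hd, norm_smul, norm_inv, norm_norm, inv_mul_cancel₀ hyz.ne']
  have hdn : inner ℝ d n = 0 := by
    rw [hd, inner_smul_left, real_inner_comm, hn.inner_eq, mul_zero]
  have hdn' : inner ℝ d n' = 0 := by
    rw [hd, inner_smul_left, real_inner_comm, hn'.inner_eq, mul_zero]
  have h1 := eq_inner_smul_of_inner_eq_zero hd1 hn.norm_eq hdn hdn'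
  have h2 : |(inner ℝ n n' : ℝ)| = 1 := by
    have := congrArg norm h1
    rw [norm_smul, hn.norm_eq, hn'.norm_eq, mul_one, Real.norm_eq_abs] at this
    exact this.symm
  rcases (abs_eq one_pos.le).1 h2 with h3 | h3
  · exfalso
    rw [h3, one_smul] at h1
    subst h1
    set ρ := min (Metric.diam (tri t) / (2 * κ)) (Metric.diam (tri t') / (2 * κ))
    have hρ : 0 < ρ := lt_min (div_pos (T.isTri ht).diam_pos (by positivity))
      (div_pos (T.isTri ht').diam_pos (by positivity))
    have e1 : midpoint ℝ z y + ρ • n' - midpoint ℝ z y = ρ • n' := by abel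
    have e2 : ‖midpoint ℝ z y + ρ • n' - midpoint ℝ z y‖ = ρ := by
      rw [e1, norm_smul, hn.norm_eq, mul_one, Real.norm_of_nonneg hρ.le]
    have e3 : (0 : ℝ) < inner ℝ n' (midpoint ℝ z y + ρ • n' - midpoint ℝ z y) := by
      rw [e1, inner_smul_right, real_inner_self_eq_norm_sq, hn.norm_eq]
      simpa using hρ
    have m1 := hn.mem_tri _ (by rw [e2]; exact min_le_left _ _) e3.le
    have m2 := hn'.mem_tri _ (by rw [e2]; exact min_le_right _ _) e3.le
    obtain ⟨x₃, hall, h3t, hpos⟩ := hn.exists_vertex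
    have h3t' := T.mem_of_vertex_mem_tri ht ht' h3t m1 m2 (hpos _ e3)
    refine hne (Finset.eq_of_subset_of_card_le (fun x hx => ?_)
      (by rw [T.card_eq t ht, T.card_eq t' ht']))
    rcases hall x hx with rfl | rfl | rfl
    exacts [hz, hy, h3t']
  · rw [h3, neg_one_smul] at h1
    exact h1

/-- Integration by parts on an element, for a function supported near the midpoint of an edge. -/
theorem IsInnerNormal.integral_fderiv {κ : ℝ} {t : Finset Plane} {z y n d : Plane}
    (hn : IsInnerNormal κ t z y n) (hd : ‖d‖ = 1) (hdn : inner ℝ d n = 0)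
    {u : Plane → ℝ} (hu : ContDiff ℝ 1 u) (hc : HasCompactSupport u)
    (hs : tsupport u ⊆ Metric.closedBall (midpoint ℝ z y) (Metric.diam (tri t) / (2 * κ)))
    (w : Plane) :
    ∫ x in tri t, fderiv ℝ u x w =
      -(inner ℝ n w * ∫ s : ℝ, u (midpoint ℝ z y + s • d)) := by
  set m := midpoint ℝ z y
  rw [← integral_halfPlane hd hn.norm_eq hdn m hu hc w]
  set H := {x : Plane | 0 < inner ℝ n (x - m)}
  have hH : IsOpen H := isOpen_lt continuous_const (by fun_prop)
  have h1 : ∫ x in H, fderiv ℝ u x w = ∫ x in H ∩ tri t, fderiv ℝ u x w := by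
    refine setIntegral_eq_of_subset_of_forall_sdiff_eq_zero hH.measurableSet inter_subset_left
      fun x hx => ?_
    have hxs : x ∉ tsupport u := by
      intro hxu
      have h2 := hs hxu
      rw [Metric.mem_closedBall, dist_eq_norm] at h2
      exact hx.2 ⟨hx.1, hn.mem_tri x h2 (le_of_lt hx.1)⟩
    rw [image_eq_zero_of_notMem_tsupport fun h => hxs (tsupport_fderiv_subset ℝ h)]
    rfl
  rw [h1, ← restrict_interior_tri]
  refine setIntegral_congr_set (Filter.EventuallyLE.antisymm ?_ ?_)
  · exact LE.le.eventuallyLE fun x hx => ⟨hn.pos x hx, interior_subset hx⟩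
  · exact (LE.le.eventuallyLE inter_subset_right).trans (interior_tri_ae_eq t).symm.le

namespace LocalProblem

variable {n : ℕ} {q : Fin n → ℝ} {ε₀ ε₁ κ : ℝ} (S : LocalProblem n q ε₀ ε₁ κ)

theorem le_interp {t : Finset Plane} (ht : S.InPatch t) {x : Plane} (hx : x ∈ tri t) :
    ε₀ ≤ S.interp t x := by
  have htri := S.isTri ht
  rw [interp, vertexInterp_apply]
  calc ε₀ = ∑ y ∈ t, baryCoord t y x * ε₀ := by rw [← Finset.sum_mul, htri.sum_baryCoord, one_mul]
    _ ≤ _ := Finset.sum_le_sum fun y hy => mul_le_mul_of_nonneg_left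
        (S.bound y (S.T.tri_subset_closure ht.1 (vertex_mem_tri hy))).1
        (htri.mem_tri_iff.1 hx y hy)

theorem inner_slope_sub_eq_zero {t t' : Finset Plane} (ht : S.InPatch t) (ht' : S.InPatch t')
    {z y : Plane} (hz : z ∈ t) (hz' : z ∈ t') (hy : y ∈ t) (hy' : y ∈ t') :
    inner ℝ (y - z) (S.slope t - S.slope t') = (0 : ℝ) := by
  obtain ⟨c, hc⟩ := S.exists_slope ht
  obtain ⟨c', hc'⟩ := S.exists_slope ht'
  have h1 := (hc z (vertex_mem_tri hz)).symm.trans (hc' z (vertex_mem_tri hz'))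
  have h2 := (hc y (vertex_mem_tri hy)).symm.trans (hc' y (vertex_mem_tri hy'))
  rw [real_inner_comm, inner_sub_right, inner_sub_left, inner_sub_left]
  linarith

theorem volume_inter_tri {t t' : Finset Plane} (ht : S.InPatch t) (ht' : S.InPatch t')
    (hne : t ≠ t') : volume (tri t ∩ tri t') = 0 := by
  refine measure_mono_null (fun x hx => ?_) (volume_frontier_tri t)
  rw [frontier, (isCompact_tri t).isClosed.closure_eq]
  exact ⟨hx.1, fun h => hne (S.T.eq_of_mem_interior ht.1 ht'.1 h hx.2)⟩

/-- The contribution of one element to the weak form, tested with a function supported near the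
midpoint of an edge. -/
theorem abs_integral_add_le {C₀ C₁ G : ℝ} {t : Finset Plane} (ht : S.InPatch t)
    {w : Plane} {r : ℝ} (hwr : S.IsAffineSource C₀ t w r) (hC₁ : 0 ≤ C₁)
    (hR : ∀ x ∈ tri t, Metric.diam (tri t) ^ 2 * |S.affineResidual t w r x| ≤ C₁ * S.error)
    {z y ν d : Plane} (hν : IsInnerNormal κ t z y ν) (hd : ‖d‖ = 1) (hdν : inner ℝ d ν = 0)
    {v : Plane → ℝ} (hv : ContDiff ℝ ∞ v) (hc : HasCompactSupport v)
    (hs : tsupport v ⊆ Metric.closedBall (midpoint ℝ z y) (Metric.diam (tri t) / (2 * κ)))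
    (hv01 : ∀ x, v x ∈ Icc (0 : ℝ) 1) (hG : 1 ≤ G)
    (hvd : ∀ x, Metric.diam (tri t) * ‖fderiv ℝ v x‖ ≤ G) :
    |(∫ x in tri t, S.potIntegrand v x) + inner ℝ ν (S.slope t) *
      ∫ s : ℝ, S.interp t (midpoint ℝ z y + s • d) * v (midpoint ℝ z y + s • d)| ≤
      (C₀ * G + 4 * C₁) * S.error := by
  have htri := S.isTri ht
  set h := Metric.diam (tri t)
  have hh : 0 < h := htri.diam_pos
  set a := S.slope t
  set L : Plane → ℝ := fun x => S.interp t x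
  set R := S.affineResidual t w r with hRdef
  have hL : ContDiff ℝ 1 L := contDiff_affine (S.interp t)
  have hv1 : ContDiff ℝ 1 v := hv.of_le (by simp)
  have hcons := hwr.consistent v G hv hc
    (fun x => by rw [abs_of_nonneg (hv01 x).1]; exact (hv01 x).2.trans hG) hvd
  have hu : ContDiff ℝ 1 fun x => L x * v x := hL.mul hv1
  have hparts := hν.integral_fderiv hd hdν hu hc.mul_left
    ((tsupport_mul_subset_right).trans hs) a
  have hfd : ∀ x, fderiv ℝ (fun x => L x * v x) x a =
      L x * fderiv ℝ v x a + inner ℝ (affGrad (S.interp t)) a * v x := fun x => by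
    rw [fderiv_fun_mul (hL.differentiable one_ne_zero x) (hv1.differentiable one_ne_zero x)]
    simp only [add_apply, smul_apply, smul_eq_mul]
    rw [show fderiv ℝ L x a = inner ℝ (affGrad (S.interp t)) a from fderiv_affine _ _ _]
    ring
  have hRc : Continuous R := by
    simp only [R]
    unfold affineResidual
    fun_prop
  have hdc : Continuous fun x => fderiv ℝ v x a :=
    (hv1.continuous_fderiv one_ne_zero).clm_apply continuous_const
  have iK : ∀ g : Plane → ℝ, Continuous g → IntegrableOn g (tri t) := fun g hg =>
    hg.continuousOn.integrableOn_compact (isCompact_tri t)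
  have hI : ∫ x in tri t, (L x * fderiv ℝ v x a - (inner ℝ w x + r) * v x) =
      (∫ x in tri t, fderiv ℝ (fun x => L x * v x) x a) - ∫ x in tri t, R x * v x := by
    have i1 : IntegrableOn (fun x => fderiv ℝ (fun x => L x * v x) x a) (tri t) :=
      iK _ ((hu.continuous_fderiv one_ne_zero).clm_apply continuous_const)
    have i2 : IntegrableOn (fun x => R x * v x) (tri t) := iK _ (hRc.mul hv.continuous)
    rw [← integral_sub i1 i2]
    refine integral_congr_ae (ae_of_all _ fun x => ?_)
    simp only [hfd, R, affineResidual, a]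
    ring
  have hK : |∫ x in tri t, R x * v x| ≤ 4 * C₁ * S.error := by
    have h1 := norm_setIntegral_le_of_norm_le_const (C := C₁ * S.error / h ^ 2)
      ((isCompact_tri t).measure_lt_top (μ := volume)) (f := fun x => R x * v x) (fun x hx => by
        rw [norm_mul, Real.norm_eq_abs, Real.norm_eq_abs, abs_of_nonneg (hv01 x).1,
          le_div_iff₀ (by positivity)]
        have h2 := hR x hx
        calc |R x| * v x * h ^ 2 ≤ |R x| * 1 * h ^ 2 := by
              gcongr
              exact (hv01 x).2
          _ = h ^ 2 * |R x| := by ring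
          _ ≤ _ := h2)
    rw [Real.norm_eq_abs, measureReal_def] at h1
    refine h1.trans ?_
    have h3 : 0 ≤ C₁ * S.error / h ^ 2 := div_nonneg (mul_nonneg hC₁ S.error_nonneg) (sq_nonneg _)
    calc _ ≤ C₁ * S.error / h ^ 2 * (2 * h) ^ 2 := mul_le_mul_of_nonneg_left htri.volume_le h3
      _ = _ := by field_simp; ring
  rw [hI, hparts] at hcons
  set J := ∫ s : ℝ, L (midpoint ℝ z y + s • d) * v (midpoint ℝ z y + s • d)
  set F := ∫ x in tri t, S.potIntegrand v x
  set K := ∫ x in tri t, R x * v x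
  have e : F + inner ℝ ν a * J = (F - (-(inner ℝ ν a * J) - K)) - K := by ring
  rw [e]
  refine (abs_sub _ _).trans ?_
  linarith

/-- The jump of `∇φ_h` across an edge of the patch is controlled by the error. -/
theorem exists_jump_bound : ∃ C : ℝ, 0 ≤ C ∧ ∀ (S : LocalProblem n q ε₀ ε₁ κ)
    (t t' : Finset Plane), S.InPatch t → S.InPatch t' → t ≠ t' → ∀ z y : Plane, z ≠ y →
    z ∈ t → z ∈ t' → y ∈ t → y ∈ t' →
    Metric.diam (tri t) * ‖S.slope t - S.slope t'‖ ≤ C * S.error := by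
  obtain ⟨C₀, C₁, hC₀, hC₁, hres⟩ :=
    exists_residual_bound (n := n) (q := q) (ε₀ := ε₀) (ε₁ := ε₁) (κ := κ)
  obtain ⟨Cb, hCb, hbump⟩ := exists_bump
  set G := 1 + 4 * Cb * |κ| ^ 3 with hG
  refine ⟨4 * |κ| ^ 2 / |ε₀| * (2 * (C₀ * G + 4 * C₁)), by positivity, ?_⟩
  intro S t t' ht ht' hne z y hzy hz hz' hy hy'
  have hκ := S.hκ
  have hκ1 := S.one_le_κ
  have hε₀ := S.hε₀
  have hE := S.error_nonneg
  rw [abs_of_pos hκ] at hG ⊢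
  rw [abs_of_pos hε₀]
  obtain ⟨w, r, hwr, hR⟩ := hres S t ht
  obtain ⟨w', r', hwr', hR'⟩ := hres S t' ht'
  have htri := S.isTri ht
  have htri' := S.isTri ht'
  obtain ⟨ν, hν⟩ := htri.exists_isInnerNormal hκ (S.shapeReg ht) hz hy hzy
  obtain ⟨ν', hν'⟩ := htri'.exists_isInnerNormal hκ (S.shapeReg ht') hz' hy' hzy
  have hneg := S.T.isInnerNormal_eq_neg hκ ht.1 ht'.1 hne hzy hz' hy' hν hν'
  have hhh' : Metric.diam (tri t) ≤ κ * Metric.diam (tri t') :=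
    (htri.diam_le_mul_dist hκ (S.shapeReg ht) hz hy hzy).trans
      (mul_le_mul_of_nonneg_left (dist_le_diam_tri (vertex_mem_tri hz') (vertex_mem_tri hy')) hκ.le)
  have hh'h : Metric.diam (tri t') ≤ κ * Metric.diam (tri t) :=
    (htri'.diam_le_mul_dist hκ (S.shapeReg ht') hz' hy' hzy).trans
      (mul_le_mul_of_nonneg_left (dist_le_diam_tri (vertex_mem_tri hz) (vertex_mem_tri hy)) hκ.le)
  have hh : 0 < Metric.diam (tri t) := htri.diam_pos
  set m := midpoint ℝ z y with hm
  set h := Metric.diam (tri t)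
  set h' := Metric.diam (tri t')
  set ρ := h / (4 * κ ^ 2) with hρdef
  have hρ : 0 < ρ := by positivity
  have hhρ : h = 4 * κ ^ 2 * ρ := by rw [hρdef]; field_simp
  have hκκ : κ ≤ κ ^ 2 := by nlinarith
  have hρ1 : 2 * ρ ≤ h / (2 * κ) := by
    rw [le_div_iff₀ (by positivity), hhρ]
    nlinarith
  have hρ2 : 2 * ρ ≤ h' / (2 * κ) := by
    rw [le_div_iff₀ (by positivity)]
    have : κ * (4 * κ * ρ) ≤ κ * h' := by rw [hhρ] at hhh'; linarith
    have := le_of_mul_le_mul_left this hκ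
    linarith
  set d := ‖y - z‖⁻¹ • (y - z) with hd
  have hyz : 0 < ‖y - z‖ := norm_pos_iff.2 (sub_ne_zero.2 hzy.symm)
  have hd1 : ‖d‖ = 1 := by
    rw [hd, norm_smul, norm_inv, norm_norm, inv_mul_cancel₀ hyz.ne']
  have hdν : inner ℝ d ν = 0 := by
    rw [hd, inner_smul_left, real_inner_comm, hν.inner_eq, mul_zero]
  have hdν' : inner ℝ d ν' = 0 := by
    rw [hneg, inner_neg_right, hdν, neg_zero]
  have hνd : inner ℝ ν d = 0 := by rw [real_inner_comm]; exact hdν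
  obtain ⟨v, hv, hvs, hv01, hvone, hvd⟩ := hbump m ρ hρ
  have hc : HasCompactSupport v := (isCompact_closedBall m ρ).of_isClosed_subset
    (isClosed_tsupport v) hvs
  have hcover : Metric.closedBall m (2 * ρ) ⊆ tri t ∪ tri t' := by
    intro x hx
    rw [Metric.mem_closedBall, dist_eq_norm] at hx
    rcases le_total 0 (inner ℝ ν (x - m) : ℝ) with h0 | h0
    · exact Or.inl (hν.mem_tri x (hx.trans hρ1) h0)
    · refine Or.inr (hν'.mem_tri x (hx.trans hρ2) ?_)
      rw [hneg, inner_neg_left]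
      exact neg_nonneg.2 h0
  have hballs : Metric.closedBall m ρ ⊆ Metric.ball m (2 * ρ) :=
    Metric.closedBall_subset_ball (by linarith)
  have hsupp : tsupport v ⊆ tri t ∪ tri t' :=
    hvs.trans (hballs.trans (Metric.ball_subset_closedBall.trans hcover))
  have htest : IsTestFunction S.Ω v := by
    refine ⟨hv, hc, hvs.trans (hballs.trans (Subset.trans ?_ S.lip.interior_closure_subset))⟩
    exact interior_maximal (Metric.ball_subset_closedBall.trans (hcover.trans
      (union_subset (S.T.tri_subset_closure ht.1) (S.T.tri_subset_closure ht'.1))))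
      Metric.isOpen_ball
  have hzero : (∫ x in tri t, S.potIntegrand v x) + ∫ x in tri t', S.potIntegrand v x = 0 := by
    have i0 : IntegrableOn (S.potIntegrand v) (closure S.Ω) := by
      rw [IntegrableOn, S.restrict_closure]
      exact S.integrableOn_potIntegrand hv hc
    rw [← setIntegral_union₀ (S.volume_inter_tri ht ht' hne)
      (isCompact_tri t').isClosed.measurableSet.nullMeasurableSet
      (i0.mono_set (S.T.tri_subset_closure ht.1)) (i0.mono_set (S.T.tri_subset_closure ht'.1)),
      ← S.integral_potIntegrand htest]
    rw [setIntegral_eq_integral_of_forall_compl_eq_zero fun x hx =>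
        S.potIntegrand_eq_zero fun h => hx (hsupp h),
      setIntegral_eq_integral_of_forall_compl_eq_zero fun x hx =>
        S.potIntegrand_eq_zero fun h => hx (htest.2.2 h)]
  have hG1 : 1 ≤ G := by rw [hG]; linarith [show 0 ≤ 4 * Cb * κ ^ 3 by positivity]
  have hGrad : ∀ ℓ ≤ κ * h, ∀ x, ℓ * ‖fderiv ℝ v x‖ ≤ G := by
    intro ℓ hℓ x
    calc ℓ * ‖fderiv ℝ v x‖ ≤ κ * h * (Cb / ρ) := by
          refine mul_le_mul hℓ (hvd x) (norm_nonneg _) (by positivity)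
      _ = 4 * Cb * κ ^ 3 := by rw [hhρ]; field_simp
      _ ≤ G := by rw [hG]; linarith
  have hh_le : h ≤ κ * h := le_mul_of_one_le_left hh.le hκ1
  have b1 := S.abs_integral_add_le ht hwr hC₁ hR hν hd1 hdν hv hc
    (hvs.trans (Metric.closedBall_subset_closedBall (by linarith))) hv01 hG1 (hGrad h hh_le)
  have b2 := S.abs_integral_add_le ht' hwr' hC₁ hR' hν' hd1 hdν' hv hc
    (hvs.trans (Metric.closedBall_subset_closedBall (by linarith))) hv01 hG1 (hGrad h' hh'h)
  have hline : ∀ s : ℝ, S.interp t' (m + s • d) = S.interp t (m + s • d) := by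
    intro s
    have key : ∀ u ∈ t, u ∈ t' → S.interp t' u = S.interp t u := fun u hu hu' => by
      rw [interp, interp, htri.vertexInterp_vertex _ hu, htri'.vertexInterp_vertex _ hu']
    have k1 := key z hz hz'
    have k2 := key y hy hy'
    have e1 := affine_sub (S.interp t) y z
    have e2 := affine_sub (S.interp t') y z
    rw [affine_add, affine_add, hm, affine_midpoint, affine_midpoint, k1, k2, hd, smul_smul,
      inner_smul_right, inner_smul_right, ← e1, ← e2, k1, k2]
  simp only [← hm, hline] at b1 b2
  set J := ∫ s : ℝ, S.interp t (m + s • d) * v (m + s • d) with hJ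
  have hmem : ∀ s : ℝ, |s| ≤ ρ → m + s • d ∈ tri t := by
    intro s hs
    refine hν.mem_tri _ ?_ ?_
    · rw [← hm, add_sub_cancel_left, norm_smul, hd1, mul_one, Real.norm_eq_abs]
      linarith
    · rw [← hm, add_sub_cancel_left, inner_smul_right, hνd, mul_zero]
  have hvz : ∀ s : ℝ, ρ < |s| → v (m + s • d) = 0 := by
    intro s hs
    refine image_eq_zero_of_notMem_tsupport fun hx => ?_
    have := hvs hx
    rw [Metric.mem_closedBall, dist_eq_norm, add_sub_cancel_left, norm_smul, hd1, mul_one,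
      Real.norm_eq_abs] at this
    linarith
  have hJlow : ε₀ * ρ ≤ J := by
    have hcont : Continuous fun s : ℝ => S.interp t (m + s • d) * v (m + s • d) :=
      ((contDiff_affine (S.interp t) (n := 1)).continuous.comp (by fun_prop)).mul
        (hv.continuous.comp (by fun_prop))
    have hcs : HasCompactSupport fun s : ℝ => S.interp t (m + s • d) * v (m + s • d) := by
      refine HasCompactSupport.of_support_subset_isCompact (isCompact_Icc (a := -ρ) (b := ρ))
        fun s hs => ?_
      by_contra hns
      refine hs ?_
      simp only
      rw [hvz s (not_le.1 fun hle => hns (abs_le.1 hle)), mul_zero]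
    have hint := hcont.integrable_of_hasCompactSupport (μ := volume) hcs
    have hnn : ∀ s : ℝ, 0 ≤ S.interp t (m + s • d) * v (m + s • d) := by
      intro s
      rcases le_or_gt |s| ρ with hs | hs
      · exact mul_nonneg (hε₀.le.trans (S.le_interp ht (hmem s hs))) (hv01 _).1
      · rw [hvz s hs, mul_zero]
    calc ε₀ * ρ = ∫ s in Icc (-(ρ / 2)) (ρ / 2), ε₀ := by
          rw [setIntegral_const, smul_eq_mul, measureReal_def, Real.volume_Icc,
            ENNReal.toReal_ofReal (by linarith)]
          ring
      _ ≤ ∫ s in Icc (-(ρ / 2)) (ρ / 2), S.interp t (m + s • d) * v (m + s • d) := by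
          refine setIntegral_mono_on (integrableOn_const (by simp)) hint.integrableOn
            measurableSet_Icc fun s hs => ?_
          have hs' : |s| ≤ ρ / 2 := abs_le.2 hs
          rw [hvone, mul_one]
          · exact S.le_interp ht (hmem s (by linarith))
          · rw [Metric.mem_closedBall, dist_eq_norm, add_sub_cancel_left, norm_smul, hd1, mul_one]
            exact hs'
      _ ≤ J := setIntegral_le_integral hint (ae_of_all _ hnn)
  have hJ0 : 0 ≤ J := (by positivity : 0 ≤ ε₀ * ρ).trans hJlow
  set b := S.slope t - S.slope t' with hb
  have hbd : inner ℝ d b = 0 := by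
    rw [hd, inner_smul_left, S.inner_slope_sub_eq_zero ht ht' hz hz' hy hy', mul_zero]
  have hbν : ‖b‖ = |(inner ℝ ν b : ℝ)| := by
    have := congrArg norm (eq_inner_smul_of_inner_eq_zero hd1 hν.norm_eq hdν hbd)
    rwa [norm_smul, hν.norm_eq, mul_one, Real.norm_eq_abs] at this
  have hsum : ‖b‖ * J ≤ 2 * (C₀ * G + 4 * C₁) * S.error := by
    have e : inner ℝ ν b * J =
        ((∫ x in tri t, S.potIntegrand v x) + inner ℝ ν (S.slope t) * J) +
        ((∫ x in tri t', S.potIntegrand v x) + inner ℝ ν' (S.slope t') * J) := by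
      rw [hneg, inner_neg_left, hb, inner_sub_right]
      linear_combination -hzero
    have e' : ‖b‖ * J = |inner ℝ ν b * J| := by rw [abs_mul, abs_of_nonneg hJ0, hbν]
    rw [e', e]
    refine (abs_add_le _ _).trans ?_
    linarith
  have hfin : ‖b‖ * (ε₀ * ρ) ≤ 2 * (C₀ * G + 4 * C₁) * S.error :=
    (mul_le_mul_of_nonneg_left hJlow (norm_nonneg _)).trans hsum
  calc h * ‖b‖ = 4 * κ ^ 2 / ε₀ * (‖b‖ * (ε₀ * ρ)) := by rw [hhρ]; field_simp
    _ ≤ 4 * κ ^ 2 / ε₀ * (2 * (C₀ * G + 4 * C₁) * S.error) := by gcongr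
    _ = _ := by ring

theorem inPatch_of_mem_star {z : Plane} (hz : z ∈ S.τ) {t : Finset Plane}
    (ht : t ∈ S.T.star z) : S.InPatch t :=
  ⟨(S.T.mem_star.1 ht).1, z, vertex_mem_tri (S.T.mem_star.1 ht).2, vertex_mem_tri hz⟩

theorem inPatch_self : S.InPatch S.τ := by
  obtain ⟨z, hz⟩ : S.τ.Nonempty := Finset.card_pos.1 (by rw [S.T.card_eq _ S.mem]; norm_num)
  exact ⟨S.mem, z, vertex_mem_tri hz, vertex_mem_tri hz⟩

/-- On the elements around a vertex of `τ`, the gradient `∇φ_h` differs from its value on `τ` by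
a quantity controlled by the error. -/
theorem exists_star_bound : ∃ C : ℝ, 0 ≤ C ∧ ∀ (S : LocalProblem n q ε₀ ε₁ κ),
    ∀ z ∈ S.τ, ∀ t ∈ S.T.star z,
    Metric.diam (tri S.τ) * ‖S.slope t - S.slope S.τ‖ ≤ C * S.error := by
  obtain ⟨C, hC, hjump⟩ := exists_jump_bound (n := n) (q := q) (ε₀ := ε₀) (ε₁ := ε₁) (κ := κ)
  refine ⟨⌈κ ^ 2⌉₊ * |κ| ^ ⌈κ ^ 2⌉₊ * C, by positivity, fun S z hz t ht => ?_⟩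
  have hκ := S.hκ
  have hκ1 := S.one_le_κ
  have hE := S.error_nonneg
  rw [abs_of_pos hκ]
  have walk : ∀ (u v : S.T.star z) (p : (S.T.starGraph z).Walk u v),
      Metric.diam (tri v.1) ≤ κ ^ p.length * Metric.diam (tri u.1) ∧
      Metric.diam (tri v.1) * ‖S.slope u.1 - S.slope v.1‖ ≤
        p.length * κ ^ p.length * C * S.error := by
    intro u v p
    induction p with
    | nil => simp
    | @cons u v w huv p ih =>
      obtain ⟨ih1, ih2⟩ := ih
      rw [SimpleGraph.Walk.length_cons]
      obtain ⟨hne, y, hyz, hyu, hyv⟩ := huv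
      have hu := S.inPatch_of_mem_star hz u.2
      have hv := S.inPatch_of_mem_star hz v.2
      have hzu := (S.T.mem_star.1 u.2).2
      have hzv := (S.T.mem_star.1 v.2).2
      have h1 : Metric.diam (tri v.1) ≤ κ * Metric.diam (tri u.1) :=
        ((S.isTri hv).diam_le_mul_dist hκ (S.shapeReg hv) hyv hzv hyz).trans
          (mul_le_mul_of_nonneg_left
            (dist_le_diam_tri (vertex_mem_tri hyu) (vertex_mem_tri hzu)) hκ.le)
      have h2 := hjump S v.1 u.1 hv hu (fun h => hne (Subtype.ext h.symm)) y z hyz hyv hyu hzv hzu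
      rw [norm_sub_rev] at h2
      set k := p.length
      refine ⟨?_, ?_⟩
      · calc _ ≤ κ ^ k * Metric.diam (tri v.1) := ih1
          _ ≤ κ ^ k * (κ * Metric.diam (tri u.1)) := by gcongr
          _ = _ := by ring
      · have h3 : ‖S.slope u.1 - S.slope w.1‖ ≤
            ‖S.slope u.1 - S.slope v.1‖ + ‖S.slope v.1 - S.slope w.1‖ :=
          norm_sub_le_norm_sub_add_norm_sub ..
        have h4 : Metric.diam (tri w.1) * ‖S.slope u.1 - S.slope v.1‖ ≤ κ ^ k * (C * S.error) := by
          calc _ ≤ κ ^ k * Metric.diam (tri v.1) * ‖S.slope u.1 - S.slope v.1‖ := by gcongr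
            _ = κ ^ k * (Metric.diam (tri v.1) * ‖S.slope u.1 - S.slope v.1‖) := by ring
            _ ≤ _ := by gcongr
        calc _ ≤ Metric.diam (tri w.1) * (‖S.slope u.1 - S.slope v.1‖ +
              ‖S.slope v.1 - S.slope w.1‖) :=
              mul_le_mul_of_nonneg_left h3 Metric.diam_nonneg
          _ ≤ κ ^ k * (C * S.error) + k * κ ^ k * C * S.error := by rw [mul_add]; linarith
          _ = ((k + 1 : ℕ) : ℝ) * κ ^ k * C * S.error := by push_cast; ring
          _ ≤ ((k + 1 : ℕ) : ℝ) * κ ^ (k + 1) * C * S.error := by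
              gcongr
              exact Nat.le_succ k
  have hτ : S.τ ∈ S.T.star z := S.T.mem_star.2 ⟨S.mem, hz⟩
  obtain ⟨p, hp⟩ := (S.T.starGraph_preconnected S.lip z ⟨t, ht⟩ ⟨S.τ, hτ⟩).exists_isPath
  have hlen : p.length ≤ ⌈κ ^ 2⌉₊ := by
    have h1 := hp.length_lt
    rw [Fintype.card_coe] at h1
    have h2 : (S.T.star z).card ≤ ⌈κ ^ 2⌉₊ := by
      have := (S.T.card_star_le hκ S.reg z).trans (Nat.le_ceil _)
      exact_mod_cast this
    omega
  refine (walk _ _ p).2.trans ?_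
  gcongr

theorem norm_nodalFlux_sub_le {wt : Plane → Finset Plane → ℝ} (hwt : S.T.IsWeight wt) {δ : ℝ}
    {z : Plane} (hz : z ∈ S.τ)
    (hδ : ∀ t ∈ S.T.star z, ‖S.slope t - S.slope S.τ‖ ≤ δ) :
    ‖S.T.nodalFlux wt S.ε S.φh z - S.ε z • S.slope S.τ‖ ≤ |ε₁| * δ := by
  obtain ⟨hnn, hsum⟩ := hwt z (S.T.subset_vertices S.mem hz)
  change ∑ t ∈ S.T.star z, wt z t = 1 at hsum
  have hε := S.ε_le (S.T.tri_subset_closure S.mem (vertex_mem_tri hz))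
  have h1 : S.T.nodalFlux wt S.ε S.φh z - S.ε z • S.slope S.τ =
      ∑ t ∈ S.T.star z, wt z t • (S.ε z • (S.slope t - S.slope S.τ)) := by
    change ∑ t ∈ S.T.star z, wt z t • (S.ε z • S.slope t) - _ = _
    simp only [smul_sub, Finset.sum_sub_distrib, ← Finset.sum_smul, hsum, one_smul]
  rw [h1]
  calc _ ≤ ∑ t ∈ S.T.star z, wt z t * (|ε₁| * δ) := by
        refine norm_sum_le_of_le _ fun t ht => ?_
        have ht' := S.T.mem_star.1 ht
        rw [norm_smul, norm_smul, Real.norm_of_nonneg (hnn t ht'.1 ht'.2), Real.norm_eq_abs]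
        exact mul_le_mul_of_nonneg_left
          (mul_le_mul hε (hδ t ht) (norm_nonneg _) (abs_nonneg _)) (hnn t ht'.1 ht'.2)
    _ = _ := by rw [← Finset.sum_mul, hsum, one_mul]

theorem inner_affGrad_interp (t : Finset Plane) (w : Plane) :
    inner ℝ (affGrad (S.interp t)) w =
      ∑ z ∈ t, inner ℝ (affGrad (baryCoord t z)) (S.ε z • w) := by
  have h1 := affine_sub (S.interp t) w 0
  rw [sub_zero] at h1
  rw [← h1, interp, vertexInterp_apply, vertexInterp_apply, ← Finset.sum_sub_distrib]
  refine Finset.sum_congr rfl fun z _ => ?_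
  have h2 := affine_sub (baryCoord t z) w 0
  rw [sub_zero] at h2
  rw [inner_smul_right, ← h2]
  ring

theorem exists_indicator_bound : ∃ C : ℝ, 0 ≤ C ∧ ∀ (S : LocalProblem n q ε₀ ε₁ κ)
    (wt : Plane → Finset Plane → ℝ), S.T.IsWeight wt →
    S.T.indicator wt S.ε S.f q S.ph S.φh S.τ ≤ C * S.error := by
  obtain ⟨C₀, C₁, hC₀, hC₁, hres⟩ :=
    exists_residual_bound (n := n) (q := q) (ε₀ := ε₀) (ε₁ := ε₁) (κ := κ)
  obtain ⟨C₂, hC₂, hstar⟩ := exists_star_bound (n := n) (q := q) (ε₀ := ε₀) (ε₁ := ε₁) (κ := κ)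
  refine ⟨C₀ + 2 * (C₁ + 3 * |κ| * (|ε₁| * C₂)) + 2 * (|ε₁| * C₂ + |κ|), by positivity,
    fun S wt hwt => ?_⟩
  have hκ := S.hκ
  have hE := S.error_nonneg
  rw [abs_of_pos hκ]
  obtain ⟨w, r, hwr, hR⟩ := hres S S.τ S.inPatch_self
  have htri := S.isTri S.inPatch_self
  have hh : 0 < Metric.diam (tri S.τ) := htri.diam_pos
  set τ := S.τ
  set h := Metric.diam (tri τ)
  set a := S.slope τ
  set F := S.T.nodalFlux wt S.ε S.φh
  set δ := |ε₁| * (C₂ * S.error / h) with hδ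
  have hδ0 : 0 ≤ δ := by positivity
  have hF : ∀ z ∈ τ, ‖F z - S.ε z • a‖ ≤ δ := fun z hz =>
    S.norm_nodalFlux_sub_le hwt hz fun t ht => by
      rw [le_div_iff₀ hh, mul_comm]
      exact hstar S z hz t ht
  have hvf : volume (tri τ) ≠ ⊤ := (isCompact_tri τ).measure_ne_top
  have : IsFiniteMeasure ((volume : Measure Plane).restrict (tri τ)) :=
    ⟨by rw [Measure.restrict_apply_univ]; exact hvf.lt_top⟩
  have hint : ∀ᵐ x ∂(volume : Measure Plane).restrict (tri τ), x ∈ interior (tri τ) := by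
    rw [← restrict_interior_tri]
    exact ae_restrict_mem isOpen_interior.measurableSet
  have hcoeff := S.coeff_slope_le S.inPatch_self
  have hdef : l2Norm (tri τ) (S.T.defect wt S.ε S.φh τ) ≤ 2 * (|ε₁| * C₂ + κ) * S.error := by
    have hM := S.coeffNorm_nonneg
    refine (l2Norm_le_of_bound (ℓ := 2 * h) (c := δ + S.coeffNorm * h ^ 2 * ‖a‖) (by positivity)
      (by positivity) hvf htri.volume_le ?_).trans ?_
    · filter_upwards [hint] with x hx
      have hxt := interior_subset hx
      have e : S.T.defect wt S.ε S.φh τ x =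
          ∑ z ∈ τ, baryCoord τ z x • (F z - S.ε z • a) - (S.ε x - S.interp τ x) • a := by
        rw [Mesh.defect, S.T.recoveredFlux_eq wt S.ε S.φh S.mem hx, interp, vertexInterp_apply]
        simp only [smul_sub, Finset.sum_sub_distrib, sub_smul, Finset.sum_smul, smul_smul]
        change _ - S.ε x • a = _
        abel
      rw [e]
      refine (norm_sub_le _ _).trans (add_le_add ?_ ?_)
      · calc _ ≤ ∑ z ∈ τ, baryCoord τ z x * δ := by
              refine norm_sum_le_of_le _ fun z hz => ?_
              have h0 := htri.mem_tri_iff.1 hxt z hz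
              rw [norm_smul, Real.norm_of_nonneg h0]
              exact mul_le_mul_of_nonneg_left (hF z hz) h0
          _ = δ := by rw [← Finset.sum_mul, htri.sum_baryCoord, one_mul]
      · rw [norm_smul]
        exact mul_le_mul_of_nonneg_right (S.abs_sub_interp_le S.inPatch_self hxt) (norm_nonneg _)
    · calc 2 * h * (δ + S.coeffNorm * h ^ 2 * ‖a‖)
          = 2 * (|ε₁| * C₂ * S.error) + 2 * (S.coeffNorm * h ^ 3 * ‖a‖) := by
            rw [hδ]; field_simp
        _ ≤ 2 * (|ε₁| * C₂ * S.error) + 2 * (κ * S.error) := by linarith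
        _ = _ := by ring
  have hresid : h * l2Norm (tri τ) (S.T.residual wt S.ε S.f q S.ph S.φh) ≤
      (C₀ + 2 * (C₁ + 3 * κ * (|ε₁| * C₂))) * S.error := by
    set β := ∑ z ∈ τ, inner ℝ (affGrad (baryCoord τ z)) (F z - S.ε z • a)
    have hβ : |β| ≤ 3 * (κ / h * δ) := by
      rw [← Real.norm_eq_abs]
      calc _ ≤ ∑ z ∈ τ, κ / h * δ := by
            refine norm_sum_le_of_le _ fun z hz => ?_
            refine (norm_inner_le_norm _ _).trans ?_
            exact mul_le_mul (htri.norm_affGrad_baryCoord_le hκ (S.shapeReg S.inPatch_self) hz)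
              (hF z hz) (norm_nonneg _) (by positivity)
        _ = _ := by rw [Finset.sum_const, htri.card, nsmul_eq_mul]; norm_num
    set u₁ : Plane → ℝ := fun x => ∑ i, q i * S.ph i x + S.f x - (inner ℝ w x + r)
    set u₂ : Plane → ℝ := fun x => S.affineResidual τ w r x + β
    have hu₂ : ∀ᵐ x ∂(volume : Measure Plane).restrict (tri τ),
        ‖u₂ x‖ ≤ C₁ * S.error / h ^ 2 + 3 * (κ / h * δ) := by
      filter_upwards [hint] with x hx
      refine (norm_add_le _ _).trans (add_le_add ?_ hβ)
      rw [le_div_iff₀ (by positivity), mul_comm]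
      exact hR x (interior_subset hx)
    have hc : Continuous u₂ := by
      simp only [u₂]
      unfold affineResidual
      fun_prop
    have hmem₂ : MemLp u₂ 2 (volume.restrict (tri τ)) :=
      MemLp.of_bound hc.aestronglyMeasurable _ hu₂
    have hsum : l2Norm (tri τ) (S.T.residual wt S.ε S.f q S.ph S.φh) =
        l2Norm (tri τ) (u₁ + u₂) := by
      refine l2Norm_congr ?_
      filter_upwards [hint] with x hx
      rw [Mesh.residual, S.T.divergence_recoveredFlux wt S.ε S.φh S.mem hx]
      simp only [Pi.add_apply, u₁, u₂, affineResidual, S.inner_affGrad_interp, β, inner_sub_right,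
        Finset.sum_sub_distrib]
      simp only [F, a]
      ring
    have hb₂ := l2Norm_le_of_bound (ℓ := 2 * h) (by positivity) (by positivity) hvf
      htri.volume_le hu₂
    rw [hsum]
    calc h * l2Norm (tri τ) (u₁ + u₂)
        ≤ h * (l2Norm (tri τ) u₁ + 2 * h * (C₁ * S.error / h ^ 2 + 3 * (κ / h * δ))) := by
          gcongr
          exact (l2Norm_add_le hwr.memLp hmem₂).trans (add_le_add le_rfl hb₂)
      _ = h * l2Norm (tri τ) u₁ + 2 * (C₁ + 3 * κ * (|ε₁| * C₂)) * S.error := by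
          rw [hδ]; field_simp
      _ ≤ C₀ * S.error + 2 * (C₁ + 3 * κ * (|ε₁| * C₂)) * S.error :=
          add_le_add hwr.l2Norm_le le_rfl
      _ = _ := by ring
  rw [Mesh.indicator]
  linarith

end LocalProblem

theorem Mesh.one_le_patchFactor {Ω : Set Plane} (T : Mesh Ω) (ε : Plane → ℝ) (s : Finset Plane) :
    1 ≤ T.patchFactor ε s :=
  (Finset.le_fold_max _).2 (Or.inl le_rfl)

end PNP

end

open MeasureTheory PNP in
theorem mainTheorem3 (n : ℕ) (q : Fin n → ℝ) (ε₀ ε₁ κ : ℝ) (hε₀ : 0 < ε₀) (hκ : 0 < κ) :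
    ∃ C : ℝ, 0 < C ∧
      ∀ Ω : Set Plane, IsLipschitzDomain Ω →
      ∀ (α : Fin n → Plane → ℝ → ℝ) (β : Fin n → Plane → ℝ → Plane)
        (γ g : Fin n → Plane → ℝ → ℝ) (ε f : Plane → ℝ),
      ContinuousOn ε (closure Ω) → (∀ x ∈ closure Ω, ε₀ ≤ ε x ∧ ε x ≤ ε₁) → MemH1 Ω f →
      ∀ (p : Fin n → Plane → ℝ) (φ : Plane → ℝ),
      Solves Ω α β γ g ε f q (MemH10 Ω) p φ →
      ∀ T : Mesh Ω, T.ShapeRegular κ →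
      ∀ wt : Plane → Finset Plane → ℝ, T.IsWeight wt →
      ∀ (ph : Fin n → Plane → ℝ) (φh : Plane → ℝ),
      Solves Ω α β γ g ε f q T.MemS0 ph φh →
      ∀ τ ∈ T.elems, MemW2Infty (interior (T.patch τ)) ε →
      ∃ r : ℝ,
        T.indicator wt ε f q ph φh τ ≤
          C * T.patchFactor ε τ *
            (l2Norm (T.patch τ) (weakGrad Ω (φ - φh)) +
              Metric.diam (T.patch τ) * ∑ i, l2Norm (T.patch τ) (p i - ph i)) + r ∧
        r ≤ C * T.patchFactor ε τ * Metric.diam (T.patch τ) ^ 2 *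
          (w2InftyNorm (interior (T.patch τ)) ε * h1Norm Ω (T.patch τ) φh +
            l2Norm (T.patch τ) (weakGrad Ω f)) := by
  obtain ⟨C, hC, hbound⟩ :=
    LocalProblem.exists_indicator_bound (n := n) (q := q) (ε₀ := ε₀) (ε₁ := ε₁) (κ := κ)
  refine ⟨C + 1, by positivity, ?_⟩
  intro Ω hΩ α β γ g ε f hε hεb hf p φ hsol T hT wt hwt ph φh hsolh τ hτ hw2
  set S : LocalProblem n q ε₀ ε₁ κ :=
    { Ω, T, τ, ε, f, φ, φh, p, ph, hε₀, hκ
      lip := hΩ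
      cont := hε
      bound := hεb
      memf := hf
      memφ := hsol.mem_pot.1
      memφh := hsolh.mem_pot.1.1
      memp := fun i => (hsol.mem_conc i).1
      memph := fun i => (hsolh.mem_conc i).1.1
      linφh := hsolh.mem_pot.2
      linph := fun i => (hsolh.mem_conc i).2
      pot := hsol.pot
      reg := hT
      mem := hτ
      w2 := hw2 }
  have hξ := T.one_le_patchFactor ε τ
  refine ⟨_, ?_, le_rfl⟩
  have h1 : T.indicator wt ε f q ph φh τ ≤ C * (S.solError + S.higherOrder) := hbound S wt hwt
  have h2 : C * (S.solError + S.higherOrder) ≤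
      (C + 1) * T.patchFactor ε τ * (S.solError + S.higherOrder) := by
    refine mul_le_mul_of_nonneg_right ?_ S.error_nonneg
    nlinarith
  refine h1.trans (h2.trans (le_of_eq ?_))
  rw [mul_add, LocalProblem.higherOrder, ← mul_assoc]
  rfl
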